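/- **Theorem 4.4 (Stability of the SD discretization).** Let $d\ge 1$, let $\widetilde{\mathcal M}$ be a closed $d$-manifold with a finite mesh $\mathcal K^h$ whose cells are parametrized by convex bodies of $\mathbb R^d$, and let $\mathbb V$ be a finite-dimensional space of continuous real functions on $\widetilde{\mathcal M}$ that are smooth on each closed cell, with $1\in\mathbb V$. Let $s\ge 1$ and $0=t_0<t_1<\dots<t_N=T$, $T_n=(t_n,t_{n+1})$, and write $\mathbb P_k(T_n;W)$ for the polynomials in time of degree at most $k$ with values in $W$. Let $\mathbf X$ be continuous in time on $[0,T]$ with prescribed initial value $\mathbf X_{t_0}$, and for each $n<N$ let $\mathbf X\in\mathbb P_s(T_n;\mathbb V^{d+1})$ and $(p,\mathbf R,\kappa)\in\mathbb P_{s-1}(T_n;\mathbb V\times\mathbb V^{d+1}\times\mathbb V)$ satisfy $$\int_{T_n}(\dot{\mathbf X}\cdot\mathbf n,y)_{\mathcal M}=\int_{T_n}(\nabla_{\mathcal M}\kappa,\nabla_{\mathcal M}y)_{\mathcal M},$$ $$\int_{T_n}\big[(\nabla_{\mathcal M}\dot{\mathbf X},\nabla_{\mathcal M}\mathbf Q)_{\mathcal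 M}+(p\,\mathbf n,\mathbf Q)_{\mathcal M}\big]=0,$$ $$\int_{T_n}(\mathbf R\cdot\mathbf n,q)_{\mathcal M}=0,$$ $$\int_{T_n}\big[(\nabla_{\mathcal M}\mathbf R,\nabla_{\mathcal M}\boldsymbol\Lambda)_{\mathcal M}+(\kappa\,\mathbf n,\boldsymbol\Lambda)_{\mathcal M}\big]=-\int_{T_n}(\nabla_{\mathcal M}\mathbf X,\nabla_{\mathcal M}\boldsymbol\Lambda)_{\mathcal M}$$ for all $(y,\mathbf Q,q,\boldsymbol\Lambda)\in\mathbb P_{s-1}(T_n;\mathbb V\times\mathbb V^{d+1}\times\mathbb V\times\mathbb V^{d+1})$. Here $\mathcal M=\mathcal M_t=\mathbf X_t(\widetilde{\mathcal M})\subset\mathbb R^{d+1}$; $\nabla_{\mathcal M}$ is the surface gradient, taken cell by cell; $(\cdot,\cdot)_{\mathcal M}$ and $\|\cdot\|_{\mathcal M}$ are the $L^2(\mathcal M)$ inner product and norm, evaluated by pullback to the cells with the Jacobian $J=\sqrt{\det\mathbf G}$, where $\mathbf G$ is the metric tensor of $\mathbf X_t$ in the coordinates of the cell; and $\mathbf n$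 is the outward unit normal. Assume that no singularity forms: for every $t\in[0,T]$ the map $\mathbf X_t$ is injective, $\mathcal M_t=\partial\Omega_t$ for a bounded Lipschitz domain $\Omega_t\subset\mathbb R^{d+1}$ (a bounded open set, not necessarily connected, that is locally the region below a Lipschitz graph), and $J>0$ on every closed cell. Let $V(t)$ be the volume (Lebesgue measure) of $\Omega_t$ and $S(t)=\sum_{K\in\mathcal K^h}\int_K J$ the surface area of $\mathcal M_t$. Then, for every $n<N$, $$V(t_{n+1})=V(t_n),\qquad S(t_{n+1})-S(t_n)=-\int_{T_n}\|\nabla_{\mathcal M}\kappa\|_{\mathcal M}^2\le 0 .$$ -/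

import Mathlib

open MeasureTheory Set
open scoped NNReal ContDiff

namespace SurfFEM

/-- The space `ℝ^d` of local coordinates of a cell. -/
abbrev Coord (d : ℕ) : Type := EuclideanSpace ℝ (Fin d)

/-- The ambient space `ℝ^(d+1)`. -/
abbrev Ambient (d : ℕ) : Type := EuclideanSpace ℝ (Fin (d + 1))

/-- A finite mesh of the reference `d`-manifold `M`. Every cell is the homeomorphic image of a convex
body of `ℝ^d` (for instance a simplex or a cube); the cells cover `M`, and the interior of a cell does
not meet any other cell. -/
structure Mesh (d : ℕ) (M : Type*) [TopologicalSpace M] where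
  /-- the (indices of the) cells -/
  Cell : Type
  fintypeCell : Fintype Cell
  /-- the coordinate domain of a cell -/
  dom : Cell → Set (Coord d)
  /-- the parametrization of a cell -/
  param : Cell → Coord d → M
  convex_dom : ∀ K, Convex ℝ (dom K)
  isCompact_dom : ∀ K, IsCompact (dom K)
  interior_dom_nonempty : ∀ K, (interior (dom K)).Nonempty
  continuousOn_param : ∀ K, ContinuousOn (param K) (dom K)
  injOn_param : ∀ K, InjOn (param K) (dom K)
  cover : ⋃ K, param K '' dom K = univ
  interior_disjoint : ∀ K L, K ≠ L → Disjoint (param K '' interior (dom K)) (param L '' dom L)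

attribute [instance] Mesh.fintypeCell

section Space

variable {d : ℕ} {M : Type*} [TopologicalSpace M]

/-- A scalar space of continuous finite elements on a mesh: a finite-dimensional space of continuous
functions that are smooth on every (closed) cell, containing the constants. -/
structure IsFESpace (𝓚 : Mesh d M) (V : Submodule ℝ (M → ℝ)) : Prop where
  finiteDimensional : FiniteDimensional ℝ V
  one_mem : (fun _ : M => (1 : ℝ)) ∈ V
  continuous : ∀ v ∈ V, Continuous v
  smooth : ∀ v ∈ V, ∀ K, ContDiffOn ℝ ∞ (fun u => v (𝓚.param K u)) (𝓚.dom K)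

end Space

/-- The vector-valued fields `M → ℝ^(d+1)` all of whose components lie in `V`. -/
def vecSpace {M : Type*} (d : ℕ) (V : Submodule ℝ (M → ℝ)) : Submodule ℝ (M → Ambient d) where
  carrier := {F | ∀ i, (fun ξ => F ξ i) ∈ V}
  add_mem' := fun hF hG i => V.add_mem (hF i) (hG i)
  zero_mem' := fun _ => V.zero_mem
  smul_mem' := fun c _ hF i => V.smul_mem c (hF i)

/-- On the time set `I`, the function `f` is a polynomial in time of degree at most `k` with
coefficients in the space `W`. -/
def IsTimePoly {F : Type*} [AddCommGroup F] [Module ℝ F] (k : ℕ) (I : Set ℝ) (W : Submodule ℝ F)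
    (f : ℝ → F) : Prop :=
  ∃ c : ℕ → F, (∀ j, c j ∈ W) ∧ ∀ τ ∈ I, f τ = ∑ j ∈ Finset.range (k + 1), τ ^ j • c j

/-- The velocity of `X` at time `τ`. -/
noncomputable def velocity {d : ℕ} {M : Type*} (X : ℝ → M → Ambient d) (τ : ℝ) : M → Ambient d :=
  fun ξ => deriv (fun σ => X σ ξ) τ

/-- A bounded Lipschitz domain of `ℝ^(d+1)`: near each of its boundary points it is, in a suitable
orthonormal direction `e`, the part below the graph of a Lipschitz function of the component
orthogonal to `e`. -/
structure IsBddLipschitzDomain {d : ℕ} (Ω : Set (Ambient d)) : Prop where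
  isOpen : IsOpen Ω
  isBounded : Bornology.IsBounded Ω
  localGraph : ∀ x ∈ frontier Ω, ∃ e : Ambient d, ‖e‖ = 1 ∧ ∃ g : Ambient d → ℝ,
    (∃ L : ℝ≥0, LipschitzWith L g) ∧ ∃ r > 0, ∀ y ∈ Metric.ball x r,
      (y ∈ Ω ↔ inner ℝ e y < g (y - inner ℝ e y • e))

/-- `n` is a unit vector orthogonal to the tangent space `T` that, at the point `x`, points out of
`Ω`. -/
def IsOutwardUnitNormal {d : ℕ} (Ω : Set (Ambient d)) (T : Submodule ℝ (Ambient d))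
    (x n : Ambient d) : Prop :=
  ‖n‖ = 1 ∧ n ∈ Tᗮ ∧ ∃ ε > 0, ∀ δ ∈ Ioo (0 : ℝ) ε, x - δ • n ∈ Ω ∧ x + δ • n ∉ closure Ω

open Classical in
/-- The outward unit normal to `∂Ω` at a point `x` with tangent space `T`. -/
noncomputable def outwardUnitNormal {d : ℕ} (Ω : Set (Ambient d)) (T : Submodule ℝ (Ambient d))
    (x : Ambient d) : Ambient d :=
  if h : ∃ n, IsOutwardUnitNormal Ω T x n then h.choose else 0

/-! Calculus on the surface `X(M)` at one instant, cell by cell, through pullback to the coordinate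
domains of the cells. A field on the surface is given by its values at each cell and coordinate
point. -/

section Surface

variable {d : ℕ} {M : Type*} [TopologicalSpace M] (𝓚 : Mesh d M)

/-- The differential, in the coordinates of the cell `K`, of a function on the reference manifold. -/
noncomputable def cellDeriv {W : Type*} [NormedAddCommGroup W] [NormedSpace ℝ W] (f : M → W)
    (K : 𝓚.Cell) (u : Coord d) : Coord d →L[ℝ] W :=
  fderivWithin ℝ (fun w => f (𝓚.param K w)) (𝓚.dom K) u

/-- The coordinate tangent vector `∂X/∂u_i`. -/
noncomputable def tangentVec (X : M → Ambient d) (K : 𝓚.Cell) (u : Coord d) (i : Fin d) :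
    Ambient d :=
  cellDeriv 𝓚 X K u (EuclideanSpace.single i 1)

/-- The metric tensor `G`. -/
noncomputable def metricTensor (X : M → Ambient d) (K : 𝓚.Cell) (u : Coord d) :
    Matrix (Fin d) (Fin d) ℝ :=
  Matrix.of fun i j => inner ℝ (tangentVec 𝓚 X K u i) (tangentVec 𝓚 X K u j)

/-- The Jacobian `J = √(det G)`, i.e. the density of the surface measure. -/
noncomputable def jacobian (X : M → Ambient d) (K : 𝓚.Cell) (u : Coord d) : ℝ :=
  √(metricTensor 𝓚 X K u).det

/-- The integral over the surface `X(M)` of a scalar field. -/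
noncomputable def surfIntegral (X : M → Ambient d) (f : 𝓚.Cell → Coord d → ℝ) : ℝ :=
  ∑ K, ∫ u in 𝓚.dom K, f K u * jacobian 𝓚 X K u

/-- The surface area of `X(M)`. -/
noncomputable def area (X : M → Ambient d) : ℝ :=
  surfIntegral 𝓚 X fun _ _ => 1

/-- The surface field obtained from a function on the reference manifold. -/
def toField {W : Type*} (f : M → W) (K : 𝓚.Cell) (u : Coord d) : W :=
  f (𝓚.param K u)

/-- The `L²` inner product on the surface `X(M)`, for scalar or vector fields. -/
noncomputable def l2Inner {W : Type*} [NormedAddCommGroup W] [InnerProductSpace ℝ W]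
    (X : M → Ambient d) (f g : 𝓚.Cell → Coord d → W) : ℝ :=
  surfIntegral 𝓚 X fun K u => inner ℝ (f K u) (g K u)

/-- The surface gradient `∑ i j, G⁻¹ i j (∂f/∂u_i) (∂X/∂u_j)` of a scalar function. -/
noncomputable def surfGrad (X : M → Ambient d) (f : M → ℝ) (K : 𝓚.Cell) (u : Coord d) :
    Ambient d :=
  ∑ i, ∑ j, ((metricTensor 𝓚 X K u)⁻¹ i j * cellDeriv 𝓚 f K u (EuclideanSpace.single i 1)) •
    tangentVec 𝓚 X K u j

/-- `(∇_M f, ∇_M g)_M` for scalar functions. -/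
noncomputable def gradInner (X : M → Ambient d) (f g : M → ℝ) : ℝ :=
  l2Inner 𝓚 X (surfGrad 𝓚 X f) (surfGrad 𝓚 X g)

/-- `(∇_M A, ∇_M B)_M` for vector-valued functions: the sum over the components. -/
noncomputable def gradInnerVec (X : M → Ambient d) (A B : M → Ambient d) : ℝ :=
  ∑ i, gradInner 𝓚 X (fun ξ => A ξ i) (fun ξ => B ξ i)

/-- `‖∇_M f‖_M²` for a scalar function. -/
noncomputable def gradNormSq (X : M → Ambient d) (f : M → ℝ) : ℝ :=
  surfIntegral 𝓚 X fun K u => ‖surfGrad 𝓚 X f K u‖ ^ 2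

/-- The outward unit normal field of the surface `X(M) = ∂Ω`. -/
noncomputable def normalField (Ω : Set (Ambient d)) (X : M → Ambient d) (K : 𝓚.Cell)
    (u : Coord d) : Ambient d :=
  outwardUnitNormal Ω (LinearMap.range (cellDeriv 𝓚 X K u).toLinearMap) (X (𝓚.param K u))

/-- `(A · n, y)_M`. -/
noncomputable def normalInner (Ω : Set (Ambient d)) (X : M → Ambient d) (A : M → Ambient d)
    (y : M → ℝ) : ℝ :=
  l2Inner 𝓚 X (fun K u => inner ℝ (toField 𝓚 A K u) (normalField 𝓚 Ω X K u)) (toField 𝓚 y)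

/-- `(q n, B)_M`. -/
noncomputable def scaledNormalInner (Ω : Set (Ambient d)) (X : M → Ambient d) (q : M → ℝ)
    (B : M → Ambient d) : ℝ :=
  l2Inner 𝓚 X (fun K u => toField 𝓚 q K u • normalField 𝓚 Ω X K u) (toField 𝓚 B)

/-- The surface parametrized by `X` is not singular and encloses `Ω`: it is the embedded boundary of
the bounded Lipschitz domain `Ω`, and the Jacobian is positive on every cell. -/
structure Encloses (X : M → Ambient d) (Ω : Set (Ambient d)) : Prop where
  injective : Function.Injective X
  range_eq : range X = frontier Ω
  lipschitz : IsBddLipschitzDomain Ω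
  jacobian_pos : ∀ K, ∀ u ∈ 𝓚.dom K, 0 < jacobian 𝓚 X K u

/-- `(X, p, R, κ)` solves the dual-MDR continuous Petrov-Galerkin scheme with `s` stages for surface
diffusion, with initial surface `X₀`, on the time slabs `(t n, t (n+1))`, `n < N`; `Ω τ` is the region
enclosed by the surface at time `τ` (it determines the outward normal). Since `X` is one function of
time that is polynomial on each closed slab, its value at the end of a slab is the initial datum on the
next one. -/
structure IsSDSolution (V : Submodule ℝ (M → ℝ)) (s N : ℕ) (t : ℕ → ℝ) (X₀ : M → Ambient d)
    (Ω : ℝ → Set (Ambient d)) (X : ℝ → M → Ambient d) (p : ℝ → M → ℝ) (R : ℝ → M → Ambient d)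
    (κ : ℝ → M → ℝ) : Prop where
  initial : X (t 0) = X₀
  poly_X : ∀ n < N, IsTimePoly s (Icc (t n) (t (n + 1))) (vecSpace d V) X
  poly_p : ∀ n < N, IsTimePoly (s - 1) (Ioo (t n) (t (n + 1))) V p
  poly_R : ∀ n < N, IsTimePoly (s - 1) (Ioo (t n) (t (n + 1))) (vecSpace d V) R
  poly_κ : ∀ n < N, IsTimePoly (s - 1) (Ioo (t n) (t (n + 1))) V κ
  eq_velocity : ∀ n < N, ∀ y : ℝ → M → ℝ, IsTimePoly (s - 1) (Ioo (t n) (t (n + 1))) V y →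
    ∫ τ in Ioo (t n) (t (n + 1)), normalInner 𝓚 (Ω τ) (X τ) (velocity X τ) (y τ) =
      ∫ τ in Ioo (t n) (t (n + 1)), gradInner 𝓚 (X τ) (κ τ) (y τ)
  eq_multiplier : ∀ n < N, ∀ Q : ℝ → M → Ambient d,
    IsTimePoly (s - 1) (Ioo (t n) (t (n + 1))) (vecSpace d V) Q →
    ∫ τ in Ioo (t n) (t (n + 1)), (gradInnerVec 𝓚 (X τ) (velocity X τ) (Q τ) +
      scaledNormalInner 𝓚 (Ω τ) (X τ) (p τ) (Q τ)) = 0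
  eq_auxiliary : ∀ n < N, ∀ q : ℝ → M → ℝ, IsTimePoly (s - 1) (Ioo (t n) (t (n + 1))) V q →
    ∫ τ in Ioo (t n) (t (n + 1)), normalInner 𝓚 (Ω τ) (X τ) (R τ) (q τ) = 0
  eq_curvature : ∀ n < N, ∀ Λ : ℝ → M → Ambient d,
    IsTimePoly (s - 1) (Ioo (t n) (t (n + 1))) (vecSpace d V) Λ →
    ∫ τ in Ioo (t n) (t (n + 1)), (gradInnerVec 𝓚 (X τ) (R τ) (Λ τ) +
      scaledNormalInner 𝓚 (Ω τ) (X τ) (κ τ) (Λ τ)) =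
      -∫ τ in Ioo (t n) (t (n + 1)), gradInnerVec 𝓚 (X τ) (X τ) (Λ τ)

end Surface

end SurfFEM

open SurfFEM

/-! Conservation of volume: the test function `1` in the velocity equation makes the flux of the
velocity through the surface vanish in mean over the slab, since a constant has no gradient. The
change of volume equals this flux by the transport theorem `IsSmoothMotion.volume_sub`.

Dissipation of area: by Jacobi's formula the surface element satisfies `∂J/∂t = (∇X : ∇Ẋ) J`, so the
change of area is `∫ (∇X, ∇Ẋ)` (`area_sub`). As `X` has degree `s` in time, `Ẋ` has degree `s - 1`
and is an admissible test function in the curvature equation, which gives `∫ (∇X, ∇Ẋ) = -∫ (∇R, ∇Ẋ)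
- ∫ (κ n, Ẋ)`. The multiplier equation tested with `R` and the auxiliary equation tested with `p`
show that the first term is zero; the velocity equation tested with `κ` turns the second one into
`-∫ ‖∇κ‖²`.

The hard part is the transport theorem, because the regions `Ω τ` are given separately at each time,
with no regularity in time and only a Lipschitz boundary. It is obtained by counting rather than
from the divergence theorem. The space-time map `(τ, u) ↦ X τ (u)` goes between spaces of equal
dimension, and its Jacobian is `|v · n| J`. The area formula, weighted by the sign of `v · n`,
therefore writes the total flux as the integral over `x` of the signed number of passages of the
surface through `x`. For almost every `x` there are finitely many passages, all transversal, at
interior times and interior points of cells, and their signed number is the difference of the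
indicators of the final and initial regions at `x`.

For this last count the indicator of `Ω τ` at `x` must be constant in time between passages and must
jump by the right sign at each. Near an interior point of a cell the surface has a defining function
in space-time (`IsSmoothMotion.exists_definingFunction`), but the side on which `Ω τ` lies could
still flip with `τ`. This is excluded by following a generic line to infinity, where nothing is
enclosed at any nearby time (`IsSmoothMotion.eventually_mem_iff`). The same information makes the
outward normal well defined and continuous on open cells, which supplies the measurability and
integrability used throughout. -/

open Filter Topology

/-! ### Functions on the line that are constant up to jumps -/

/-- A proposition on the line that is constant on every punctured neighbourhood is constant. -/
theorem eventually_punctured_of_locally_constant {P : ℝ → Prop}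
    (h : ∀ y, (∀ᶠ z in 𝓝[≠] y, P z) ∨ ∀ᶠ z in 𝓝[≠] y, ¬ P z) {y₁ : ℝ}
    (h₁ : ∀ᶠ z in 𝓝[≠] y₁, P z) (y : ℝ) : ∀ᶠ z in 𝓝[≠] y, P z := by
  -- A punctured neighbourhood of `a` is a full neighbourhood of each of its points, hence openness.
  -- Applied to `P` and to its negation it yields a clopen set, and the line is connected.
  have isOpen_set : ∀ Q : ℝ → Prop, IsOpen {y | ∀ᶠ z in 𝓝[≠] y, Q z} := by
    intro Q
    rw [isOpen_iff_mem_nhds]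
    intro a ha
    have h2 : ∀ᶠ y in 𝓝[≠] a, ∀ᶠ x in 𝓝[≠] a, True := by simp
    have h3 : ∀ᶠ y in 𝓝[≠] a, ∀ᶠ x in 𝓝[≠] y, Q x := by
      have h4 := eventually_eventually_nhdsWithin.2 ha
      filter_upwards [h4, self_mem_nhdsWithin] with y hy hya
      rw [IsOpen.nhdsWithin_eq isOpen_compl_singleton hya] at hy
      exact hy.filter_mono nhdsWithin_le_nhds
    rw [eventually_nhdsWithin_iff] at h3
    filter_upwards [h3] with y hy
    by_cases hya : y = a
    · subst hya; exact ha
    · exact hy hya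
  have hS : IsClopen {y | ∀ᶠ z in 𝓝[≠] y, P z} := by
    refine ⟨⟨?_⟩, isOpen_set P⟩
    have : {y | ∀ᶠ z in 𝓝[≠] y, P z}ᶜ = {y | ∀ᶠ z in 𝓝[≠] y, ¬ P z} := by
      ext y
      refine ⟨fun hy => (h y).resolve_left hy, fun hy hy' => ?_⟩
      obtain ⟨z, hz, hz'⟩ := ((show ∀ᶠ z in 𝓝[≠] y, ¬ P z from hy).and hy').exists
      exact hz hz'
    rw [this]
    exact isOpen_set _
  have := hS.eq_univ ⟨y₁, h₁⟩
  exact (this ▸ mem_univ y : y ∈ {y | ∀ᶠ z in 𝓝[≠] y, P z})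

/-- A function on the line that is constant on every punctured neighbourhood takes the same value
near any two points. -/
theorem eq_of_locally_constant_punctured {G : ℝ → ℝ}
    (h : ∀ y, ∃ c, ∀ᶠ z in 𝓝[≠] y, G z = c) {y₁ y₂ c₁ c₂ : ℝ}
    (h₁ : ∀ᶠ z in 𝓝 y₁, G z = c₁) (h₂ : ∀ᶠ z in 𝓝 y₂, G z = c₂) : c₁ = c₂ := by
  have := eventually_punctured_of_locally_constant (P := fun z => G z = c₁) (fun y => by
    obtain ⟨c, hc⟩ := h y
    by_cases hcc : c = c₁
    · left; simpa [hcc] using hc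
    · right
      filter_upwards [hc] with z hz
      rw [hz]; exact hcc) (h₁.filter_mono nhdsWithin_le_nhds) y₂
  obtain ⟨z, hz, hz'⟩ := (this.and (h₂.filter_mono nhdsWithin_le_nhds)).exists
  exact hz.symm.trans hz'

/-- A function that is locally constant up to finitely many jumps varies by the sum of the jumps. -/
theorem sub_eq_sum_jumps {ι : Type*} (S : Finset ι) (t σ : ι → ℝ) (f : ℝ → ℝ) {a b : ℝ}
    (hab : a < b) (ht : InjOn t S) (hmem : ∀ i ∈ S, t i ∈ Ioo a b)
    (hcont : ∀ τ ∈ Icc a b, (∀ i ∈ S, t i ≠ τ) → ∀ᶠ τ' in 𝓝[Icc a b] τ, f τ' = f τ)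
    (hjump : ∀ i ∈ S, ∃ c, (∀ᶠ τ in 𝓝[<] t i, f τ = c) ∧ ∀ᶠ τ in 𝓝[>] t i, f τ = c + σ i) :
    f b - f a = ∑ i ∈ S, σ i := by
  classical
  -- Clamping extends `f` by constants outside `[a, b]`, and the step functions remove the jumps.
  -- Only punctured neighbourhoods matter, so the value of `f` at a jump time is irrelevant.
  set G : ℝ → ℝ := fun τ => f (max a (min b τ)) - ∑ i ∈ S, if t i < τ then σ i else 0 with hG
  have step_const : ∀ τ : ℝ, ∀ i, t i ≠ τ →
      ∀ᶠ τ' in 𝓝 τ, (if t i < τ' then σ i else 0) = (if t i < τ then σ i else 0) := by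
    intro τ i hi
    rcases lt_or_gt_of_ne hi with h | h
    · filter_upwards [eventually_gt_nhds h] with τ' h'
      rw [if_pos h', if_pos h]
    · filter_upwards [eventually_lt_nhds h] with τ' h'
      rw [if_neg (not_lt.2 h'.le), if_neg (not_lt.2 h.le)]
  have sum_const : ∀ τ : ℝ, ∀ S' ⊆ S, (∀ i ∈ S', t i ≠ τ) →
      ∀ᶠ τ' in 𝓝 τ, (∑ i ∈ S', if t i < τ' then σ i else 0) =
        ∑ i ∈ S', if t i < τ then σ i else 0 := by
    intro τ S' _ hi
    have : ∀ᶠ τ' in 𝓝 τ, ∀ i ∈ S',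
        (if t i < τ' then σ i else 0) = (if t i < τ then σ i else 0) :=
      (Filter.eventually_all_finset S').2 fun i hiS => step_const τ i (hi i hiS)
    filter_upwards [this] with τ' h
    exact Finset.sum_congr rfl h
  have clamp_cont : Continuous fun τ : ℝ => max a (min b τ) := by fun_prop
  have clamp_mem : ∀ τ : ℝ, max a (min b τ) ∈ Icc a b := fun τ =>
    ⟨le_max_left _ _, max_le hab.le (min_le_left _ _)⟩
  have clamp_id : ∀ τ ∈ Icc a b, max a (min b τ) = τ := fun τ hτ => by
    rw [min_eq_right hτ.2, max_eq_right hτ.1]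
  have noJump : ∀ τ : ℝ, (∀ i ∈ S, t i ≠ τ) → ∀ᶠ τ' in 𝓝 τ, G τ' = G τ := by
    intro τ hτ
    have h1 : ∀ i ∈ S, t i ≠ max a (min b τ) := by
      intro i hi heq
      have h2 := hmem i hi
      rw [heq] at h2
      have h3 : τ ∈ Icc a b := by
        rcases lt_or_ge τ a with h | h
        · rw [min_eq_right (h.le.trans hab.le), max_eq_left h.le] at h2
          exact absurd h2.1 (lt_irrefl _)
        · refine ⟨h, ?_⟩
          by_contra h'
          rw [min_eq_left (not_le.1 h').le, max_eq_right hab.le] at h2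
          exact absurd h2.2 (lt_irrefl _)
      exact hτ i hi (heq.trans (clamp_id τ h3))
    have h4 : Tendsto (fun τ' : ℝ => max a (min b τ')) (𝓝 τ) (𝓝[Icc a b] (max a (min b τ))) :=
      tendsto_nhdsWithin_iff.2 ⟨clamp_cont.tendsto τ, Eventually.of_forall clamp_mem⟩
    filter_upwards [h4.eventually (hcont _ (clamp_mem τ) h1), sum_const τ S subset_rfl hτ]
      with τ' h5 h6
    simp only [hG, h5, h6]
  have hloc : ∀ y, ∃ c, ∀ᶠ z in 𝓝[≠] y, G z = c := by
    intro y
    by_cases hy : ∀ i ∈ S, t i ≠ y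
    · exact ⟨G y, (noJump y hy).filter_mono nhdsWithin_le_nhds⟩
    · push Not at hy
      obtain ⟨i, hi, rfl⟩ := hy
      obtain ⟨c, hl, hr⟩ := hjump i hi
      have hrest := sum_const (t i) (S.erase i) (Finset.erase_subset _ _) (fun j hj h =>
        (Finset.mem_erase.1 hj).1 (ht (Finset.mem_of_mem_erase hj) hi h))
      have hsplit : ∀ τ, (∑ j ∈ S, if t j < τ then σ j else 0) =
          (if t i < τ then σ i else 0) + ∑ j ∈ S.erase i, if t j < τ then σ j else 0 :=
        fun τ => (Finset.add_sum_erase S _ hi).symm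
      have hIcc : ∀ᶠ z in 𝓝 (t i), z ∈ Icc a b := Icc_mem_nhds (hmem i hi).1 (hmem i hi).2
      refine ⟨c - ∑ j ∈ S.erase i, (if t j < t i then σ j else 0), ?_⟩
      rw [← Iio_union_Ioi, nhdsWithin_union, eventually_sup]
      constructor
      · filter_upwards [hl, hrest.filter_mono nhdsWithin_le_nhds,
          hIcc.filter_mono nhdsWithin_le_nhds, self_mem_nhdsWithin] with z h1 h2 h3 h4
        simp only [hG, clamp_id z h3, h1, hsplit z, h2, if_neg (not_lt.2 (mem_Iio.1 h4).le), zero_add]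
      · filter_upwards [hr, hrest.filter_mono nhdsWithin_le_nhds,
          hIcc.filter_mono nhdsWithin_le_nhds, self_mem_nhdsWithin] with z h1 h2 h3 h4
        simp only [hG, clamp_id z h3, h1, hsplit z, h2, if_pos (mem_Ioi.1 h4)]
        ring
  have ha := noJump a (fun i hi h => by have := (hmem i hi).1; rw [h] at this; exact lt_irrefl _ this)
  have hb := noJump b (fun i hi h => by have := (hmem i hi).2; rw [h] at this; exact lt_irrefl _ this)
  have hfin := eq_of_locally_constant_punctured hloc ha hb
  have hGa : G a = f a := by
    simp only [hG, clamp_id a (left_mem_Icc.2 hab.le)]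
    rw [Finset.sum_eq_zero, sub_zero]
    intro i hi
    rw [if_neg (not_lt.2 (hmem i hi).1.le)]
  have hGb : G b = f b - ∑ i ∈ S, σ i := by
    simp only [hG, clamp_id b (right_mem_Icc.2 hab.le)]
    congr 1
    exact Finset.sum_congr rfl fun i hi => if_pos (hmem i hi).2
  rw [hGa, hGb] at hfin
  linarith

/-! ### The area formula with multiplicity -/

section AreaFormula

variable {E : Type*} [NormedAddCommGroup E] [NormedSpace ℝ E] [FiniteDimensional ℝ E]

theorem exists_injOn_of_det_ne_zero {F : E → E} {F' : E →L[ℝ] E} {z : E}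
    (hF : HasStrictFDerivAt F F' z) (hdet : F'.det ≠ 0) : ∃ U ∈ 𝓝 z, InjOn F U := by
  have hF' : HasStrictFDerivAt F
      ((F'.toContinuousLinearEquivOfDetNeZero hdet : E ≃L[ℝ] E) : E →L[ℝ] E) z := by
    rwa [ContinuousLinearMap.coe_toContinuousLinearEquivOfDetNeZero]
  refine ⟨(hF'.toOpenPartialHomeomorph F).source,
    (hF'.toOpenPartialHomeomorph F).open_source.mem_nhds hF'.mem_toOpenPartialHomeomorph_source, ?_⟩
  have := (hF'.toOpenPartialHomeomorph F).injOn
  rwa [hF'.toOpenPartialHomeomorph_coe] at this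

/-- A map that is locally injective on an open set is injective on the pieces of a countable Borel
partition. -/
theorem exists_measurable_partition_injOn [MeasurableSpace E] [BorelSpace E] {F : E → E} {R : Set E}
    (hR : IsOpen R) (hF : ∀ z ∈ R, ∃ U ∈ 𝓝 z, InjOn F U) :
    ∃ A : ℕ → Set E, (∀ i, MeasurableSet (A i)) ∧ Pairwise (Function.onFun Disjoint A) ∧
      ⋃ i, A i = R ∧ ∀ i, InjOn F (A i) := by
  classical
  have h1 : ∀ z : E, ∃ U : Set E, IsOpen U ∧ U ⊆ R ∧ InjOn F U ∧ (z ∈ R → z ∈ U) := by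
    intro z
    by_cases hz : z ∈ R
    · obtain ⟨U, hU, hinj⟩ := hF z hz
      refine ⟨interior U ∩ R, isOpen_interior.inter hR, inter_subset_right,
        hinj.mono (inter_subset_left.trans interior_subset),
        fun _ => ⟨mem_interior_iff_mem_nhds.2 hU, hz⟩⟩
    · exact ⟨∅, isOpen_empty, empty_subset _, injOn_empty _, fun h => absurd h hz⟩
  choose U hUo hUR hUinj hUmem using h1
  obtain ⟨t, -, htc, htU⟩ := TopologicalSpace.countable_cover_nhdsWithin (s := R) (f := U)
    (fun z hz => mem_nhdsWithin_of_mem_nhds ((hUo z).mem_nhds (hUmem z hz)))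
  -- Inserting `0` makes the countable set nonempty, so that it can be enumerated by `ℕ`. This is
  -- harmless, since every `U z` is an open subset of `R` on which `F` is injective.
  obtain ⟨e, he⟩ := (htc.insert 0).exists_eq_range (insert_nonempty _ _)
  refine ⟨disjointed fun i => U (e i), fun i => ?_, disjoint_disjointed _, ?_, fun i =>
    (hUinj (e i)).mono (disjointed_subset _ i)⟩
  · exact MeasurableSet.disjointed (fun i => (hUo _).measurableSet) i
  · rw [iUnion_disjointed]
    refine subset_antisymm (iUnion_subset fun i => hUR _) fun z hz => ?_
    obtain ⟨w, hw, hzw⟩ := mem_iUnion₂.1 (htU hz)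
    have : w ∈ range e := he ▸ mem_insert_of_mem _ hw
    obtain ⟨i, rfl⟩ := this
    exact mem_iUnion.2 ⟨i, hzw⟩

/-- The area formula, with multiplicity, for a finite family of maps between spaces of the same
dimension. -/
theorem sum_integral_abs_det_mul_eq_integral_tsum [MeasurableSpace E] [BorelSpace E]
    (μ : Measure E) [μ.IsAddHaarMeasure] {κ : Type*} [Fintype κ]
    {F : κ → E → E} {F' : κ → E → E →L[ℝ] E} {Q : κ → Set E} (hQ : ∀ k, IsOpen (Q k))
    (hF : ∀ k, ∀ z ∈ Q k, HasStrictFDerivAt (F k) (F' k z) z)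
    (hF' : ∀ k, ContinuousOn (F' k) (Q k)) (σ : κ → E → ℝ)
    (hσ : ∀ k, IntegrableOn (fun z => |(F' k z).det| * σ k z) (Q k) μ) :
    ∑ k, ∫ z in Q k, |(F' k z).det| * σ k z ∂μ =
      ∫ x, ∑' q : {q : κ × E // (q.2 ∈ Q q.1 ∧ (F' q.1 q.2).det ≠ 0) ∧ F q.1 q.2 = x},
        σ q.1.1 q.1.2 ∂μ := by
  classical
  set R : κ → Set E := fun k => {z | z ∈ Q k ∧ (F' k z).det ≠ 0} with hRdef
  have hRQ : ∀ k, R k ⊆ Q k := fun k z hz => hz.1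
  have hRo : ∀ k, IsOpen (R k) := by
    intro k
    have hc : ContinuousOn (fun z => (F' k z).det) (Q k) :=
      ContinuousLinearMap.continuous_det.comp_continuousOn (hF' k)
    exact hc.isOpen_inter_preimage (hQ k) isOpen_ne
  have hpart := fun k => exists_measurable_partition_injOn (F := F k) (hRo k) fun z hz =>
    exists_injOn_of_det_ne_zero (hF k z (hRQ k hz)) hz.2
  choose A hAm hAd hAU hAinj using hpart
  have hAR : ∀ k i, A k i ⊆ R k := fun k i => (hAU k) ▸ subset_iUnion (A k) i
  have hder : ∀ k i, ∀ z ∈ A k i, HasFDerivWithinAt (F k) (F' k z) (A k i) z := fun k i z hz =>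
    (hF k z (hRQ k (hAR k i hz))).hasFDerivAt.hasFDerivWithinAt
  -- Critical points contribute nothing, because the determinant is a factor of the integrand.
  have hone : ∀ k, ∫ z in Q k, |(F' k z).det| * σ k z ∂μ =
      ∫ z in R k, |(F' k z).det| * σ k z ∂μ := by
    intro k
    refine (setIntegral_eq_of_subset_of_forall_sdiff_eq_zero (hQ k).measurableSet (hRQ k) ?_)
    rintro z ⟨hz, hz'⟩
    have : (F' k z).det = 0 := by
      by_contra h
      exact hz' ⟨hz, h⟩
    simp [this]
  have hσR : ∀ k, IntegrableOn (fun z => |(F' k z).det| * σ k z) (⋃ i, A k i) μ := fun k =>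
    (hσ k).mono_set ((hAU k).subset.trans (hRQ k))
  -- `g (k, i)` is the weight carried to the image of the piece `A k i`, on which `F k` is injective
  -- and the usual change of variables applies. Summed over all pieces, its value at `x` is the sum
  -- of the weights of the regular preimages of `x`.
  set g : κ × ℕ → E → ℝ := fun q =>
    (F q.1 '' A q.1 q.2).indicator fun x => σ q.1 (Function.invFunOn (F q.1) (A q.1 q.2) x) with hg
  have hinv : ∀ k i, ∀ z ∈ A k i, Function.invFunOn (F k) (A k i) (F k z) = z := fun k i z hz =>
    (hAinj k i).leftInvOn_invFunOn hz
  have himm : ∀ k i, MeasurableSet (F k '' A k i) := fun k i =>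
    measurable_image_of_fderivWithin (hAm k i) (hder k i) (hAinj k i)
  have hgint : ∀ q, Integrable (g q) μ := by
    rintro ⟨k, i⟩
    refine (integrable_indicator_iff (himm k i)).2 ?_
    rw [integrableOn_image_iff_integrableOn_abs_det_fderiv_smul μ (hAm k i) (hder k i) (hAinj k i)]
    refine ((hσR k).mono_set (subset_iUnion (A k) i)).congr_fun (fun z hz => ?_) (hAm k i)
    simp only [hinv k i z hz, smul_eq_mul]
  have hgval : ∀ k i, ∫ x, g (k, i) x ∂μ = ∫ z in A k i, |(F' k z).det| * σ k z ∂μ := by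
    intro k i
    simp only [hg]
    rw [integral_indicator (himm k i),
      integral_image_eq_integral_abs_det_fderiv_smul μ (hAm k i) (hder k i) (hAinj k i)]
    refine setIntegral_congr_fun (hAm k i) fun z hz => ?_
    simp only [hinv k i z hz, smul_eq_mul]
  have hgnorm : ∀ k i, ∫ x, ‖g (k, i) x‖ ∂μ = ∫ z in A k i, ‖|(F' k z).det| * σ k z‖ ∂μ := by
    intro k i
    simp only [hg, norm_indicator_eq_indicator_norm]
    rw [integral_indicator (himm k i),
      integral_image_eq_integral_abs_det_fderiv_smul μ (hAm k i) (hder k i) (hAinj k i)]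
    refine setIntegral_congr_fun (hAm k i) fun z hz => ?_
    simp only [hinv k i z hz, smul_eq_mul, norm_mul, Real.norm_eq_abs, abs_abs]
  have hsumk : ∀ k, HasSum (fun i => ∫ x, ‖g (k, i) x‖ ∂μ)
      (∫ z in ⋃ i, A k i, ‖|(F' k z).det| * σ k z‖ ∂μ) := by
    intro k
    simp only [hgnorm]
    exact hasSum_integral_iUnion (hAm k) (hAd k) (hσR k).norm
  have hsummable : Summable fun q => ∫ x, ‖g q x‖ ∂μ := by
    rw [summable_prod_of_nonneg (fun q => integral_nonneg fun x => norm_nonneg _)]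
    exact ⟨fun k => (hsumk k).summable, Summable.of_finite⟩
  have hmain := hasSum_integral_of_summable_integral_norm hgint hsummable
  have hlhs : HasSum (fun q => ∫ x, g q x ∂μ) (∑ k, ∫ z in Q k, |(F' k z).det| * σ k z ∂μ) := by
    have hs : Summable fun q => ∫ x, g q x ∂μ := hmain.summable
    have : ∀ k, HasSum (fun i => ∫ x, g (k, i) x ∂μ) (∫ z in Q k, |(F' k z).det| * σ k z ∂μ) := by
      intro k
      rw [hone k, ← hAU k]
      simp only [hgval]
      exact hasSum_integral_iUnion (hAm k) (hAd k) (hσR k)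
    have h2 := hs.hasSum.prod_fiberwise this
    rw [(hasSum_fintype _).unique h2]
    exact hs.hasSum
  rw [hlhs.unique hmain]
  refine integral_congr_ae (Eventually.of_forall fun x => ?_)
  simp only
  have hidx : ∀ q : {q : κ × E // (q.2 ∈ Q q.1 ∧ (F' q.1 q.2).det ≠ 0) ∧ F q.1 q.2 = x},
      ∃ i, q.1.2 ∈ A q.1.1 i := fun q => by
    have : q.1.2 ∈ ⋃ i, A q.1.1 i := by rw [hAU]; exact q.2.1
    exact mem_iUnion.1 this
  choose idx hidx using hidx
  -- A regular preimage of `x` lies in exactly one piece and a piece contains at most one of them,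
  -- so the sum over pieces can be reindexed by preimages.
  have hinj : Function.Injective fun q => (q.1.1, idx q) := by
    rintro ⟨⟨k, z⟩, hz⟩ ⟨⟨k', z'⟩, hz'⟩ h
    simp only [Prod.mk.injEq] at h
    obtain ⟨rfl, h⟩ := h
    have h1 := hidx ⟨⟨k, z⟩, hz⟩
    have h2 := hidx ⟨⟨k, z'⟩, hz'⟩
    rw [← h] at h2
    have := hAinj _ _ h1 h2 (hz.2.trans hz'.2.symm)
    simp only at this
    subst this
    rfl
  have hsupp : Function.support (fun q => g q x) ⊆ range fun q => (q.1.1, idx q) := by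
    rintro ⟨k, i⟩ hq
    have : x ∈ F k '' A k i := by
      by_contra h
      exact hq (by simp [hg, h])
    obtain ⟨z, hz, hzx⟩ := this
    refine ⟨⟨(k, z), hAR k i hz, hzx⟩, ?_⟩
    simp only [Prod.mk.injEq, true_and]
    by_contra hne
    have h1 := hidx ⟨(k, z), hAR k i hz, hzx⟩
    exact (disjoint_left.1 (hAd k hne)) h1 hz
  rw [← hinj.tsum_eq hsupp]
  refine tsum_congr fun q => ?_
  have h1 := hidx q
  have h2 : x ∈ F q.1.1 '' A q.1.1 (idx q) := ⟨_, h1, q.2.2⟩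
  simp only [hg, indicator_of_mem h2]
  have h3 := hinv _ _ _ h1
  rw [q.2.2] at h3
  rw [h3]

end AreaFormula

/-! ### Determinants, Gram matrices and space-time coordinates -/

section Gram

variable {d : ℕ}

/-- The determinant of `d + 1` vectors of `ℝ^(d+1)`, in terms of the component of the first one
orthogonal to the others and of the Gram determinant of the others. -/
theorem sq_det_eq_sq_inner_mul_gram (v n : EuclideanSpace ℝ (Fin (d + 1)))
    (T : Fin d → EuclideanSpace ℝ (Fin (d + 1))) (hn : ‖n‖ = 1) (hT : ∀ i, inner ℝ n (T i) = 0)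
    (hG : (Matrix.of fun i j => inner ℝ (T i) (T j) : Matrix (Fin d) (Fin d) ℝ).det ≠ 0) :
    (Matrix.of fun i j => (Fin.cons v T : Fin (d + 1) → _) j i :
      Matrix (Fin (d + 1)) (Fin (d + 1)) ℝ).det ^ 2 =
    inner ℝ v n ^ 2 * (Matrix.of fun i j => inner ℝ (T i) (T j) : Matrix (Fin d) (Fin d) ℝ).det := by
  set G : Matrix (Fin d) (Fin d) ℝ := Matrix.of fun i j => inner ℝ (T i) (T j) with hGdef
  let A : EuclideanSpace ℝ (Fin (d + 1)) → Matrix (Fin (d + 1)) (Fin (d + 1)) ℝ := fun w =>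
    Matrix.of fun i j => (Fin.cons w T : Fin (d + 1) → EuclideanSpace ℝ (Fin (d + 1))) j i
  -- The first row of `(A n)ᵀ * A w` is `(⟨n, w⟩, 0, …, 0)` and the remaining block is `G`. The case
  -- `w = n` evaluates `(A n).det ^ 2`, and the case `w = v` then gives the claim.
  have key : ∀ w, (A w).det * (A n).det = inner ℝ w n * G.det := by
    intro w
    have hentry : ∀ i j, ((A n).transpose * A w) i j =
        inner ℝ ((Fin.cons n T : Fin (d + 1) → EuclideanSpace ℝ (Fin (d + 1))) i)
          ((Fin.cons w T : Fin (d + 1) → EuclideanSpace ℝ (Fin (d + 1))) j) := by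
      intro i j
      simp only [Matrix.mul_apply, Matrix.transpose_apply, A, Matrix.of_apply, PiLp.inner_apply,
        RCLike.inner_apply, conj_trivial]
      exact Finset.sum_congr rfl fun k _ => mul_comm _ _
    rw [mul_comm, ← Matrix.det_transpose (A n), ← Matrix.det_mul, Matrix.det_succ_row_zero,
      Fin.sum_univ_succ]
    rw [Finset.sum_eq_zero]
    · simp only [hentry, Fin.val_zero, pow_zero, one_mul, Fin.cons_zero, add_zero,
        Fin.succAbove_zero]
      rw [real_inner_comm]
      congr 2
      ext i j
      simp [hentry, hGdef]
    · intro j _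
      simp [hentry, hT]
  have h1 := key n
  rw [real_inner_self_eq_norm_sq, hn] at h1
  have h2 := key v
  change (A v).det ^ 2 = _
  have h3 : (A v).det ^ 2 * G.det = inner ℝ v n ^ 2 * G.det * G.det := by
    have h4 : (A n).det * (A n).det = G.det := by linarith
    calc (A v).det ^ 2 * G.det = ((A v).det * (A n).det) ^ 2 := by rw [← h4]; ring
      _ = _ := by rw [h2]; ring
  exact mul_right_cancel₀ hG h3

end Gram

section Coordinates

variable (d : ℕ)

/-- The splitting of the first coordinate from the others. -/
noncomputable def splitFirst : EuclideanSpace ℝ (Fin (d + 1)) ≃L[ℝ] ℝ × EuclideanSpace ℝ (Fin d) :=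
  LinearEquiv.toContinuousLinearEquiv
    { toFun := fun x => (x 0, WithLp.toLp 2 fun i => x i.succ)
      invFun := fun z => WithLp.toLp 2 (Fin.cons z.1 z.2 : Fin (d + 1) → ℝ)
      map_add' := fun x y => by ext <;> simp
      map_smul' := fun c x => by ext <;> simp
      left_inv := fun x => by
        ext i
        refine Fin.cases ?_ (fun j => ?_) i <;> simp
      right_inv := fun z => by ext <;> simp }

variable {d}

@[simp] theorem splitFirst_apply (x : EuclideanSpace ℝ (Fin (d + 1))) :
    splitFirst d x = (x 0, WithLp.toLp 2 fun i => x i.succ) := rfl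

theorem splitFirst_single_zero :
    splitFirst d (EuclideanSpace.single 0 1) = (1, 0) := by
  ext <;> simp

theorem splitFirst_single_succ (i : Fin d) :
    splitFirst d (EuclideanSpace.single i.succ 1) = (0, EuclideanSpace.single i 1) := by
  ext j
  · simp
  · by_cases h : j = i
    · subst h; simp
    · simp [h]

theorem measurePreserving_splitFirst : MeasurePreserving (splitFirst d) := by
  have h1 := PiLp.volume_preserving_ofLp (Fin (d + 1))
  have h2 := volume_preserving_piFinSuccAbove (fun _ : Fin (d + 1) => ℝ) 0
  have h3 := (MeasurePreserving.id (volume : Measure ℝ)).prod (PiLp.volume_preserving_toLp (Fin d))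
  have h4 := (h3.comp h2).comp h1
  exact h4

end Coordinates

/-! ### Local defining functions of the moving surface -/

namespace SurfFEM

variable {d : ℕ}

/-- A family of parametrized hypersurfaces can be straightened near a point where it is immersed; the
last coordinate of the straightening has the expected derivative. -/
theorem exists_straightening {F : ℝ × Coord d → Ambient d} {A : ℝ × Coord d →L[ℝ] Ambient d}
    {τ₀ : ℝ} {u₀ : Coord d} {n : Ambient d} (hF : HasStrictFDerivAt F A (τ₀, u₀)) (hn : ‖n‖ = 1)
    (hperp : ∀ w, inner ℝ n (A (0, w)) = 0) (hinj : ∀ w, A (0, w) = 0 → w = 0) :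
    ∃ P : OpenPartialHomeomorph (ℝ × (Coord d × ℝ)) (ℝ × Ambient d),
      (∀ q, P q = (q.1, F (q.1, q.2.1) + q.2.2 • n)) ∧ (τ₀, (u₀, 0)) ∈ P.source ∧
      HasStrictFDerivAt (fun q => (P.symm q).2.2)
        ((innerSL ℝ n).comp (ContinuousLinearMap.snd ℝ ℝ (Ambient d)) -
          inner ℝ n (A (1, 0)) • ContinuousLinearMap.fst ℝ ℝ (Ambient d)) (τ₀, F (τ₀, u₀)) := by
  -- In these coordinates the moving surface is `s = 0`. The inverse function theorem applies at
  -- `(τ₀, u₀, 0)`, the differential being injective between spaces of equal dimension.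
  let Ψ : ℝ × (Coord d × ℝ) → ℝ × Ambient d := fun q => (q.1, F (q.1, q.2.1) + q.2.2 • n)
  let e1 : ℝ × (Coord d × ℝ) →L[ℝ] ℝ × Coord d :=
    (ContinuousLinearMap.fst ℝ ℝ (Coord d × ℝ)).prod
      ((ContinuousLinearMap.fst ℝ (Coord d) ℝ).comp (ContinuousLinearMap.snd ℝ ℝ (Coord d × ℝ)))
  let e2 : ℝ × (Coord d × ℝ) →L[ℝ] ℝ :=
    (ContinuousLinearMap.snd ℝ (Coord d) ℝ).comp (ContinuousLinearMap.snd ℝ ℝ (Coord d × ℝ))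
  let L : ℝ × (Coord d × ℝ) →L[ℝ] ℝ × Ambient d :=
    (ContinuousLinearMap.fst ℝ ℝ (Coord d × ℝ)).prod (A.comp e1 + e2.smulRight n)
  have hLapp : ∀ h w s, L (h, (w, s)) = (h, A (h, w) + s • n) := fun h w s => rfl
  have hΨ : HasStrictFDerivAt Ψ L (τ₀, (u₀, 0)) := by
    have h1 : HasStrictFDerivAt (fun q : ℝ × (Coord d × ℝ) => F (q.1, q.2.1)) (A.comp e1)
        (τ₀, (u₀, 0)) := by
      have : HasStrictFDerivAt F A (e1 (τ₀, (u₀, 0))) := hF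
      exact this.comp (τ₀, (u₀, (0 : ℝ))) e1.hasStrictFDerivAt
    exact hasStrictFDerivAt_fst.prodMk (h1.add (e2.smulRight n).hasStrictFDerivAt)
  have hA : ∀ h w, A (h, w) = h • A (1, 0) + A (0, w) := by
    intro h w
    rw [← map_smul, ← map_add]
    simp
  -- Pairing with `n` annihilates the tangential part and recovers the height `s`. This gives the
  -- injectivity of `L` and also the derivative of the height.
  have hinner : ∀ h w s, inner ℝ n (A (h, w) + s • n) = h * inner ℝ n (A (1, 0)) + s := by
    intro h w s
    rw [hA, inner_add_right, inner_add_right, hperp, inner_smul_right, inner_smul_right,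
      real_inner_self_eq_norm_sq, hn]
    ring
  have hLinj : Function.Injective L.toLinearMap := by
    rw [← LinearMap.ker_eq_bot, LinearMap.ker_eq_bot']
    rintro ⟨h, w, s⟩ hq
    have hq' : (h, A (h, w) + s • n) = (0, 0) := hq
    simp only [Prod.mk.injEq] at hq'
    obtain ⟨rfl, h2⟩ := hq'
    have h3 := hinner 0 w s
    rw [h2, inner_zero_right, zero_mul, zero_add] at h3
    subst h3
    rw [zero_smul, add_zero] at h2
    rw [hinj w h2]
    rfl
  have hdim : Module.finrank ℝ (ℝ × (Coord d × ℝ)) = Module.finrank ℝ (ℝ × Ambient d) := by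
    simp [Module.finrank_prod]
  let Le : (ℝ × (Coord d × ℝ)) ≃L[ℝ] ℝ × Ambient d :=
    (L.toLinearMap.linearEquivOfInjective hLinj hdim).toContinuousLinearEquiv
  have hLe : (Le : (ℝ × (Coord d × ℝ)) →L[ℝ] ℝ × Ambient d) = L := by
    refine ContinuousLinearMap.ext fun x => ?_
    exact L.toLinearMap.linearEquivOfInjective_apply (hf := hLinj) (hdim := hdim) x
  have hΨ' : HasStrictFDerivAt Ψ (Le : (ℝ × (Coord d × ℝ)) →L[ℝ] ℝ × Ambient d)
    (τ₀, (u₀, 0)) := by rwa [hLe]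
  refine ⟨hΨ'.toOpenPartialHomeomorph Ψ, fun q => rfl, hΨ'.mem_toOpenPartialHomeomorph_source, ?_⟩
  have h1 := hΨ'.to_localInverse
  have h2 : Ψ (τ₀, (u₀, 0)) = (τ₀, F (τ₀, u₀)) := by simp [Ψ]
  rw [h2] at h1
  have h3 := (e2.hasStrictFDerivAt).comp _ h1
  refine (h3.congr_fderiv ?_)
  refine ContinuousLinearMap.ext fun z => ?_
  obtain ⟨⟨h, w, s⟩, rfl⟩ := Le.surjective z
  have h4 : Le (h, w, s) = (h, A (h, w) + s • n) := by
    rw [← hLapp, ← hLe]; rfl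
  simp only [ContinuousLinearMap.comp_apply, ContinuousLinearEquiv.coe_coe,
    ContinuousLinearEquiv.symm_apply_apply]
  rw [h4]
  simp only [sub_apply, ContinuousLinearMap.comp_apply,
    smul_apply, ContinuousLinearMap.coe_snd', ContinuousLinearMap.coe_fst',
    innerSL_apply_apply, hinner, smul_eq_mul]
  change s = _
  ring

/-- A preconnected set that does not meet the boundary of an open set is on one side of it. -/
theorem subset_or_disjoint_of_disjoint_frontier {E : Type*} [TopologicalSpace E] {C Ω : Set E}
    (hC : IsPreconnected C) (hΩ : IsOpen Ω) (h : ∀ y ∈ C, y ∉ frontier Ω) :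
    C ⊆ Ω ∨ Disjoint C Ω := by
  by_contra hcon
  push Not at hcon
  obtain ⟨h1, h2⟩ := hcon
  obtain ⟨y, hy1, hy2⟩ := not_subset.1 h1
  rw [not_disjoint_iff_nonempty_inter] at h2
  rw [hΩ.frontier_eq] at h
  obtain ⟨z, -, hz1, hz2⟩ := hC Ω (closure Ω)ᶜ hΩ isClosed_closure.isOpen_compl
    (fun y hy => by
      by_contra hcon
      rw [mem_union, not_or, mem_compl_iff, not_not] at hcon
      exact h y hy ⟨hcon.2, hcon.1⟩)
    h2 ⟨y, hy1, fun hy => h y hy1 ⟨hy, hy2⟩⟩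
  exact hz2 (subset_closure hz1)

/-- The two sides of a separating hypersurface in the boundary of an open set that is nowhere on both
sides of its boundary. -/
theorem mem_iff_of_separated {E : Type*} [TopologicalSpace E] {Ω U : Set E} (hΩ : IsOpen Ω)
    (hreg : frontier Ω ⊆ closure (closure Ω)ᶜ) (hU : IsOpen U) {f : E → ℝ}
    (hpos : IsPreconnected (U ∩ {y | 0 < f y})) (hneg : IsPreconnected (U ∩ {y | f y < 0}))
    (hfr : ∀ y ∈ U, y ∈ frontier Ω ↔ f y = 0) (hne : ∃ x ∈ U, f x = 0) :
    (∀ y ∈ U, (y ∈ Ω ↔ f y < 0) ∧ (y ∈ closure Ω ↔ f y ≤ 0)) ∨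
      (∀ y ∈ U, (y ∈ Ω ↔ 0 < f y) ∧ (y ∈ closure Ω ↔ 0 ≤ f y)) := by
  obtain ⟨x, hxU, hx⟩ := hne
  have hxf := (hfr x hxU).2 hx
  have side : ∀ C : Set E, IsPreconnected C → C ⊆ U → (∀ y ∈ C, f y ≠ 0) →
      C ⊆ Ω ∨ Disjoint C Ω := by
    intro C hC hCU hCf
    exact subset_or_disjoint_of_disjoint_frontier hC hΩ fun y hy hyf =>
      hCf y hy ((hfr y (hCU hy)).1 hyf)
  have hclos : ∀ y ∈ U, (y ∈ closure Ω ↔ y ∈ Ω ∨ f y = 0) := by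
    intro y hy
    rw [← hfr y hy, hΩ.frontier_eq, Set.mem_sdiff]
    constructor
    · intro h
      by_cases h' : y ∈ Ω
      · exact Or.inl h'
      · exact Or.inr ⟨h, h'⟩
    · rintro (h | h)
      · exact subset_closure h
      · exact h.1
  have hzero : ∀ y ∈ U, f y = 0 → y ∉ Ω := by
    intro y hy h hyΩ
    have := (hfr y hy).2 h
    rw [hΩ.frontier_eq] at this
    exact this.2 hyΩ
  have hP := side _ hpos inter_subset_left (fun y hy => ne_of_gt hy.2)
  have hN := side _ hneg inter_subset_left (fun y hy => ne_of_lt hy.2)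
  have hin : ∃ z ∈ U, z ∈ Ω := by
    obtain ⟨z, hz⟩ := mem_closure_iff.1 (frontier_subset_closure hxf) U hU hxU
    exact ⟨z, hz.1, hz.2⟩
  have hout : ∃ z ∈ U, z ∉ closure Ω := by
    obtain ⟨z, hz⟩ := mem_closure_iff.1 (hreg hxf) U hU hxU
    exact ⟨z, hz.1, hz.2⟩
  obtain ⟨zi, hziU, hzi⟩ := hin
  obtain ⟨zo, hzoU, hzo⟩ := hout
  have hzi0 : f zi ≠ 0 := fun h => hzero zi hziU h hzi
  have hzo0 : f zo ≠ 0 := fun h => hzo ((hclos zo hzoU).2 (Or.inr h))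
  have hzo' : zo ∉ Ω := fun h => hzo (subset_closure h)
  -- Both sides inside `Ω` is excluded by the exterior point `zo`, both outside by the interior
  -- point `zi`. The two mixed cases are the two alternatives.
  rcases hP with hP | hP <;> rcases hN with hN | hN
  · exact absurd (hzo0.lt_or_gt.elim (fun h => hN ⟨hzoU, h⟩) (fun h => hP ⟨hzoU, h⟩)) hzo'
  · right
    intro y hy
    have h1 : y ∈ Ω ↔ 0 < f y := by
      refine ⟨fun h => ?_, fun h => hP ⟨hy, h⟩⟩
      rcases lt_trichotomy (f y) 0 with h' | h' | h'
      · exact absurd h (disjoint_left.1 hN ⟨hy, h'⟩)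
      · exact absurd h (hzero y hy h')
      · exact h'
    refine ⟨h1, ?_⟩
    rw [hclos y hy, h1, le_iff_lt_or_eq, eq_comm (a := (0 : ℝ))]
  · left
    intro y hy
    have h1 : y ∈ Ω ↔ f y < 0 := by
      refine ⟨fun h => ?_, fun h => hN ⟨hy, h⟩⟩
      rcases lt_trichotomy (f y) 0 with h' | h' | h'
      · exact h'
      · exact absurd h (hzero y hy h')
      · exact absurd h (disjoint_left.1 hP ⟨hy, h'⟩)
    refine ⟨h1, ?_⟩
    rw [hclos y hy, h1, le_iff_lt_or_eq]
  · exact (hzi0.lt_or_gt.elim (fun h => absurd hzi (disjoint_left.1 hN ⟨hziU, h⟩))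
      (fun h => absurd hzi (disjoint_left.1 hP ⟨hziU, h⟩)))

/-- A bounded Lipschitz domain is nowhere on both sides of its boundary. -/
theorem IsBddLipschitzDomain.frontier_subset {Ω : Set (Ambient d)} (hΩ : IsBddLipschitzDomain Ω) :
    frontier Ω ⊆ closure (closure Ω)ᶜ := by
  intro x hx
  obtain ⟨e, he, g, ⟨L, hL⟩, r, hr, h⟩ := hΩ.localGraph x hx
  have hxΩ : x ∉ Ω := by
    rw [hΩ.isOpen.frontier_eq] at hx
    exact hx.2
  have hgx : g (x - inner ℝ e x • e) ≤ inner ℝ e x := by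
    by_contra hcon
    exact hxΩ ((h x (Metric.mem_ball_self hr)).2 (not_le.1 hcon))
  have hee : inner ℝ e e = (1 : ℝ) := by rw [real_inner_self_eq_norm_sq, he]; norm_num
  -- The points `x + s • e` with small `s > 0` lie strictly above the graph, and so do all points
  -- near them; they are thus exterior points tending to `x`.
  have hlim : Tendsto (fun s : ℝ => x + s • e) (𝓝[>] 0) (𝓝 x) := by
    have : Tendsto (fun s : ℝ => x + s • e) (𝓝 0) (𝓝 (x + (0 : ℝ) • e)) :=
      (Continuous.tendsto (by fun_prop) 0)
    rw [zero_smul, add_zero] at this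
    exact this.mono_left nhdsWithin_le_nhds
  refine mem_closure_of_tendsto hlim ?_
  filter_upwards [hlim.eventually (Metric.ball_mem_nhds x hr), self_mem_nhdsWithin] with s hs hs0
  rw [← interior_compl, mem_interior_iff_mem_nhds]
  have hgt : ∀ᶠ y in 𝓝 (x + s • e), g (y - inner ℝ e y • e) < inner ℝ e y := by
    have hc1 : Continuous fun y : Ambient d => g (y - inner ℝ e y • e) :=
      hL.continuous.comp (by fun_prop)
    refine (isOpen_lt hc1 (by fun_prop)).mem_nhds ?_
    simp only [mem_ofPred_eq, inner_add_right, inner_smul_right, hee, mul_one]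
    have : x + s • e - (inner ℝ e x + s) • e = x - inner ℝ e x • e := by
      rw [add_smul]; abel
    rw [this]
    have : 0 < s := hs0
    linarith
  filter_upwards [hgt, Metric.isOpen_ball.mem_nhds hs] with y h1 h2
  intro hy
  exact absurd ((h y h2).1 hy) (not_lt.2 h1.le)

end SurfFEM

namespace SurfFEM

variable {d : ℕ} {M : Type*} [TopologicalSpace M] {𝓚 : Mesh d M}

/-- Open subsets of the interior of a cell are open in the manifold. -/
theorem Mesh.isOpen_image [T2Space M] (𝓚 : Mesh d M) (K : 𝓚.Cell) {U : Set (Coord d)} (hU : IsOpen U)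
    (hUK : U ⊆ interior (𝓚.dom K)) : IsOpen (𝓚.param K '' U) := by
  -- The complement is a finite union of compact images: the other cells and the rest of this one.
  -- Invariance of domain is therefore not needed.
  have hcompl : (𝓚.param K '' U)ᶜ =
      (⋃ L ∈ {L | L ≠ K}, 𝓚.param L '' 𝓚.dom L) ∪ 𝓚.param K '' (𝓚.dom K \ U) := by
    ext ξ
    constructor
    · intro hξ
      have : ξ ∈ ⋃ L, 𝓚.param L '' 𝓚.dom L := 𝓚.cover ▸ mem_univ ξ
      obtain ⟨L, u, hu, rfl⟩ := mem_iUnion.1 this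
      by_cases hL : L = K
      · subst hL
        exact Or.inr ⟨u, ⟨hu, fun h => hξ ⟨u, h, rfl⟩⟩, rfl⟩
      · exact Or.inl (mem_iUnion₂.2 ⟨L, hL, u, hu, rfl⟩)
    · rintro (h | ⟨u, hu, rfl⟩) ⟨w, hw, hwξ⟩
      · obtain ⟨L, hL, hξ⟩ := mem_iUnion₂.1 h
        exact disjoint_left.1 (𝓚.interior_disjoint K L (Ne.symm hL)) ⟨w, hUK hw, hwξ⟩ hξ
      · have := 𝓚.injOn_param K (interior_subset (hUK hw)) hu.1 hwξ
        exact hu.2 (this ▸ hw)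
  rw [← isClosed_compl_iff, hcompl]
  have hc : ∀ L, ∀ S ⊆ 𝓚.dom L, IsClosed S → IsClosed (𝓚.param L '' S) := fun L S hS hSc =>
    (((𝓚.isCompact_dom L).of_isClosed_subset hSc hS).image_of_continuousOn
      ((𝓚.continuousOn_param L).mono hS)).isClosed
  refine IsClosed.union ((toFinite _).isClosed_biUnion fun L _ =>
    hc L _ subset_rfl (𝓚.isCompact_dom L).isClosed) (hc K _ sdiff_subset ?_)
  exact (𝓚.isCompact_dom K).isClosed.sdiff hU

/-- A point of the interior of a cell lies in no other cell and has only one coordinate. -/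
theorem Mesh.eq_of_param_eq (𝓚 : Mesh d M) {K L : 𝓚.Cell} {u w : Coord d}
    (hu : u ∈ interior (𝓚.dom K)) (hw : w ∈ 𝓚.dom L) (h : 𝓚.param K u = 𝓚.param L w) :
    (⟨K, u⟩ : 𝓚.Cell × Coord d) = ⟨L, w⟩ := by
  by_cases hKL : K = L
  · subst hKL
    rw [𝓚.injOn_param K (interior_subset hu) hw h]
  · exact absurd ⟨w, hw, h.symm⟩ (disjoint_left.1 (𝓚.interior_disjoint K L hKL) ⟨u, hu, rfl⟩)

theorem Mesh.exists_param (𝓚 : Mesh d M) (ξ : M) : ∃ K, ∃ u ∈ 𝓚.dom K, 𝓚.param K u = ξ := by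
  have : ξ ∈ ⋃ L, 𝓚.param L '' 𝓚.dom L := 𝓚.cover ▸ mem_univ ξ
  obtain ⟨L, u, hu, rfl⟩ := mem_iUnion.1 this
  exact ⟨L, u, hu, rfl⟩

/-- The differentials of an immersion are injective. -/
theorem cellDeriv_injective {X : M → Ambient d} {K : 𝓚.Cell} {u : Coord d}
    (hJ : 0 < jacobian 𝓚 X K u) (w : Coord d) (hw : cellDeriv 𝓚 X K u w = 0) : w = 0 := by
  by_contra hne
  have hdet : (metricTensor 𝓚 X K u).det ≠ 0 := fun h => by
    rw [jacobian, h, Real.sqrt_zero] at hJ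
    exact lt_irrefl _ hJ
  refine hdet (Matrix.exists_mulVec_eq_zero_iff.1 ⟨w.ofLp, fun h => hne ?_, ?_⟩)
  · ext i; exact congrFun h i
  · have hexp : cellDeriv 𝓚 X K u w = ∑ j, w j • tangentVec 𝓚 X K u j := by
      conv_lhs => rw [← (EuclideanSpace.basisFun (Fin d) ℝ).sum_repr w]
      simp [tangentVec, map_sum]
    ext i
    have : inner ℝ (tangentVec 𝓚 X K u i) (cellDeriv 𝓚 X K u w) = 0 := by
      rw [hw, inner_zero_right]
    rw [hexp, inner_sum] at this
    simp only [inner_smul_right] at this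
    simp only [Matrix.mulVec, dotProduct, metricTensor, Matrix.of_apply, Pi.zero_apply]
    rw [← this]
    exact Finset.sum_congr rfl fun j _ => mul_comm _ _

/-- A tangent space of dimension at most `d` has a unit normal. -/
theorem exists_unit_normal (A : Coord d →L[ℝ] Ambient d) :
    ∃ n : Ambient d, ‖n‖ = 1 ∧ ∀ w, inner ℝ n (A w) = 0 := by
  have hlt : Module.finrank ℝ (LinearMap.range A.toLinearMap) < Module.finrank ℝ (Ambient d) := by
    have := LinearMap.finrank_range_le A.toLinearMap
    simp only [finrank_euclideanSpace, Fintype.card_fin] at this ⊢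
    omega
  have hne : (LinearMap.range A.toLinearMap)ᗮ ≠ ⊥ := by
    intro h
    rw [Submodule.orthogonal_eq_bot_iff] at h
    rw [h, finrank_top] at hlt
    exact lt_irrefl _ hlt
  obtain ⟨v, hv, hv0⟩ := Submodule.exists_mem_ne_zero_of_ne_bot hne
  refine ⟨‖v‖⁻¹ • v, ?_, fun w => ?_⟩
  · rw [norm_smul, norm_inv, norm_norm, inv_mul_cancel₀ (norm_ne_zero_iff.2 hv0)]
  · rw [inner_smul_left, real_inner_comm, hv (A w) ⟨w, rfl⟩, mul_zero]

/-- The position of the surface in space-time, in the coordinates of a cell. -/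
def cellMap (𝓚 : Mesh d M) (Z : ℝ → M → Ambient d) (K : 𝓚.Cell) (z : ℝ × Coord d) : Ambient d :=
  Z z.1 (𝓚.param K z.2)

/-- A motion of the surface that is continuously differentiable on the closed cells. -/
structure IsSmoothMotion (𝓚 : Mesh d M) (Z : ℝ → M → Ambient d) : Prop where
  continuous : Continuous fun q : ℝ × M => Z q.1 q.2
  contDiffOn : ∀ K, ContDiffOn ℝ 1 (cellMap 𝓚 Z K) (univ ×ˢ 𝓚.dom K)

section Motion

variable {Z : ℝ → M → Ambient d} (hZ : IsSmoothMotion 𝓚 Z)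
include hZ

theorem IsSmoothMotion.contDiffAt {K : 𝓚.Cell} {z : ℝ × Coord d} (hz : z.2 ∈ interior (𝓚.dom K)) :
    ContDiffAt ℝ 1 (cellMap 𝓚 Z K) z :=
  (hZ.contDiffOn K).contDiffAt (prod_mem_nhds univ_mem (mem_interior_iff_mem_nhds.1 hz))

theorem IsSmoothMotion.hasStrictFDerivAt {K : 𝓚.Cell} {z : ℝ × Coord d}
    (hz : z.2 ∈ interior (𝓚.dom K)) :
    HasStrictFDerivAt (cellMap 𝓚 Z K) (fderiv ℝ (cellMap 𝓚 Z K) z) z :=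
  (hZ.contDiffAt hz).hasStrictFDerivAt one_ne_zero

theorem IsSmoothMotion.hasFDerivAt_space {K : 𝓚.Cell} {τ : ℝ} {u : Coord d}
    (hu : u ∈ interior (𝓚.dom K)) :
    HasFDerivAt (fun w => Z τ (𝓚.param K w))
      ((fderiv ℝ (cellMap 𝓚 Z K) (τ, u)).comp (ContinuousLinearMap.inr ℝ ℝ (Coord d))) u := by
  have h1 := (hZ.hasStrictFDerivAt (z := (τ, u)) hu).hasFDerivAt
  have h2 : HasFDerivAt (fun w : Coord d => (τ, w)) (ContinuousLinearMap.inr ℝ ℝ (Coord d)) u :=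
    hasFDerivAt_prodMk_right τ u
  exact h1.comp u h2

theorem IsSmoothMotion.cellDeriv_eq {K : 𝓚.Cell} {τ : ℝ} {u : Coord d}
    (hu : u ∈ interior (𝓚.dom K)) (w : Coord d) :
    cellDeriv 𝓚 (Z τ) K u w = fderiv ℝ (cellMap 𝓚 Z K) (τ, u) (0, w) := by
  have h := hZ.hasFDerivAt_space (τ := τ) hu
  rw [cellDeriv, fderivWithin_of_mem_nhds (mem_interior_iff_mem_nhds.1 hu), h.fderiv]
  rfl

theorem IsSmoothMotion.velocity_eq {K : 𝓚.Cell} {τ : ℝ} {u : Coord d}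
    (hu : u ∈ interior (𝓚.dom K)) :
    velocity Z τ (𝓚.param K u) = fderiv ℝ (cellMap 𝓚 Z K) (τ, u) (1, 0) := by
  have h1 := (hZ.hasStrictFDerivAt (z := (τ, u)) hu).hasFDerivAt
  have h2 : HasDerivAt (fun σ : ℝ => (σ, u)) ((1 : ℝ), (0 : Coord d)) τ :=
    (hasDerivAt_id τ).prodMk (hasDerivAt_const τ u)
  exact (h1.comp_hasDerivAt τ h2).deriv

end Motion

/-- On the points of the neighbourhood `W` at time `τ`, the region `Ω` is given by `f < 0`. -/
def IsSublevel (Ω : Set (Ambient d)) (W : Set (ℝ × Ambient d)) (f : ℝ × Ambient d → ℝ) (τ : ℝ) :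
    Prop :=
  ∀ y, (τ, y) ∈ W → (y ∈ Ω ↔ f (τ, y) < 0) ∧ (y ∈ closure Ω ↔ f (τ, y) ≤ 0)

/-- Near a point of the interior of a cell the moving surface has, in space-time, a defining function
with the expected derivative, and the enclosed region lies on one of its sides. -/
theorem IsSmoothMotion.exists_definingFunction [T2Space M] [CompactSpace M] {Z : ℝ → M → Ambient d}
    (hZ : IsSmoothMotion 𝓚 Z) {Ω : ℝ → Set (Ambient d)} {I : Set ℝ}
    (hI : ∀ τ ∈ I, Encloses 𝓚 (Z τ) (Ω τ)) {τ₀ : ℝ} (hτ₀ : τ₀ ∈ I) {K : 𝓚.Cell} {u₀ : Coord d}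
    (hu₀ : u₀ ∈ interior (𝓚.dom K)) {n : Ambient d} (hn : ‖n‖ = 1)
    (hperp : ∀ w, inner ℝ n (cellDeriv 𝓚 (Z τ₀) K u₀ w) = 0) :
    ∃ f : ℝ × Ambient d → ℝ, f (τ₀, Z τ₀ (𝓚.param K u₀)) = 0 ∧
      HasStrictFDerivAt f
        ((innerSL ℝ n).comp (ContinuousLinearMap.snd ℝ ℝ (Ambient d)) -
          inner ℝ n (velocity Z τ₀ (𝓚.param K u₀)) • ContinuousLinearMap.fst ℝ ℝ (Ambient d))
        (τ₀, Z τ₀ (𝓚.param K u₀)) ∧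
      ∃ W, IsOpen W ∧ (τ₀, Z τ₀ (𝓚.param K u₀)) ∈ W ∧ ContinuousOn f W ∧ ∀ τ ∈ I,
        IsSublevel (Ω τ) W f τ ∨ IsSublevel (Ω τ) W (-f) τ := by
  obtain ⟨P, hP, hmem, hder⟩ := exists_straightening (hZ.hasStrictFDerivAt (z := (τ₀, u₀)) hu₀) hn
    (fun w => by rw [← hZ.cellDeriv_eq hu₀]; exact hperp w)
    (fun w hw => cellDeriv_injective ((hI τ₀ hτ₀).jacobian_pos K u₀ (interior_subset hu₀)) w
      (by rw [hZ.cellDeriv_eq hu₀]; exact hw))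
  set x₀ := Z τ₀ (𝓚.param K u₀) with hx₀
  have hPx : P (τ₀, (u₀, 0)) = (τ₀, x₀) := by rw [hP]; simp [cellMap, hx₀]
  -- The defining function is the height in the straightened coordinates. Its zeros are exactly the
  -- surface points only where no other part of the surface comes near, which the two radii `r` and
  -- `r'` ensure.
  set f : ℝ × Ambient d → ℝ := fun q => (P.symm q).2.2 with hf
  have hfP : ∀ q ∈ P.source, f (P q) = q.2.2 := fun q hq => by simp only [hf, P.left_inv hq]
  -- a box on which the straightening is injective
  obtain ⟨r, hr, hball⟩ : ∃ r > 0, Metric.ball (τ₀, (u₀, (0 : ℝ))) r ⊆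
      P.source ∩ {q | q.2.1 ∈ interior (𝓚.dom K)} := by
    refine Metric.mem_nhds_iff.1 (inter_mem (P.open_source.mem_nhds hmem) ?_)
    exact (isOpen_interior.preimage (by fun_prop : Continuous fun q : ℝ × (Coord d × ℝ) => q.2.1)).mem_nhds
      hu₀
  have hmemball : ∀ (τ : ℝ) (u : Coord d) (s ρ : ℝ), (τ, (u, s)) ∈ Metric.ball (τ₀, (u₀, (0 : ℝ))) ρ ↔
      τ ∈ Metric.ball τ₀ ρ ∧ u ∈ Metric.ball u₀ ρ ∧ s ∈ Metric.ball (0 : ℝ) ρ := by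
    intro τ u s ρ
    rw [← ball_prod_same, ← ball_prod_same, mem_prod, mem_prod]
  have hballK : Metric.ball u₀ r ⊆ interior (𝓚.dom K) := fun u hu =>
    (hball ((hmemball τ₀ u 0 r).2 ⟨Metric.mem_ball_self hr, hu, Metric.mem_ball_self hr⟩)).2
  -- the remaining part of the surface stays away
  have hfar : ∀ᶠ q : ℝ × Ambient d in 𝓝 (τ₀, x₀),
      ∀ ξ ∈ (𝓚.param K '' Metric.ball u₀ r)ᶜ, Z q.1 ξ ≠ q.2 := by
    refine IsCompact.eventually_forall_of_forall_eventually
      (𝓚.isOpen_image K Metric.isOpen_ball hballK).isClosed_compl.isCompact fun ξ hξ => ?_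
    have hc : Continuous fun z : (ℝ × Ambient d) × M => Z z.1.1 z.2 :=
      hZ.continuous.comp (by fun_prop : Continuous fun z : (ℝ × Ambient d) × M => (z.1.1, z.2))
    refine (isOpen_ne_fun hc (by fun_prop)).mem_nhds fun h => hξ ?_
    rw [show ξ = 𝓚.param K u₀ from (hI τ₀ hτ₀).injective h]
    exact ⟨u₀, Metric.mem_ball_self hr, rfl⟩
  obtain ⟨r', hr', hball'⟩ : ∃ r' > 0, Metric.ball (τ₀, (u₀, (0 : ℝ))) r' ⊆
      {q | ∀ ξ ∈ (𝓚.param K '' Metric.ball u₀ r)ᶜ, Z (P q).1 ξ ≠ (P q).2} := by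
    have : ∀ᶠ q in 𝓝 (τ₀, (u₀, (0 : ℝ))),
        ∀ ξ ∈ (𝓚.param K '' Metric.ball u₀ r)ᶜ, Z (P q).1 ξ ≠ (P q).2 :=
      (P.continuousAt hmem).eventually (by rw [hPx]; exact hfar)
    exact Metric.mem_nhds_iff.1 this
  set ρ := min r r' with hρ
  have hρ0 : 0 < ρ := lt_min hr hr'
  have hρr : Metric.ball (τ₀, (u₀, (0 : ℝ))) ρ ⊆ Metric.ball (τ₀, (u₀, (0 : ℝ))) r :=
    Metric.ball_subset_ball (min_le_left _ _)
  have hρr' : Metric.ball (τ₀, (u₀, (0 : ℝ))) ρ ⊆ Metric.ball (τ₀, (u₀, (0 : ℝ))) r' :=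
    Metric.ball_subset_ball (min_le_right _ _)
  have hρs : Metric.ball (τ₀, (u₀, (0 : ℝ))) ρ ⊆ P.source := fun q hq => (hball (hρr hq)).1
  have hWo : IsOpen (P '' Metric.ball (τ₀, (u₀, (0 : ℝ))) ρ) :=
    P.isOpen_image_of_subset_source Metric.isOpen_ball hρs
  refine ⟨f, ?_, ?_, P '' Metric.ball (τ₀, (u₀, (0 : ℝ))) ρ, hWo,
    ⟨_, Metric.mem_ball_self hρ0, hPx⟩, ?_, fun τ hτ => ?_⟩
  · rw [← hPx, hfP _ hmem]
  · rw [hZ.velocity_eq hu₀]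
    exact hder
  · refine ContinuousOn.snd (ContinuousOn.snd (P.continuousOn_symm.mono ?_))
    rintro _ ⟨q, hq, rfl⟩
    exact P.map_source (hρs hq)
  set W := P '' Metric.ball (τ₀, (u₀, (0 : ℝ))) ρ with hW
  have hdesc : ∀ y, (τ, y) ∈ W → ∃ u s, (τ, (u, s)) ∈ Metric.ball (τ₀, (u₀, (0 : ℝ))) ρ ∧
      y = cellMap 𝓚 Z K (τ, u) + s • n ∧ f (τ, y) = s := by
    rintro y ⟨⟨τ', u, s⟩, hq, hqy⟩
    have h1 := hqy
    rw [hP] at h1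
    simp only [Prod.mk.injEq] at h1
    obtain ⟨rfl, h1⟩ := h1
    exact ⟨u, s, hq, h1.symm, by rw [← hqy]; exact hfP _ (hρs hq)⟩
  have hcell : ∀ u s, (τ, (u, s)) ∈ Metric.ball (τ₀, (u₀, (0 : ℝ))) ρ →
      (τ, cellMap 𝓚 Z K (τ, u) + s • n) ∈ W ∧ f (τ, cellMap 𝓚 Z K (τ, u) + s • n) = s := by
    intro u s h
    have : P (τ, (u, s)) = (τ, cellMap 𝓚 Z K (τ, u) + s • n) := hP _
    rw [← this]
    exact ⟨⟨_, h, rfl⟩, hfP _ (hρs h)⟩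
  -- Outside the time range of the box the slice of `W` is empty, and either alternative holds
  -- vacuously.
  by_cases hτρ : τ ∈ Metric.ball τ₀ ρ
  swap
  · left
    intro y hy
    obtain ⟨u, s, h, -, -⟩ := hdesc y hy
    exact absurd ((hmemball τ u s ρ).1 h).1 hτρ
  -- Each side of the surface in the slice is the continuous image of a convex set of coordinates,
  -- hence connected.
  have hconn : ∀ S : Set ℝ, Convex ℝ S →
      IsPreconnected ({y | (τ, y) ∈ W} ∩ {y | f (τ, y) ∈ S}) := by
    intro S hS
    have himg : {y | (τ, y) ∈ W} ∩ {y | f (τ, y) ∈ S} =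
        (fun q : Coord d × ℝ => cellMap 𝓚 Z K (τ, q.1) + q.2 • n) ''
          (Metric.ball u₀ ρ ×ˢ (Metric.ball (0 : ℝ) ρ ∩ S)) := by
      ext y
      constructor
      · rintro ⟨hy, hys⟩
        obtain ⟨u, s, h, rfl, hfs⟩ := hdesc y hy
        have h' := (hmemball τ u s ρ).1 h
        exact ⟨(u, s), ⟨h'.2.1, h'.2.2, hfs ▸ hys⟩, rfl⟩
      · rintro ⟨⟨u, s⟩, ⟨hu, hs, hsS⟩, rfl⟩
        have h := hcell u s ((hmemball τ u s ρ).2 ⟨hτρ, hu, hs⟩)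
        refine ⟨h.1, ?_⟩
        rw [mem_ofPred_eq, h.2]
        exact hsS
    rw [himg]
    refine ((convex_ball u₀ ρ).prod ((convex_ball (0 : ℝ) ρ).inter hS)).isPreconnected.image _ ?_
    refine ContinuousOn.add ?_ (by fun_prop)
    have h1 : ContinuousOn (fun q : Coord d × ℝ => (τ, q.1)) (Metric.ball u₀ ρ ×ˢ (Metric.ball (0 : ℝ) ρ ∩ S)) :=
      by fun_prop
    refine (hZ.contDiffOn K).continuousOn.comp h1 fun q hq => ⟨mem_univ _, ?_⟩
    exact interior_subset (hballK (Metric.ball_subset_ball (min_le_left _ _) hq.1))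
  have hmid := (hmemball τ u₀ 0 ρ).2 ⟨hτρ, Metric.mem_ball_self hρ0, Metric.mem_ball_self hρ0⟩
  have hmid' := hcell u₀ 0 hmid
  have := mem_iff_of_separated (hI τ hτ).lipschitz.isOpen (hI τ hτ).lipschitz.frontier_subset
    (U := {y | (τ, y) ∈ W}) (hWo.preimage (by fun_prop)) (f := fun y => f (τ, y))
    (hconn (Ioi 0) (convex_Ioi 0)) (hconn (Iio 0) (convex_Iio 0)) (fun y hy => ?_)
    ⟨_, hmid'.1, hmid'.2⟩
  · rcases this with h | h
    · exact Or.inl fun y hy => h y hy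
    · right
      intro y hy
      have := h y hy
      simpa using this
  · obtain ⟨u, s, h, hyu, hfs⟩ := hdesc y hy
    rw [← (hI τ hτ).range_eq, hfs]
    constructor
    · rintro ⟨ξ, hξ⟩
      have hnear := hball' (hρr' h)
      have hPq : P (τ, (u, s)) = (τ, y) := by rw [hP, hyu]
      rw [mem_ofPred_eq, hPq] at hnear
      -- A surface point in the slice comes from the patch of radius `r`, on which the straightening
      -- is still injective. It has height `0` there, hence `s = 0`.
      have hξK : ξ ∈ 𝓚.param K '' Metric.ball u₀ r := by
        by_contra hcon
        exact hnear ξ hcon hξ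
      obtain ⟨w, hw, rfl⟩ := hξK
      have hτr : τ ∈ Metric.ball τ₀ r := ((hmemball τ u s r).1 (hρr h)).1
      have hw' : (τ, (w, (0 : ℝ))) ∈ P.source :=
        (hball ((hmemball τ w 0 r).2 ⟨hτr, hw, Metric.mem_ball_self hr⟩)).1
      have heq : P (τ, (w, 0)) = P (τ, (u, s)) := by
        rw [hPq, hP]
        simp [cellMap, hξ]
      have := P.injOn hw' (hρs h) heq
      simp only [Prod.mk.injEq] at this
      exact this.2.2.symm
    · rintro rfl
      exact ⟨𝓚.param K u, by rw [hyu]; simp [cellMap]⟩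

end SurfFEM

/-! ### Membership in the enclosed region is locally constant in time -/

namespace SurfFEM

variable {d : ℕ} {M : Type*} [TopologicalSpace M] {𝓚 : Mesh d M}

/-- Near a point off the surface, the whole neighbourhood stays on one side. -/
theorem IsSmoothMotion.exists_ball_off [CompactSpace M] {Z : ℝ → M → Ambient d}
    (hZ : IsSmoothMotion 𝓚 Z) {Ω : ℝ → Set (Ambient d)} {I : Set ℝ}
    (hI : ∀ τ ∈ I, Encloses 𝓚 (Z τ) (Ω τ)) {τ₀ : ℝ} (hτ₀ : τ₀ ∈ I) {x : Ambient d}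
    (hx : x ∉ frontier (Ω τ₀)) :
    ∃ r > 0, ∀ᶠ τ in 𝓝[I] τ₀, ∀ y ∈ Metric.ball x r, (y ∈ Ω τ ↔ x ∈ Ω τ) := by
  have hfar : ∀ᶠ q : ℝ × Ambient d in 𝓝 (τ₀, x), ∀ ξ ∈ (univ : Set M), Z q.1 ξ ≠ q.2 := by
    refine IsCompact.eventually_forall_of_forall_eventually isCompact_univ fun ξ _ => ?_
    have hc : Continuous fun z : (ℝ × Ambient d) × M => Z z.1.1 z.2 :=
      hZ.continuous.comp (by fun_prop : Continuous fun z : (ℝ × Ambient d) × M => (z.1.1, z.2))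
    refine (isOpen_ne_fun hc (by fun_prop)).mem_nhds fun h => hx ?_
    rw [← (hI τ₀ hτ₀).range_eq]
    exact ⟨ξ, h⟩
  obtain ⟨r, hr, hball⟩ := Metric.mem_nhds_iff.1 hfar
  refine ⟨r, hr, ?_⟩
  filter_upwards [self_mem_nhdsWithin, mem_nhdsWithin_of_mem_nhds (Metric.ball_mem_nhds τ₀ hr)]
    with τ hτ hτr y hy
  have hoff : ∀ z ∈ Metric.ball x r, z ∉ frontier (Ω τ) := by
    intro z hz hzf
    rw [← (hI τ hτ).range_eq] at hzf
    obtain ⟨ξ, hξ⟩ := hzf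
    refine hball (?_ : (τ, z) ∈ Metric.ball (τ₀, x) r) ξ (mem_univ _) hξ
    rw [← ball_prod_same]
    exact ⟨hτr, hz⟩
  rcases subset_or_disjoint_of_disjoint_frontier (convex_ball x r).isPreconnected
    (hI τ hτ).lipschitz.isOpen hoff with h | h
  · exact ⟨fun _ => h (Metric.mem_ball_self hr), fun _ => h hy⟩
  · exact ⟨fun h' => absurd h' (disjoint_left.1 h hy),
      fun h' => absurd h' (disjoint_left.1 h (Metric.mem_ball_self hr))⟩

theorem hasDerivAt_along_line {f : ℝ × Ambient d → ℝ} {L : ℝ × Ambient d →L[ℝ] ℝ}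
    {τ : ℝ} {x : Ambient d} (v : Ambient d) (hf : HasStrictFDerivAt f L (τ, x)) :
    HasDerivAt (fun s : ℝ => f (τ, x + s • v)) (L (0, v)) 0 := by
  have h1 : HasDerivAt (fun s : ℝ => (τ, x + s • v)) ((0 : ℝ), v) 0 := by
    refine (hasDerivAt_const _ _).prodMk ?_
    simpa using ((hasDerivAt_id (0 : ℝ)).smul_const v).const_add x
  have h2 : HasStrictFDerivAt f L (τ, x + (0 : ℝ) • v) := by simpa using hf
  exact h2.hasFDerivAt.comp_hasDerivAt (0 : ℝ) h1

/-- The value `0` of a real function with invertible derivative is isolated, also for derivatives along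
an affine line. -/
theorem eventually_ne_along_line {f : ℝ × Ambient d → ℝ} {L : ℝ × Ambient d →L[ℝ] ℝ}
    {τ : ℝ} {x v : Ambient d} (hf : HasStrictFDerivAt f L (τ, x)) (hL : L (0, v) ≠ 0) :
    ∀ᶠ s : ℝ in 𝓝[≠] 0, f (τ, x + s • v) ≠ 0 :=
  (hasDerivAt_along_line v hf).eventually_ne hL

/-- The set of positions of vertical lines that are tangent to the surface or meet the boundaries of
the cells. -/
def badLines (𝓚 : Mesh d M) (X : M → Ambient d) : Set (Coord d) :=
  ⋃ K, (fun u => (splitFirst d (X (𝓚.param K u))).2) ''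
    (frontier (𝓚.dom K) ∪ {u | u ∈ interior (𝓚.dom K) ∧
      (fderiv ℝ (fun u => (splitFirst d (X (𝓚.param K u))).2) u).det = 0})

/-- The boundary of a convex body is null and differentiable maps of `ℝ^d` preserve null sets; the
critical values are null by Sard's theorem in equal dimensions. Almost every vertical line is thus
transversal to the surface and misses the boundaries of the cells. -/
theorem volume_badLines {X : M → Ambient d}
    (hX : ∀ K, DifferentiableOn ℝ (fun u => X (𝓚.param K u)) (𝓚.dom K)) :
    volume (badLines 𝓚 X) = 0 := by
  refine measure_iUnion_null fun K => ?_
  have hdiff : DifferentiableOn ℝ (fun u => (splitFirst d (X (𝓚.param K u))).2) (𝓚.dom K) :=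
    (((splitFirst d).differentiable.comp_differentiableOn (hX K))).snd
  rw [image_union]
  refine measure_union_null ?_ ?_
  · exact addHaar_image_eq_zero_of_differentiableOn_of_addHaar_eq_zero _
      (hdiff.mono (𝓚.isCompact_dom K).isClosed.frontier_subset)
      ((𝓚.convex_dom K).addHaar_frontier volume)
  · refine addHaar_image_eq_zero_of_det_fderivWithin_eq_zero volume
      (f' := fderiv ℝ (fun u => (splitFirst d (X (𝓚.param K u))).2)) (fun u hu => ?_)
      (fun u hu => hu.2)
    exact (hdiff.differentiableAt (mem_interior_iff_mem_nhds.1 hu.1)).hasFDerivAt.hasFDerivWithinAt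

variable [T2Space M] [CompactSpace M] {Z : ℝ → M → Ambient d} (hZ : IsSmoothMotion 𝓚 Z)
  {Ω : ℝ → Set (Ambient d)} {I : Set ℝ} (hI : ∀ τ ∈ I, Encloses 𝓚 (Z τ) (Ω τ))
include hZ hI

omit [T2Space M] in
/-- Far out on a vertical line there are no points of the enclosed regions. -/
theorem IsSmoothMotion.eventually_line_not_mem {τ₀ : ℝ} (x' : Coord d) :
    ∃ ρ : ℝ, ∀ᶠ τ in 𝓝[I] τ₀, ∀ y > ρ, (splitFirst d).symm (y, x') ∉ Ω τ := by
  have hcomp : IsCompact (range (Z τ₀)) :=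
    isCompact_range (hZ.continuous.comp (by fun_prop : Continuous fun ξ : M => (τ₀, ξ)))
  obtain ⟨ρ, hρ⟩ := hcomp.isBounded.exists_norm_le
  have hfar : ∀ᶠ τ in 𝓝 τ₀, ∀ ξ ∈ (univ : Set M), ‖Z τ ξ‖ < ρ + 1 := by
    refine IsCompact.eventually_forall_of_forall_eventually isCompact_univ fun ξ _ => ?_
    refine (isOpen_lt hZ.continuous.norm continuous_const).mem_nhds ?_
    have := hρ _ ⟨ξ, rfl⟩
    simp only [mem_ofPred_eq]
    linarith
  have hcoord : ∀ y, ((splitFirst d).symm (y, x')) 0 = y := by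
    intro y
    have := (splitFirst d).apply_symm_apply (y, x')
    rw [splitFirst_apply] at this
    exact congrArg Prod.fst this
  have hnorm : ∀ y, y ≤ ‖(splitFirst d).symm (y, x')‖ := by
    intro y
    calc y ≤ |y| := le_abs_self y
      _ = ‖((splitFirst d).symm (y, x')) 0‖ := by rw [hcoord, Real.norm_eq_abs]
      _ ≤ _ := PiLp.norm_apply_le _ _
  refine ⟨ρ + 1, ?_⟩
  filter_upwards [self_mem_nhdsWithin, mem_nhdsWithin_of_mem_nhds hfar] with τ hτ hτρ y hy
  have hpre : IsPreconnected ((fun y => (splitFirst d).symm (y, x')) '' Ioi (ρ + 1)) :=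
    isPreconnected_Ioi.image _ (by fun_prop)
  have hoff : ∀ z ∈ (fun y => (splitFirst d).symm (y, x')) '' Ioi (ρ + 1), z ∉ frontier (Ω τ) := by
    rintro _ ⟨y, hy, rfl⟩ hyf
    rw [← (hI τ hτ).range_eq] at hyf
    obtain ⟨ξ, hξ⟩ := hyf
    have h1 := hτρ ξ (mem_univ _)
    rw [hξ] at h1
    exact absurd (lt_of_lt_of_le (mem_Ioi.1 hy) (hnorm y)) (not_lt.2 h1.le)
  -- The half-line avoids the surface, so it is on one side; being unbounded, it cannot lie in the
  -- bounded region.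
  rcases subset_or_disjoint_of_disjoint_frontier hpre (hI τ hτ).lipschitz.isOpen hoff with h | h
  · obtain ⟨C, hC⟩ := (hI τ hτ).lipschitz.isBounded.exists_norm_le
    have h1 := hC _ (h ⟨max (ρ + 2) (C + 1), by
      simp only [mem_Ioi, lt_max_iff]; left; linarith, rfl⟩)
    have h2 := hnorm (max (ρ + 2) (C + 1))
    have h3 := le_max_right (ρ + 2) (C + 1)
    simp only at h1
    linarith
  · exact disjoint_left.1 h ⟨y, hy, rfl⟩

/-- Membership of a point off the surface in the enclosed region is locally constant in time. -/
theorem IsSmoothMotion.eventually_mem_iff {τ₀ : ℝ} (hτ₀ : τ₀ ∈ I) {x : Ambient d}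
    (hx : x ∉ frontier (Ω τ₀)) : ∀ᶠ τ in 𝓝[I] τ₀, (x ∈ Ω τ ↔ x ∈ Ω τ₀) := by
  obtain ⟨r, hr, hball⟩ := hZ.exists_ball_off hI hτ₀ hx
  have hdiff : ∀ K, DifferentiableOn ℝ (fun u => Z τ₀ (𝓚.param K u)) (𝓚.dom K) := fun K =>
    ((hZ.contDiffOn K).differentiableOn one_ne_zero).comp (f := fun u => (τ₀, u))
      (by fun_prop) fun u hu => ⟨mem_univ _, hu⟩
  -- a generic vertical line near `x`
  obtain ⟨x', hx'b, hx'⟩ : ∃ x' : Coord d,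
      (splitFirst d).symm ((splitFirst d x).1, x') ∈ Metric.ball x r ∧ x' ∉ badLines 𝓚 (Z τ₀) := by
    have hopen : IsOpen {x' : Coord d |
        (splitFirst d).symm ((splitFirst d x).1, x') ∈ Metric.ball x r} :=
      Metric.isOpen_ball.preimage (by fun_prop)
    have hne : {x' : Coord d |
        (splitFirst d).symm ((splitFirst d x).1, x') ∈ Metric.ball x r}.Nonempty :=
      ⟨(splitFirst d x).2, by
        rw [mem_ofPred_eq, Prod.mk.eta, (splitFirst d).symm_apply_apply]
        exact Metric.mem_ball_self hr⟩
    by_contra hcon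
    push Not at hcon
    have h1 : volume {x' : Coord d |
        (splitFirst d).symm ((splitFirst d x).1, x') ∈ Metric.ball x r} = 0 :=
      measure_mono_null (fun x' hx' => hcon x' hx') (volume_badLines hdiff)
    exact (hopen.measure_pos volume hne).ne' h1
  set ℓ : ℝ → Ambient d := fun y => (splitFirst d).symm (y, x') with hℓ
  have hℓc : Continuous ℓ := by fun_prop
  set e₀ : Ambient d := EuclideanSpace.single 0 1 with he₀
  have hℓadd : ∀ y s, ℓ (y + s) = ℓ y + s • e₀ := by
    intro y s
    apply (splitFirst d).injective
    rw [map_add, map_smul, splitFirst_single_zero]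
    simp only [hℓ, ContinuousLinearEquiv.apply_symm_apply]
    simp
  -- `P` is followed along the line. It is locally constant off the surface, at each transversal
  -- crossing it holds on both sides or on neither, and it holds far out, where the points are
  -- outside at all nearby times. Hence it holds at the height of `x`.
  set P : ℝ → Prop := fun y => ∀ᶠ τ in 𝓝[I] τ₀, (ℓ y ∈ Ω τ ↔ ℓ y ∈ Ω τ₀) with hP
  have hoff : ∀ y, ℓ y ∉ frontier (Ω τ₀) → ∀ᶠ y' in 𝓝 y, (P y' ↔ P y) := by
    intro y hy
    obtain ⟨r, hr, hb⟩ := hZ.exists_ball_off hI hτ₀ hy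
    filter_upwards [hℓc.continuousAt.eventually (Metric.ball_mem_nhds _ hr)] with y' hy'
    have h0 := hb.self_of_nhdsWithin hτ₀ _ hy'
    refine eventually_congr ?_
    filter_upwards [hb] with τ hτ
    rw [hτ _ hy', h0]
  have hon : ∀ y, ℓ y ∈ frontier (Ω τ₀) →
      (∀ᶠ z in 𝓝[≠] y, P z) ∨ ∀ᶠ z in 𝓝[≠] y, ¬ P z := by
    intro y hy
    rw [← (hI τ₀ hτ₀).range_eq] at hy
    obtain ⟨ξ, hξ⟩ := hy
    obtain ⟨K, u, hu, rfl⟩ := 𝓚.exists_param ξ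
    have hproj : (splitFirst d (Z τ₀ (𝓚.param K u))).2 = x' := by
      rw [hξ]; simp only [hℓ, ContinuousLinearEquiv.apply_symm_apply]
    have hgood : ¬ (u ∈ frontier (𝓚.dom K) ∪ {u | u ∈ interior (𝓚.dom K) ∧
        (fderiv ℝ (fun u => (splitFirst d (Z τ₀ (𝓚.param K u))).2) u).det = 0}) := fun h =>
      hx' (mem_iUnion.2 ⟨K, u, h, hproj⟩)
    rw [mem_union, not_or] at hgood
    have hui : u ∈ interior (𝓚.dom K) := by
      by_contra h
      exact hgood.1 ⟨subset_closure hu, h⟩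
    have hdet : (fderiv ℝ (fun u => (splitFirst d (Z τ₀ (𝓚.param K u))).2) u).det ≠ 0 := fun h =>
      hgood.2 ⟨hui, h⟩
    obtain ⟨n, hn, hperp⟩ := exists_unit_normal (cellDeriv 𝓚 (Z τ₀) K u)
    -- The tangent space projects onto the horizontal coordinates, so some tangent vector differs
    -- from `n` by a multiple of `e₀`. If `e₀` were orthogonal to `n`, pairing with `n` would give
    -- `‖n‖ = 0`.
    have hne : inner ℝ n e₀ ≠ 0 := by
      intro h0
      have hder : HasFDerivAt (fun u => (splitFirst d (Z τ₀ (𝓚.param K u))).2)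
          ((ContinuousLinearMap.snd ℝ ℝ (Coord d)).comp
            (((splitFirst d : Ambient d ≃L[ℝ] ℝ × Coord d) : Ambient d →L[ℝ] ℝ × Coord d).comp
              (cellDeriv 𝓚 (Z τ₀) K u))) u := by
        have h1 : HasFDerivAt (fun w => Z τ₀ (𝓚.param K w)) (cellDeriv 𝓚 (Z τ₀) K u) u := by
          rw [cellDeriv, fderivWithin_of_mem_nhds (mem_interior_iff_mem_nhds.1 hui)]
          exact (hZ.hasFDerivAt_space hui).differentiableAt.hasFDerivAt
        exact hasFDerivAt_snd.comp u ((splitFirst d).hasFDerivAt.comp u h1)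
      rw [hder.fderiv] at hdet
      obtain ⟨w, hw⟩ := (ContinuousLinearMap.toContinuousLinearEquivOfDetNeZero _ hdet).surjective
        (splitFirst d n).2
      rw [ContinuousLinearMap.toContinuousLinearEquivOfDetNeZero_apply] at hw
      simp only [ContinuousLinearMap.comp_apply, ContinuousLinearEquiv.coe_coe,
        ContinuousLinearMap.coe_snd'] at hw
      have h2 : cellDeriv 𝓚 (Z τ₀) K u w - n =
          (splitFirst d (cellDeriv 𝓚 (Z τ₀) K u w - n)).1 • e₀ := by
        apply (splitFirst d).injective
        rw [map_smul, splitFirst_single_zero, map_sub]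
        ext1
        · simp
        · rw [Prod.snd_sub, hw]; simp
      have h3 : inner ℝ n (cellDeriv 𝓚 (Z τ₀) K u w - n) = (0 : ℝ) := by
        rw [h2, inner_smul_right, h0, mul_zero]
      rw [inner_sub_right, hperp, real_inner_self_eq_norm_sq, hn] at h3
      norm_num at h3
    obtain ⟨f, hf0, hf, W, hWo, hxW, hfc, hside⟩ :=
      hZ.exists_definingFunction hI hτ₀ hui hn hperp
    rw [hξ] at hf0 hf hxW
    have hline : ∀ᶠ z in 𝓝[≠] y, f (τ₀, ℓ z) ≠ 0 := by
      have h1 := eventually_ne_along_line hf (v := e₀) (by simpa using hne)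
      have h2 : Tendsto (fun z => z - y) (𝓝[≠] y) (𝓝[≠] 0) := by
        refine tendsto_nhdsWithin_iff.2 ⟨?_, ?_⟩
        · have : Tendsto (fun z => z - y) (𝓝 y) (𝓝 (y - y)) :=
            (continuous_id.sub continuous_const).tendsto y
          rw [sub_self] at this
          exact this.mono_left nhdsWithin_le_nhds
        · filter_upwards [self_mem_nhdsWithin] with z hz
          exact sub_ne_zero.2 hz
      filter_upwards [h2.eventually h1] with z hz
      rwa [← hℓadd, add_sub_cancel] at hz
    have hlineW : ∀ᶠ z in 𝓝[≠] y, (τ₀, ℓ z) ∈ W :=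
      ((by fun_prop : Continuous fun z : ℝ => (τ₀, ℓ z)).continuousAt.eventually
        (hWo.mem_nhds hxW)).filter_mono nhdsWithin_le_nhds
    have main : ∀ g : ℝ × Ambient d → ℝ, ContinuousOn g W → (∀ᶠ z in 𝓝[≠] y, g (τ₀, ℓ z) ≠ 0) →
        (∀ τ ∈ I, IsSublevel (Ω τ) W g τ ∨ IsSublevel (Ω τ) W (-g) τ) → IsSublevel (Ω τ₀) W g τ₀ →
        (∀ᶠ z in 𝓝[≠] y, P z) ∨ ∀ᶠ z in 𝓝[≠] y, ¬ P z := by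
      intro g hgc hgline hgside hg0
      -- Off the crossing the sign of `g` at `ℓ z` does not change for times near `τ₀`. Membership
      -- of `ℓ z` is therefore unchanged exactly when `Ω τ` keeps its side of `g`, a condition that
      -- does not involve `z`.
      have hiff : ∀ᶠ z in 𝓝[≠] y, (P z ↔ ∀ᶠ τ in 𝓝[I] τ₀, IsSublevel (Ω τ) W g τ) := by
        filter_upwards [hgline, hlineW] with z hz hzW
        have hmem : ∀ᶠ τ in 𝓝[I] τ₀, (τ, ℓ z) ∈ W :=
          ((by fun_prop : Continuous fun τ : ℝ => (τ, ℓ z)).continuousAt.eventually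
            (hWo.mem_nhds hzW)).filter_mono nhdsWithin_le_nhds
        have hcont : ContinuousAt (fun τ => g (τ, ℓ z)) τ₀ :=
          ContinuousAt.comp (f := fun τ => (τ, ℓ z)) (hgc.continuousAt (hWo.mem_nhds hzW))
            (by fun_prop)
        have hsign : ∀ᶠ τ in 𝓝[I] τ₀, g (τ, ℓ z) ≠ 0 ∧ (g (τ, ℓ z) < 0 ↔ g (τ₀, ℓ z) < 0) := by
          refine Filter.Eventually.filter_mono nhdsWithin_le_nhds ?_
          rcases lt_or_gt_of_ne hz with h | h
          · filter_upwards [hcont.eventually (gt_mem_nhds h)] with τ hτ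
            exact ⟨hτ.ne, by simp [hτ, h]⟩
          · filter_upwards [hcont.eventually (lt_mem_nhds h)] with τ hτ
            exact ⟨ne_of_gt hτ, fun h' => absurd h' (not_lt.2 (le_of_lt hτ)),
              fun h' => absurd h' (not_lt.2 (le_of_lt h))⟩
        refine eventually_congr ?_
        filter_upwards [hmem, hsign, self_mem_nhdsWithin] with τ h1 h2 h3
        rw [(hg0 _ hzW).1, ← h2.2]
        constructor
        · intro h4
          rcases hgside τ h3 with h5 | h5
          · exact h5
          · have h6 := (h5 _ h1).1
            rw [h6] at h4
            simp only [Pi.neg_apply, Left.neg_neg_iff] at h4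
            rcases lt_or_gt_of_ne h2.1 with h7 | h7
            · exact absurd (h4.2 h7) (not_lt.2 h7.le)
            · exact absurd (h4.1 h7) (not_lt.2 h7.le)
        · intro h4
          exact (h4 _ h1).1
      by_cases hE : ∀ᶠ τ in 𝓝[I] τ₀, IsSublevel (Ω τ) W g τ
      · left
        filter_upwards [hiff] with z hz
        exact hz.2 hE
      · right
        filter_upwards [hiff] with z hz
        exact fun h => hE (hz.1 h)
    rcases hside τ₀ hτ₀ with h | h
    · exact main f hfc hline hside h
    · refine main (-f) hfc.neg ?_ (fun τ hτ => ?_) h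
      · filter_upwards [hline] with z hz
        exact neg_ne_zero.2 hz
      · rw [neg_neg]
        exact (hside τ hτ).symm
  obtain ⟨ρ, hρ⟩ := hZ.eventually_line_not_mem hI (τ₀ := τ₀) x'
  have hfar : ∀ y > ρ, P y := by
    intro y hy
    have h0 := hρ.self_of_nhdsWithin hτ₀ y hy
    filter_upwards [hρ] with τ hτ
    exact ⟨fun h => absurd h (hτ y hy), fun h => absurd h h0⟩
  have hall := eventually_punctured_of_locally_constant (P := P) (fun y => by
    by_cases hy : ℓ y ∈ frontier (Ω τ₀)
    · exact hon y hy
    · have h1 := hoff y hy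
      by_cases hPy : P y
      · left
        filter_upwards [h1.filter_mono nhdsWithin_le_nhds] with z hz
        exact hz.2 hPy
      · right
        filter_upwards [h1.filter_mono nhdsWithin_le_nhds] with z hz
        exact fun h => hPy (hz.1 h)) (y₁ := ρ + 1) (by
      filter_upwards [mem_nhdsWithin_of_mem_nhds (Ioi_mem_nhds (lt_add_one ρ))] with z hz
      exact hfar z hz) (splitFirst d x).1
  have hnf : ℓ (splitFirst d x).1 ∉ frontier (Ω τ₀) := by
    obtain ⟨r', hr', hb'⟩ : ∃ r' > 0, Metric.ball (ℓ (splitFirst d x).1) r' ⊆ Metric.ball x r :=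
      Metric.isOpen_iff.1 Metric.isOpen_ball _ hx'b
    have h0 := hball.self_of_nhdsWithin hτ₀
    intro hcon
    rw [(hI τ₀ hτ₀).lipschitz.isOpen.frontier_eq] at hcon
    obtain ⟨z, hz, hzΩ⟩ := mem_closure_iff.1 hcon.1 _ Metric.isOpen_ball (Metric.mem_ball_self hr')
    exact hcon.2 ((h0 _ hx'b).2 ((h0 z (hb' hz)).1 hzΩ))
  have hPx : P (splitFirst d x).1 := by
    obtain ⟨z, hz1, hz2⟩ := (hall.and ((hoff _ hnf).filter_mono nhdsWithin_le_nhds)).exists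
    exact hz2.1 hz1
  have h0 := hball.self_of_nhdsWithin hτ₀ _ hx'b
  filter_upwards [hball, hPx] with τ h1 h2
  rw [← h0, ← h1 _ hx'b]
  exact h2

end SurfFEM

/-! ### Existence, uniqueness and continuity of the outward normal -/

namespace SurfFEM

variable {d : ℕ} {M : Type*} [TopologicalSpace M] {𝓚 : Mesh d M}

theorem eventually_sign_of_hasDerivAt_pos {g : ℝ → ℝ} {g' t₀ : ℝ} (hg : HasDerivAt g g' t₀)
    (h0 : g t₀ = 0) (hpos : 0 < g') :
    (∀ᶠ t in 𝓝[>] t₀, 0 < g t) ∧ ∀ᶠ t in 𝓝[<] t₀, g t < 0 := by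
  have h1 := (hasDerivAt_iff_tendsto_slope.1 hg).eventually (lt_mem_nhds hpos)
  constructor
  · filter_upwards [h1.filter_mono (nhdsWithin_mono _ fun t ht => ne_of_gt ht), self_mem_nhdsWithin]
      with t ht ht0
    rw [slope_def_field, h0, sub_zero] at ht
    exact (div_pos_iff_of_pos_right (sub_pos.2 ht0)).1 ht
  · filter_upwards [h1.filter_mono (nhdsWithin_mono _ fun t ht => ne_of_lt ht), self_mem_nhdsWithin]
      with t ht ht0
    rw [slope_def_field, h0, sub_zero] at ht
    by_contra hcon
    exact absurd ht (not_lt.2 (div_nonpos_of_nonneg_of_nonpos (not_lt.1 hcon)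
      (sub_nonpos.2 (le_of_lt ht0))))

/-- Two unit normals of a hyperplane that form no obtuse angle are equal. -/
theorem unit_normal_unique {A : Coord d →L[ℝ] Ambient d} (hA : ∀ w, A w = 0 → w = 0)
    {n m : Ambient d} (hn : ‖n‖ = 1) (hm : ‖m‖ = 1) (hnA : ∀ w, inner ℝ n (A w) = 0)
    (hmA : ∀ w, inner ℝ m (A w) = 0) (hnm : 0 ≤ inner ℝ n m) : m = n := by
  have hinj : Function.Injective A.toLinearMap := by
    rw [← LinearMap.ker_eq_bot, LinearMap.ker_eq_bot']
    exact hA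
  set T := LinearMap.range A.toLinearMap with hT
  have hmem : ∀ v, (∀ w, inner ℝ v (A w) = 0) → v ∈ Tᗮ := by
    rintro v hv _ ⟨w, rfl⟩
    rw [real_inner_comm]; exact hv w
  have hdim : Module.finrank ℝ Tᗮ = 1 := by
    have h1 := T.finrank_add_finrank_orthogonal
    rw [hT, LinearMap.finrank_range_of_inj hinj] at h1
    simp only [finrank_euclideanSpace, Fintype.card_fin] at h1
    rw [hT]; omega
  have hn0 : (⟨n, hmem n hnA⟩ : Tᗮ) ≠ 0 := fun h => by
    have : n = 0 := congrArg Subtype.val h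
    rw [this, norm_zero] at hn
    exact zero_ne_one hn
  obtain ⟨c, hc⟩ := (finrank_eq_one_iff_of_nonzero' _ hn0).1 hdim ⟨m, hmem m hmA⟩
  have hc' : c • n = m := congrArg Subtype.val hc
  rw [← hc', inner_smul_right, real_inner_self_eq_norm_sq, hn, one_pow, mul_one] at hnm
  rw [← hc', norm_smul, hn, mul_one, Real.norm_eq_abs, abs_of_nonneg hnm] at hm
  rw [← hc', hm, one_smul]

section

variable [T2Space M] [CompactSpace M] {Z : ℝ → M → Ambient d} (hZ : IsSmoothMotion 𝓚 Z)
  {Ω : ℝ → Set (Ambient d)} {I : Set ℝ} (hI : ∀ τ ∈ I, Encloses 𝓚 (Z τ) (Ω τ))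
include hZ hI

/-- The sign of `n` is chosen so that the region is `f < 0` at `τ₀`. A point slightly displaced
along `n` is then exterior at `τ₀`, and by `IsSmoothMotion.eventually_mem_iff` it stays out of the
region at nearby times, which prevents a change of side. -/
theorem IsSmoothMotion.exists_outward_definingFunction {τ₀ : ℝ} (hτ₀ : τ₀ ∈ I) {K : 𝓚.Cell}
    {u₀ : Coord d} (hu₀ : u₀ ∈ interior (𝓚.dom K)) :
    ∃ n : Ambient d, ‖n‖ = 1 ∧ (∀ w, inner ℝ n (cellDeriv 𝓚 (Z τ₀) K u₀ w) = 0) ∧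
    ∃ f : ℝ × Ambient d → ℝ, f (τ₀, Z τ₀ (𝓚.param K u₀)) = 0 ∧
      HasStrictFDerivAt f
        ((innerSL ℝ n).comp (ContinuousLinearMap.snd ℝ ℝ (Ambient d)) -
          inner ℝ n (velocity Z τ₀ (𝓚.param K u₀)) • ContinuousLinearMap.fst ℝ ℝ (Ambient d))
        (τ₀, Z τ₀ (𝓚.param K u₀)) ∧
      ∃ W, IsOpen W ∧ (τ₀, Z τ₀ (𝓚.param K u₀)) ∈ W ∧ ContinuousOn f W ∧
        ∀ᶠ τ in 𝓝[I] τ₀, IsSublevel (Ω τ) W f τ := by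
  obtain ⟨n, hn, hperp⟩ := exists_unit_normal (cellDeriv 𝓚 (Z τ₀) K u₀)
  obtain ⟨f, hf0, hf, W, hWo, hxW, hfc, hside⟩ := hZ.exists_definingFunction hI hτ₀ hu₀ hn hperp
  set x₀ := Z τ₀ (𝓚.param K u₀) with hx₀
  have main : ∀ (n : Ambient d) (f : ℝ × Ambient d → ℝ), ‖n‖ = 1 → f (τ₀, x₀) = 0 →
      HasStrictFDerivAt f ((innerSL ℝ n).comp (ContinuousLinearMap.snd ℝ ℝ (Ambient d)) -
          inner ℝ n (velocity Z τ₀ (𝓚.param K u₀)) • ContinuousLinearMap.fst ℝ ℝ (Ambient d))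
        (τ₀, x₀) → ContinuousOn f W →
      (∀ τ ∈ I, IsSublevel (Ω τ) W f τ ∨ IsSublevel (Ω τ) W (-f) τ) → IsSublevel (Ω τ₀) W f τ₀ →
      ∀ᶠ τ in 𝓝[I] τ₀, IsSublevel (Ω τ) W f τ := by
    intro n f hn hf0 hf hfc hside h0
    have h1 := (eventually_sign_of_hasDerivAt_pos (hasDerivAt_along_line n hf) (by simpa using hf0)
      (by simp [hn])).1
    have h2 : ∀ᶠ s : ℝ in 𝓝[>] 0, (τ₀, x₀ + s • n) ∈ W := by
      have hc : Continuous fun s : ℝ => (τ₀, x₀ + s • n) := by fun_prop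
      refine (hc.continuousAt.eventually (hWo.mem_nhds ?_)).filter_mono nhdsWithin_le_nhds
      simpa using hxW
    obtain ⟨s, hs, hsW⟩ := (h1.and h2).exists
    set y := x₀ + s • n with hy
    have hyc : y ∉ closure (Ω τ₀) := fun h => absurd ((h0 y hsW).2.1 h) (not_le.2 hs)
    have hyf : y ∉ frontier (Ω τ₀) := fun h => hyc (frontier_subset_closure h)
    have hmem : ∀ᶠ τ in 𝓝[I] τ₀, (τ, y) ∈ W :=
      ((by fun_prop : Continuous fun τ : ℝ => (τ, y)).continuousAt.eventually
        (hWo.mem_nhds hsW)).filter_mono nhdsWithin_le_nhds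
    have hpos : ∀ᶠ τ in 𝓝[I] τ₀, 0 < f (τ, y) := by
      have hcont : ContinuousAt (fun τ => f (τ, y)) τ₀ :=
        ContinuousAt.comp (f := fun τ => (τ, y)) (hfc.continuousAt (hWo.mem_nhds hsW))
          (by fun_prop)
      exact (hcont.eventually (lt_mem_nhds hs)).filter_mono nhdsWithin_le_nhds
    filter_upwards [hZ.eventually_mem_iff hI hτ₀ hyf, hmem, hpos, self_mem_nhdsWithin]
      with τ h3 h4 h5 h6
    rcases hside τ h6 with h7 | h7
    · exact h7
    · exact absurd (h3.1 ((h7 y h4).1.2 (by simpa using h5))) fun h => hyc (subset_closure h)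
  rcases hside τ₀ hτ₀ with h | h
  · exact ⟨n, hn, hperp, f, hf0, hf, W, hWo, hxW, hfc, main n f hn hf0 hf hfc hside h⟩
  · have hf' : HasStrictFDerivAt (-f)
        ((innerSL ℝ (-n)).comp (ContinuousLinearMap.snd ℝ ℝ (Ambient d)) -
          inner ℝ (-n) (velocity Z τ₀ (𝓚.param K u₀)) • ContinuousLinearMap.fst ℝ ℝ (Ambient d))
        (τ₀, x₀) := by
      refine hf.neg.congr_fderiv (ContinuousLinearMap.ext fun z => ?_)
      simp
      ring
    have hn' : ‖-n‖ = 1 := by rw [norm_neg, hn]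
    refine ⟨-n, hn', fun w => by rw [inner_neg_left, hperp, neg_zero], -f, by simp [hf0], hf', W,
      hWo, hxW, hfc.neg, main (-n) (-f) hn' (by simp [hf0]) hf' hfc.neg (fun τ hτ => ?_) h⟩
    rw [neg_neg]
    exact (hside τ hτ).symm

/-- The vector `n` of the outward defining function meets the definition, so at interior points of
cells the choice in `outwardUnitNormal` never takes its default value `0`. -/
theorem IsSmoothMotion.isOutwardUnitNormal_normalField {τ : ℝ} (hτ : τ ∈ I) {K : 𝓚.Cell}
    {u : Coord d} (hu : u ∈ interior (𝓚.dom K)) :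
    IsOutwardUnitNormal (Ω τ) (LinearMap.range (cellDeriv 𝓚 (Z τ) K u).toLinearMap)
      (Z τ (𝓚.param K u)) (normalField 𝓚 (Ω τ) (Z τ) K u) := by
  obtain ⟨n, hn, hperp, f, hf0, hf, W, hWo, hxW, hfc, hside⟩ :=
    hZ.exists_outward_definingFunction hI hτ hu
  set x := Z τ (𝓚.param K u) with hx
  have h0 := hside.self_of_nhdsWithin hτ
  have hex : ∃ n, IsOutwardUnitNormal (Ω τ)
      (LinearMap.range (cellDeriv 𝓚 (Z τ) K u).toLinearMap) x n := by
    refine ⟨n, hn, ?_, ?_⟩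
    · rintro _ ⟨w, rfl⟩
      rw [real_inner_comm]; exact hperp w
    · have hs := eventually_sign_of_hasDerivAt_pos (hasDerivAt_along_line n hf)
        (by simpa using hf0) (by simp [hn])
      have hW : ∀ᶠ s : ℝ in 𝓝 0, (τ, x + s • n) ∈ W := by
        have hc : Continuous fun s : ℝ => (τ, x + s • n) := by fun_prop
        exact hc.continuousAt.eventually (hWo.mem_nhds (by simpa using hxW))
      have h1 : ∀ᶠ s : ℝ in 𝓝[>] 0, x + s • n ∉ closure (Ω τ) := by
        filter_upwards [hs.1, hW.filter_mono nhdsWithin_le_nhds] with s h2 h3 h4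
        exact absurd ((h0 _ h3).2.1 h4) (not_le.2 h2)
      have h2 : ∀ᶠ s : ℝ in 𝓝[<] 0, x + s • n ∈ Ω τ := by
        filter_upwards [hs.2, hW.filter_mono nhdsWithin_le_nhds] with s h2 h3
        exact (h0 _ h3).1.2 h2
      have h3 : ∀ᶠ s : ℝ in 𝓝[>] 0, x - s • n ∈ Ω τ := by
        have hneg : Tendsto (fun s : ℝ => -s) (𝓝[>] 0) (𝓝[<] 0) := by
          simpa using tendsto_neg_nhdsGT (a := (0 : ℝ))
        filter_upwards [hneg.eventually h2] with s hs
        rwa [neg_smul, ← sub_eq_add_neg] at hs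
      obtain ⟨ε, hε, hεs⟩ := (mem_nhdsGT_iff_exists_Ioo_subset).1 (h3.and h1)
      exact ⟨ε, hε, fun δ hδ => hεs hδ⟩
  rw [normalField, outwardUnitNormal, dif_pos hex]
  exact hex.choose_spec

theorem IsSmoothMotion.norm_normalField {τ : ℝ} (hτ : τ ∈ I) {K : 𝓚.Cell}
    {u : Coord d} (hu : u ∈ interior (𝓚.dom K)) : ‖normalField 𝓚 (Ω τ) (Z τ) K u‖ = 1 :=
  (hZ.isOutwardUnitNormal_normalField hI hτ hu).1

theorem IsSmoothMotion.inner_normalField_cellDeriv {τ : ℝ} (hτ : τ ∈ I) {K : 𝓚.Cell}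
    {u : Coord d} (hu : u ∈ interior (𝓚.dom K)) (w : Coord d) :
    inner ℝ (normalField 𝓚 (Ω τ) (Z τ) K u) (cellDeriv 𝓚 (Z τ) K u w) = 0 := by
  rw [real_inner_comm]
  exact (hZ.isOutwardUnitNormal_normalField hI hτ hu).2.1 _ ⟨w, rfl⟩

/-- The outward normals at nearby points and times form no obtuse angle in the limit. -/
theorem IsSmoothMotion.eventually_inner_normalField {τ₀ : ℝ} {K : 𝓚.Cell}
    {u₀ : Coord d} (hu₀ : u₀ ∈ interior (𝓚.dom K)) {n : Ambient d} {f : ℝ × Ambient d → ℝ} {c : ℝ}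
    (hf : HasStrictFDerivAt f
        ((innerSL ℝ n).comp (ContinuousLinearMap.snd ℝ ℝ (Ambient d)) -
          c • ContinuousLinearMap.fst ℝ ℝ (Ambient d)) (τ₀, Z τ₀ (𝓚.param K u₀)))
    {W : Set (ℝ × Ambient d)} (hWo : IsOpen W) (hxW : (τ₀, Z τ₀ (𝓚.param K u₀)) ∈ W)
    (hside : ∀ᶠ τ in 𝓝[I] τ₀, IsSublevel (Ω τ) W f τ) {ε : ℝ} (hε : 0 < ε) :
    ∀ᶠ z in 𝓝[I ×ˢ interior (𝓚.dom K)] (τ₀, u₀),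
      -ε ≤ inner ℝ n (normalField 𝓚 (Ω z.1) (Z z.1) K z.2) := by
  -- Strict differentiability is uniform in the base point: `f` vanishes at the nearby surface point
  -- and is positive at the point displaced by `s • m`, whence `0 < s * (⟨n, m⟩ + ε)`.
  have h1 := hf.isLittleO.def hε
  rw [nhds_prod_eq] at h1
  obtain ⟨O, hO, hOO⟩ := eventually_prod_self_iff'.1 h1
  obtain ⟨O', hO'O, hO'o, hO'x⟩ := mem_nhds_iff.1 (inter_mem hO (hWo.mem_nhds hxW))
  have hcell : ContinuousAt (fun z : ℝ × Coord d => (z.1, cellMap 𝓚 Z K z)) (τ₀, u₀) :=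
    continuousAt_fst.prodMk (hZ.hasStrictFDerivAt (z := (τ₀, u₀)) hu₀).continuousAt
  have h2 : ∀ᶠ z in 𝓝[I ×ˢ interior (𝓚.dom K)] (τ₀, u₀), (z.1, cellMap 𝓚 Z K z) ∈ O' :=
    (hcell.eventually (hO'o.mem_nhds hO'x)).filter_mono nhdsWithin_le_nhds
  have h3 : ∀ᶠ z : ℝ × Coord d in 𝓝[I ×ˢ interior (𝓚.dom K)] (τ₀, u₀),
      IsSublevel (Ω z.1) W f z.1 := by
    rw [nhdsWithin_prod_eq]
    exact hside.prod_inl _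
  filter_upwards [h2, h3, self_mem_nhdsWithin] with z hz hzs hzI
  set m := normalField 𝓚 (Ω z.1) (Z z.1) K z.2 with hm
  obtain ⟨hm1, -, ε', hε', hout⟩ := hZ.isOutwardUnitNormal_normalField hI hzI.1 hzI.2
  rw [← hm] at hm1 hout
  have h4 : ∀ᶠ s : ℝ in 𝓝[>] 0, (z.1, cellMap 𝓚 Z K z + s • m) ∈ O' := by
    have hc : Continuous fun s : ℝ => (z.1, cellMap 𝓚 Z K z + s • m) := by fun_prop
    exact (hc.continuousAt.eventually (hO'o.mem_nhds (by simpa using hz))).filter_mono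
      nhdsWithin_le_nhds
  obtain ⟨s, hs, hsε⟩ := (h4.and (Ioo_mem_nhdsGT hε')).exists
  have hs0 : 0 < s := hsε.1
  have hx : cellMap 𝓚 Z K z ∈ frontier (Ω z.1) := by
    rw [← (hI z.1 hzI.1).range_eq]; exact ⟨_, rfl⟩
  have hfx : f (z.1, cellMap 𝓚 Z K z) ≤ 0 :=
    (hzs _ (hO'O hz).2).2.1 (frontier_subset_closure hx)
  have hfx' : 0 ≤ f (z.1, cellMap 𝓚 Z K z) := by
    by_contra hcon
    have := (hzs _ (hO'O hz).2).1.2 (not_le.1 hcon)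
    rw [(hI z.1 hzI.1).lipschitz.isOpen.frontier_eq] at hx
    exact hx.2 this
  have hfy : 0 < f (z.1, cellMap 𝓚 Z K z + s • m) := by
    by_contra hcon
    exact (hout s hsε).2 ((hzs _ (hO'O hs).2).2.2 (not_lt.1 hcon))
  have h5 := hOO _ (hO'O hs).1 _ (hO'O hz).1
  simp only [Prod.mk_sub_mk, sub_self, add_sub_cancel_left] at h5
  have h6 := (abs_le.1 ((Real.norm_eq_abs _).symm.le.trans h5)).2
  simp only [sub_apply, ContinuousLinearMap.comp_apply, ContinuousLinearMap.coe_snd',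
    smul_apply, ContinuousLinearMap.coe_fst', smul_zero, sub_zero, innerSL_apply_apply,
    inner_smul_right, Prod.norm_mk, norm_zero, norm_smul, hm1, mul_one, Real.norm_eq_abs,
    abs_of_pos hs0, max_eq_right hs0.le] at h6
  have h7 : 0 < s * (inner ℝ n m + ε) := by linarith
  have := (pos_iff_pos_of_mul_pos h7).1 hs0
  linarith

/-- Near a point of the interior of a cell the enclosed region is the sublevel set of a function whose
differential is given by the outward normal and by the normal velocity. -/
theorem IsSmoothMotion.exists_definingFunction_normalField {τ₀ : ℝ} (hτ₀ : τ₀ ∈ I) {K : 𝓚.Cell}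
    {u₀ : Coord d} (hu₀ : u₀ ∈ interior (𝓚.dom K)) :
    ∃ f : ℝ × Ambient d → ℝ, f (τ₀, Z τ₀ (𝓚.param K u₀)) = 0 ∧
      HasStrictFDerivAt f
        ((innerSL ℝ (normalField 𝓚 (Ω τ₀) (Z τ₀) K u₀)).comp
            (ContinuousLinearMap.snd ℝ ℝ (Ambient d)) -
          inner ℝ (normalField 𝓚 (Ω τ₀) (Z τ₀) K u₀) (velocity Z τ₀ (𝓚.param K u₀)) •
            ContinuousLinearMap.fst ℝ ℝ (Ambient d)) (τ₀, Z τ₀ (𝓚.param K u₀)) ∧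
      ∃ W, IsOpen W ∧ (τ₀, Z τ₀ (𝓚.param K u₀)) ∈ W ∧
        ∀ᶠ τ in 𝓝[I] τ₀, IsSublevel (Ω τ) W f τ := by
  obtain ⟨n, hn, hperp, f, hf0, hf, W, hWo, hxW, hfc, hside⟩ :=
    hZ.exists_outward_definingFunction hI hτ₀ hu₀
  -- Both vectors are unit normals of the same hyperplane; letting `ε` tend to `0` rules out that
  -- they are opposite.
  have h1 : 0 ≤ inner ℝ n (normalField 𝓚 (Ω τ₀) (Z τ₀) K u₀) := by
    refine le_of_forall_pos_le_add fun ε hε => ?_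
    have := (hZ.eventually_inner_normalField hI hu₀ hf hWo hxW hside hε).self_of_nhdsWithin
      ⟨hτ₀, hu₀⟩
    simp only at this
    linarith
  have h2 := unit_normal_unique
    (fun w hw => cellDeriv_injective ((hI τ₀ hτ₀).jacobian_pos K u₀ (interior_subset hu₀)) w hw)
    hn (hZ.norm_normalField hI hτ₀ hu₀) hperp (hZ.inner_normalField_cellDeriv hI hτ₀ hu₀) h1
  rw [h2]
  exact ⟨f, hf0, hf, W, hWo, hxW, hside⟩

/-- The outward normal is continuous in space and time on the interior of the cells. -/
theorem IsSmoothMotion.continuousOn_normalField (K : 𝓚.Cell) :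
    ContinuousOn (fun z : ℝ × Coord d => normalField 𝓚 (Ω z.1) (Z z.1) K z.2)
      (I ×ˢ interior (𝓚.dom K)) := by
  rintro ⟨τ₀, u₀⟩ ⟨hτ₀, hu₀⟩
  obtain ⟨f, hf0, hf, W, hWo, hxW, hside⟩ := hZ.exists_definingFunction_normalField hI hτ₀ hu₀
  -- By compactness of the sphere it suffices to identify cluster points. Such a point is a unit
  -- normal of the limiting tangent space and forms no obtuse angle with the normal there, so it is
  -- that normal.
  refine (isCompact_sphere (0 : Ambient d) 1).tendsto_nhds_of_unique_mapClusterPt ?_ ?_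
  · filter_upwards [self_mem_nhdsWithin] with z hz
    rw [mem_sphere_zero_iff_norm]
    exact hZ.norm_normalField hI hz.1 hz.2
  · intro m hm hcl
    obtain ⟨U, hU, hUm⟩ := mapClusterPt_iff_ultrafilter.1 hcl
    have hmem : ∀ᶠ z in (U : Filter (ℝ × Coord d)), z ∈ I ×ˢ interior (𝓚.dom K) :=
      hU self_mem_nhdsWithin
    refine unit_normal_unique
      (fun w hw => cellDeriv_injective ((hI τ₀ hτ₀).jacobian_pos K u₀ (interior_subset hu₀)) w hw)
      (hZ.norm_normalField hI hτ₀ hu₀) (mem_sphere_zero_iff_norm.1 hm)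
      (hZ.inner_normalField_cellDeriv hI hτ₀ hu₀) (fun w => ?_) ?_
    · have hder : ContinuousAt (fun z => fderiv ℝ (cellMap 𝓚 Z K) z (0, w)) (τ₀, u₀) := by
        have h1 := (hZ.contDiffAt (z := (τ₀, u₀)) hu₀).continuousAt_fderiv one_ne_zero
        exact h1.clm_apply continuousAt_const
      have h2 : Tendsto (fun z => inner ℝ (normalField 𝓚 (Ω z.1) (Z z.1) K z.2)
          (fderiv ℝ (cellMap 𝓚 Z K) z (0, w))) U
          (𝓝 (inner ℝ m (fderiv ℝ (cellMap 𝓚 Z K) (τ₀, u₀) (0, w)))) :=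
        hUm.inner (hder.tendsto.mono_left (hU.trans nhdsWithin_le_nhds))
      have h3 : Tendsto (fun z => inner ℝ (normalField 𝓚 (Ω z.1) (Z z.1) K z.2)
          (fderiv ℝ (cellMap 𝓚 Z K) z (0, w))) U (𝓝 0) := by
        refine tendsto_const_nhds.congr' ?_
        filter_upwards [hmem] with z hz
        rw [← hZ.cellDeriv_eq (τ := z.1) hz.2, hZ.inner_normalField_cellDeriv hI hz.1 hz.2]
      rw [hZ.cellDeriv_eq hu₀]
      exact tendsto_nhds_unique h2 h3
    · refine le_of_forall_pos_le_add fun ε hε => ?_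
      have h1 := hU (hZ.eventually_inner_normalField hI hu₀ hf hWo hxW hside hε)
      have h2 : -ε ≤ inner ℝ (normalField 𝓚 (Ω τ₀) (Z τ₀) K u₀) m :=
        ge_of_tendsto (tendsto_const_nhds.inner hUm) h1
      linarith

end

end SurfFEM

/-! ### The transport theorem for the enclosed volume -/

namespace SurfFEM

variable {d : ℕ} {M : Type*} [TopologicalSpace M] {𝓚 : Mesh d M}

theorem Mesh.interior_ae_eq (𝓚 : Mesh d M) (K : 𝓚.Cell) :
    (interior (𝓚.dom K) : Set (Coord d)) =ᵐ[volume] 𝓚.dom K := by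
  refine ae_eq_set.2 ⟨by simp [sdiff_eq_empty.2 (interior_subset (s := 𝓚.dom K))], ?_⟩
  refine measure_mono_null (t := frontier (𝓚.dom K)) (fun u hu => ⟨subset_closure hu.1, hu.2⟩)
    ((𝓚.convex_dom K).addHaar_frontier volume)

/-- Bounded continuous functions on an open space-time cell are integrable. -/
theorem Mesh.integrableOn_of_bounded (𝓚 : Mesh d M) (K : 𝓚.Cell) {a b C : ℝ} {H : ℝ × Coord d → ℝ}
    (hH : ContinuousOn H (Ioo a b ×ˢ interior (𝓚.dom K)))
    (hC : ∀ z ∈ Ioo a b ×ˢ interior (𝓚.dom K), |H z| ≤ C) :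
    IntegrableOn H (Ioo a b ×ˢ interior (𝓚.dom K)) := by
  have hm : MeasurableSet (Ioo a b ×ˢ interior (𝓚.dom K)) :=
    measurableSet_Ioo.prod isOpen_interior.measurableSet
  refine IntegrableOn.of_bound ?_ (hH.aestronglyMeasurable hm) C ?_
  · refine (((isCompact_Icc (a := a) (b := b)).prod
      (𝓚.isCompact_dom K)).measure_lt_top).trans_le' (measure_mono ?_)
    exact prod_mono Ioo_subset_Icc_self interior_subset
  · exact (ae_restrict_iff' hm).2 (Eventually.of_forall fun z hz => hC z hz)

/-- Closed cells differ from their interiors by null sets, so Fubini can be used on open cells,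
where the normal is under control. -/
theorem Mesh.restrict_prod (𝓚 : Mesh d M) (K : 𝓚.Cell) (a b : ℝ) :
    ((volume : Measure ℝ).restrict (Ioo a b)).prod ((volume : Measure (Coord d)).restrict (𝓚.dom K)) =
      (volume : Measure (ℝ × Coord d)).restrict (Ioo a b ×ˢ interior (𝓚.dom K)) := by
  rw [← Measure.restrict_congr_set (𝓚.interior_ae_eq K), Measure.prod_restrict]
  rfl

theorem Mesh.integrableOn_integral (𝓚 : Mesh d M) (K : 𝓚.Cell) {a b : ℝ} {H : ℝ × Coord d → ℝ}
    (hH : IntegrableOn H (Ioo a b ×ˢ interior (𝓚.dom K))) :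
    IntegrableOn (fun τ => ∫ u in 𝓚.dom K, H (τ, u)) (Ioo a b) := by
  rw [IntegrableOn, ← 𝓚.restrict_prod K a b] at hH
  exact hH.integral_prod_left

theorem Mesh.integral_integral (𝓚 : Mesh d M) (K : 𝓚.Cell) {a b : ℝ} {H : ℝ × Coord d → ℝ}
    (hH : IntegrableOn H (Ioo a b ×ˢ interior (𝓚.dom K))) :
    ∫ τ in Ioo a b, ∫ u in 𝓚.dom K, H (τ, u) =
      ∫ z in Ioo a b ×ˢ interior (𝓚.dom K), H z := by
  rw [IntegrableOn, ← 𝓚.restrict_prod K a b] at hH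
  rw [← 𝓚.restrict_prod K a b, integral_prod _ hH]

/-- The outward normal velocity of the moving surface. -/
noncomputable def normalVelocity (𝓚 : Mesh d M) (Ω : ℝ → Set (Ambient d)) (Z : ℝ → M → Ambient d)
    (K : 𝓚.Cell) (z : ℝ × Coord d) : ℝ :=
  inner ℝ (velocity Z z.1 (𝓚.param K z.2)) (normalField 𝓚 (Ω z.1) (Z z.1) K z.2)

/-- The density of the flux of the enclosed volume through the moving surface. -/
noncomputable def fluxDensity (𝓚 : Mesh d M) (Ω : ℝ → Set (Ambient d)) (Z : ℝ → M → Ambient d)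
    (K : 𝓚.Cell) (z : ℝ × Coord d) : ℝ :=
  normalVelocity 𝓚 Ω Z K z * jacobian 𝓚 (Z z.1) K z.2

/-- The differential of the space-time position, as an endomorphism. -/
noncomputable def cellMapDeriv (𝓚 : Mesh d M) (Z : ℝ → M → Ambient d) (K : 𝓚.Cell) (y : Ambient d) :
    Ambient d →L[ℝ] Ambient d :=
  (fderiv ℝ (cellMap 𝓚 Z K) (splitFirst d y)).comp
    ((splitFirst d : Ambient d ≃L[ℝ] ℝ × Coord d) : Ambient d →L[ℝ] ℝ × Coord d)

section

variable {Z : ℝ → M → Ambient d} (hZ : IsSmoothMotion 𝓚 Z)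
include hZ

theorem IsSmoothMotion.hasStrictFDerivAt_comp {K : 𝓚.Cell} {y : Ambient d}
    (hy : (splitFirst d y).2 ∈ interior (𝓚.dom K)) :
    HasStrictFDerivAt (fun y => cellMap 𝓚 Z K (splitFirst d y)) (cellMapDeriv 𝓚 Z K y) y :=
  (hZ.hasStrictFDerivAt hy).comp y (splitFirst d).hasStrictFDerivAt

theorem IsSmoothMotion.continuousOn_fderiv (K : 𝓚.Cell) :
    ContinuousOn (fderiv ℝ (cellMap 𝓚 Z K)) (univ ×ˢ interior (𝓚.dom K)) := fun _ hz =>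
  ((hZ.contDiffAt hz.2).continuousAt_fderiv one_ne_zero).continuousWithinAt

theorem IsSmoothMotion.continuousOn_cellMapDeriv (K : 𝓚.Cell) :
    ContinuousOn (cellMapDeriv 𝓚 Z K) {y | (splitFirst d y).2 ∈ interior (𝓚.dom K)} := by
  have h1 : ContinuousOn (fun y => fderiv ℝ (cellMap 𝓚 Z K) (splitFirst d y))
      {y | (splitFirst d y).2 ∈ interior (𝓚.dom K)} :=
    (hZ.continuousOn_fderiv K).comp (splitFirst d).continuous.continuousOn
      fun y hy => ⟨mem_univ _, hy⟩
  exact h1.clm_comp continuousOn_const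

/-- The Jacobian is continuous on the interior of the cells. -/
theorem IsSmoothMotion.continuousOn_jacobian (K : 𝓚.Cell) :
    ContinuousOn (fun z : ℝ × Coord d => jacobian 𝓚 (Z z.1) K z.2) (univ ×ˢ interior (𝓚.dom K)) := by
  refine (ContinuousOn.congr (f := fun z : ℝ × Coord d => √(Matrix.of fun i j : Fin d =>
    inner ℝ (fderiv ℝ (cellMap 𝓚 Z K) z (0, EuclideanSpace.single i 1))
      (fderiv ℝ (cellMap 𝓚 Z K) z (0, EuclideanSpace.single j 1))).det) ?_ ?_)
  · have hd := hZ.continuousOn_fderiv K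
    rw [continuousOn_iff_continuous_domRestrict] at hd ⊢
    refine Real.continuous_sqrt.comp (Continuous.matrix_det ?_)
    refine continuous_matrix fun i j => ?_
    exact (hd.clm_apply continuous_const).inner (hd.clm_apply continuous_const)
  · intro z hz
    simp only [jacobian, metricTensor, tangentVec, hZ.cellDeriv_eq hz.2]

/-- The derivative within the closed cell is continuous up to the boundary, hence bounded by
compactness. This dominates the flux density, whose normal is controlled only on the open cell. -/
theorem IsSmoothMotion.exists_bound_det (K : 𝓚.Cell) (a b : ℝ) :
    ∃ C, ∀ y, splitFirst d y ∈ Icc a b ×ˢ interior (𝓚.dom K) → |(cellMapDeriv 𝓚 Z K y).det| ≤ C := by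
  have hu : UniqueDiffOn ℝ ((univ : Set ℝ) ×ˢ 𝓚.dom K) :=
    uniqueDiffOn_univ.prod (uniqueDiffOn_convex (𝓚.convex_dom K) (𝓚.interior_dom_nonempty K))
  have h1 : ContinuousOn (fderivWithin ℝ (cellMap 𝓚 Z K) (univ ×ˢ 𝓚.dom K)) (Icc a b ×ˢ 𝓚.dom K) :=
    ((hZ.contDiffOn K).continuousOn_fderivWithin hu le_rfl).mono
      (prod_mono (subset_univ _) subset_rfl)
  have h2 : ContinuousOn (fun z : ℝ × Coord d =>
      ((fderivWithin ℝ (cellMap 𝓚 Z K) (univ ×ˢ 𝓚.dom K) z).comp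
        ((splitFirst d : Ambient d ≃L[ℝ] ℝ × Coord d) : Ambient d →L[ℝ] ℝ × Coord d)).det)
      (Icc a b ×ˢ 𝓚.dom K) :=
    ContinuousLinearMap.continuous_det.comp_continuousOn (h1.clm_comp continuousOn_const)
  obtain ⟨C, hC⟩ := (isCompact_Icc.prod (𝓚.isCompact_dom K)).exists_bound_of_continuousOn h2
  refine ⟨C, fun y hy => ?_⟩
  have h3 := hC _ ⟨hy.1, interior_subset hy.2⟩
  rw [fderivWithin_of_mem_nhds (prod_mem_nhds univ_mem (mem_interior_iff_mem_nhds.1 hy.2))] at h3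
  exact h3

end

section

variable [T2Space M] [CompactSpace M] {Z : ℝ → M → Ambient d} (hZ : IsSmoothMotion 𝓚 Z)
  {Ω : ℝ → Set (Ambient d)} {I : Set ℝ} (hI : ∀ τ ∈ I, Encloses 𝓚 (Z τ) (Ω τ))
include hZ hI

/-- The space-time volume element is the product of the normal velocity and of the surface
element. -/
theorem IsSmoothMotion.abs_det_cellMapDeriv {K : 𝓚.Cell} {y : Ambient d}
    (hy : splitFirst d y ∈ I ×ˢ interior (𝓚.dom K)) :
    |(cellMapDeriv 𝓚 Z K y).det| =
      |normalVelocity 𝓚 Ω Z K (splitFirst d y)| *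
        jacobian 𝓚 (Z (splitFirst d y).1) K (splitFirst d y).2 := by
  set z := splitFirst d y with hz
  have hJ := (hI z.1 hy.1).jacobian_pos K z.2 (interior_subset hy.2)
  have hG : 0 < (metricTensor 𝓚 (Z z.1) K z.2).det := Real.sqrt_pos.1 hJ
  have h1 := sq_det_eq_sq_inner_mul_gram (velocity Z z.1 (𝓚.param K z.2))
    (normalField 𝓚 (Ω z.1) (Z z.1) K z.2) (tangentVec 𝓚 (Z z.1) K z.2)
    (hZ.norm_normalField hI hy.1 hy.2) (fun i => hZ.inner_normalField_cellDeriv hI hy.1 hy.2 _)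
    hG.ne'
  -- The first coordinate plays the role of time, so the columns in the standard basis are the
  -- velocity followed by the tangent vectors.
  have h2 : (cellMapDeriv 𝓚 Z K y).det = (Matrix.of fun i j =>
      (Fin.cons (velocity Z z.1 (𝓚.param K z.2)) (tangentVec 𝓚 (Z z.1) K z.2) :
        Fin (d + 1) → Ambient d) j i : Matrix (Fin (d + 1)) (Fin (d + 1)) ℝ).det := by
    rw [ContinuousLinearMap.det,
      ← LinearMap.det_toMatrix (EuclideanSpace.basisFun (Fin (d + 1)) ℝ).toBasis]
    congr 1
    ext i j
    rw [LinearMap.toMatrix_apply]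
    simp only [OrthonormalBasis.coe_toBasis, EuclideanSpace.basisFun_apply,
      OrthonormalBasis.coe_toBasis_repr_apply, EuclideanSpace.basisFun_repr, Matrix.of_apply,
      ContinuousLinearMap.coe_coe, cellMapDeriv, ContinuousLinearMap.comp_apply,
      ContinuousLinearEquiv.coe_coe, ← hz]
    refine Fin.cases ?_ (fun j => ?_) j
    · rw [splitFirst_single_zero, Fin.cons_zero, hZ.velocity_eq hy.2]
    · rw [splitFirst_single_succ, Fin.cons_succ, tangentVec, hZ.cellDeriv_eq hy.2]
  rw [← h2] at h1
  have h3 : (cellMapDeriv 𝓚 Z K y).det ^ 2 =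
      (normalVelocity 𝓚 Ω Z K z * jacobian 𝓚 (Z z.1) K z.2) ^ 2 := by
    rw [h1, normalVelocity, mul_pow, jacobian, Real.sq_sqrt hG.le]
    rfl
  rw [(sq_eq_sq_iff_abs_eq_abs _ _).1 h3, abs_mul, abs_of_pos hJ]

theorem IsSmoothMotion.continuousOn_fluxDensity (K : 𝓚.Cell) :
    ContinuousOn (fluxDensity 𝓚 Ω Z K) (I ×ˢ interior (𝓚.dom K)) := by
  have hsub : I ×ˢ interior (𝓚.dom K) ⊆ (univ : Set ℝ) ×ˢ interior (𝓚.dom K) :=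
    prod_mono (subset_univ _) subset_rfl
  refine ContinuousOn.mul (ContinuousOn.inner ?_ (hZ.continuousOn_normalField hI K))
    ((hZ.continuousOn_jacobian K).mono hsub)
  refine (((hZ.continuousOn_fderiv K).mono hsub).clm_apply
    (continuousOn_const (c := ((1 : ℝ), (0 : Coord d))))).congr fun z hz => ?_
  exact hZ.velocity_eq hz.2

end

section Slab

variable [T2Space M] [CompactSpace M] {Z : ℝ → M → Ambient d} (hZ : IsSmoothMotion 𝓚 Z)
  {Ω : ℝ → Set (Ambient d)} {a b : ℝ} (hI : ∀ τ ∈ Icc a b, Encloses 𝓚 (Z τ) (Ω τ))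
include hZ hI

theorem IsSmoothMotion.integrableOn_fluxDensity (K : 𝓚.Cell) :
    IntegrableOn (fluxDensity 𝓚 Ω Z K) (Ioo a b ×ˢ interior (𝓚.dom K)) := by
  obtain ⟨C, hC⟩ := hZ.exists_bound_det K a b
  refine 𝓚.integrableOn_of_bounded K (C := C)
    ((hZ.continuousOn_fluxDensity hI K).mono (prod_mono Ioo_subset_Icc_self subset_rfl))
    fun z hz => ?_
  obtain ⟨y, rfl⟩ := (splitFirst d).surjective z
  have hy : splitFirst d y ∈ Icc a b ×ˢ interior (𝓚.dom K) := ⟨Ioo_subset_Icc_self hz.1, hz.2⟩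
  have h1 := hC y hy
  rw [hZ.abs_det_cellMapDeriv hI hy] at h1
  rw [fluxDensity, abs_mul,
    abs_of_pos ((hI _ hy.1).jacobian_pos K _ (interior_subset hy.2))]
  exact h1

omit [T2Space M] [CompactSpace M] hI in
/-- For almost every point, the surface passes through it only at interior times, in the interior of a
cell, and with nonzero normal velocity. -/
theorem IsSmoothMotion.ae_regular : ∀ᵐ x : Ambient d, ∀ K, ∀ z ∈ Icc a b ×ˢ 𝓚.dom K,
    cellMap 𝓚 Z K z = x → z ∈ Ioo a b ×ˢ interior (𝓚.dom K) ∧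
      (cellMapDeriv 𝓚 Z K ((splitFirst d).symm z)).det ≠ 0 := by
  rw [ae_all_iff]
  intro K
  set G : Ambient d → Ambient d := fun y => cellMap 𝓚 Z K (splitFirst d y) with hG
  -- Two null sets of points are discarded: the image of the boundary of the space-time cylinder,
  -- itself null, and the critical values of the space-time map.
  set S : Set (Ambient d) := splitFirst d ⁻¹' ((Icc a b ×ˢ 𝓚.dom K) \ (Ioo a b ×ˢ interior (𝓚.dom K)))
    with hS
  set S' : Set (Ambient d) := {y | splitFirst d y ∈ Ioo a b ×ˢ interior (𝓚.dom K) ∧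
    (cellMapDeriv 𝓚 Z K y).det = 0} with hS'
  have hSnull : volume S = 0 := by
    rw [hS, measurePreserving_splitFirst.measure_preimage_emb
      (splitFirst d).toHomeomorph.measurableEmbedding]
    have hae : (Ioo a b ×ˢ interior (𝓚.dom K) : Set (ℝ × Coord d)) =ᵐ[volume]
        (Icc a b ×ˢ 𝓚.dom K : Set (ℝ × Coord d)) :=
      Measure.set_prod_ae_eq Ioo_ae_eq_Icc (𝓚.interior_ae_eq K)
    exact (ae_eq_set.1 hae).2
  have hnull : volume (G '' S) = 0 := by
    refine addHaar_image_eq_zero_of_differentiableOn_of_addHaar_eq_zero _ ?_ hSnull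
    exact ((hZ.contDiffOn K).differentiableOn one_ne_zero).comp
      (splitFirst d).differentiable.differentiableOn fun y hy => ⟨mem_univ _, hy.1.2⟩
  have hnull' : volume (G '' S') = 0 := by
    refine addHaar_image_eq_zero_of_det_fderivWithin_eq_zero volume
      (f' := cellMapDeriv 𝓚 Z K) (fun y hy => ?_) (fun y hy => hy.2)
    exact (hZ.hasStrictFDerivAt_comp hy.1.2).hasFDerivAt.hasFDerivWithinAt
  filter_upwards [measure_eq_zero_iff_ae_notMem.1 hnull, measure_eq_zero_iff_ae_notMem.1 hnull']
    with x h1 h2 z hz hzx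
  have hGz : G ((splitFirst d).symm z) = x := by
    simp only [hG, ContinuousLinearEquiv.apply_symm_apply]; exact hzx
  have hzi : z ∈ Ioo a b ×ˢ interior (𝓚.dom K) := by
    by_contra hcon
    refine h1 ⟨_, ?_, hGz⟩
    rw [hS, mem_preimage, ContinuousLinearEquiv.apply_symm_apply]
    exact ⟨hz, hcon⟩
  refine ⟨hzi, fun h0 => h2 ⟨_, ⟨?_, h0⟩, hGz⟩⟩
  rwa [ContinuousLinearEquiv.apply_symm_apply]

omit [T2Space M] [CompactSpace M] hI in
/-- The surface passes only finitely often through a regular point. -/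
theorem IsSmoothMotion.finite_passages {x : Ambient d} {K : 𝓚.Cell}
    (hx : ∀ z ∈ Icc a b ×ˢ 𝓚.dom K,
      cellMap 𝓚 Z K z = x → z ∈ Ioo a b ×ˢ interior (𝓚.dom K) ∧
      (cellMapDeriv 𝓚 Z K ((splitFirst d).symm z)).det ≠ 0) :
    {y : Ambient d | splitFirst d y ∈ Icc a b ×ˢ 𝓚.dom K ∧
      cellMap 𝓚 Z K (splitFirst d y) = x}.Finite := by
  set A : Set (Ambient d) := {y : Ambient d | splitFirst d y ∈ Icc a b ×ˢ 𝓚.dom K ∧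
      cellMap 𝓚 Z K (splitFirst d y) = x} with hA
  have hc : IsCompact (splitFirst d ⁻¹' (Icc a b ×ˢ 𝓚.dom K)) :=
    (splitFirst d).toHomeomorph.isCompact_preimage.2 (isCompact_Icc.prod (𝓚.isCompact_dom K))
  have hcont : ContinuousOn (fun y => cellMap 𝓚 Z K (splitFirst d y))
      (splitFirst d ⁻¹' (Icc a b ×ˢ 𝓚.dom K)) :=
    (hZ.contDiffOn K).continuousOn.comp (splitFirst d).continuous.continuousOn
      fun y hy => ⟨mem_univ _, hy.2⟩
  have hAc : IsCompact A := by
    refine hc.of_isClosed_subset ?_ (fun y hy => hy.1)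
    exact hcont.preimage_isClosed_of_isClosed hc.isClosed isClosed_singleton
  -- Passages are isolated by local injectivity, and a compact discrete set is finite.
  have : DiscreteTopology A := by
    rw [discreteTopology_subtype_iff']
    intro y hy
    have h1 := hx _ hy.1 hy.2
    rw [ContinuousLinearEquiv.symm_apply_apply] at h1
    obtain ⟨U, hU, hinj⟩ := exists_injOn_of_det_ne_zero (hZ.hasStrictFDerivAt_comp h1.1.2) h1.2
    refine ⟨interior U, isOpen_interior, ?_⟩
    ext w
    simp only [mem_inter_iff, mem_singleton_iff]
    constructor
    · rintro ⟨hwU, hwA⟩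
      exact hinj (interior_subset hwU) (mem_of_mem_nhds hU) (hwA.2.trans hy.2.symm)
    · rintro rfl
      exact ⟨mem_interior_iff_mem_nhds.2 hU, hy⟩
  exact hAc.finite ⟨this⟩

/-- The jump of the indicator function of the enclosed regions at a passage of the surface. -/
theorem IsSmoothMotion.jump_indicator {x : Ambient d} {K : 𝓚.Cell} {y : Ambient d}
    (hy : splitFirst d y ∈ Ioo a b ×ˢ interior (𝓚.dom K))
    (hdet : (cellMapDeriv 𝓚 Z K y).det ≠ 0) (hyx : cellMap 𝓚 Z K (splitFirst d y) = x) :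
    ∃ c, (∀ᶠ τ in 𝓝[<] (splitFirst d y).1, (Ω τ).indicator (1 : Ambient d → ℝ) x = c) ∧
      ∀ᶠ τ in 𝓝[>] (splitFirst d y).1, (Ω τ).indicator (1 : Ambient d → ℝ) x =
        c + Real.sign (normalVelocity 𝓚 Ω Z K (splitFirst d y)) := by
  have habs := hZ.abs_det_cellMapDeriv hI (K := K) (y := y) ⟨Ioo_subset_Icc_self hy.1, hy.2⟩
  set z := splitFirst d y with hz
  rw [normalVelocity] at habs ⊢
  set v := velocity Z z.1 (𝓚.param K z.2) with hv
  set n := normalField 𝓚 (Ω z.1) (Z z.1) K z.2 with hn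
  have hvn : inner ℝ v n ≠ 0 := by
    intro h
    rw [h, abs_zero, zero_mul, abs_eq_zero] at habs
    exact hdet habs
  obtain ⟨f, hf0, hf, W, hWo, hxW, hside⟩ :=
    hZ.exists_definingFunction_normalField hI (Ioo_subset_Icc_self hy.1) hy.2
  have hZx : Z z.1 (𝓚.param K z.2) = x := hyx
  rw [← hn, ← hv, hZx] at hf
  rw [hZx] at hf0 hxW
  rw [nhdsWithin_eq_nhds.2 (Icc_mem_nhds hy.1.1 hy.1.2)] at hside
  have hW : ∀ᶠ τ in 𝓝 z.1, (τ, x) ∈ W :=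
    (by fun_prop : Continuous fun τ : ℝ => (τ, x)).continuousAt.eventually (hWo.mem_nhds hxW)
  -- At the fixed point `x` the time derivative of the defining function is minus the normal
  -- velocity: when the surface moves outward, `f` becomes negative and `x` enters the region.
  have hder : HasDerivAt (fun τ => f (τ, x)) (-inner ℝ v n) z.1 := by
    have h1 : HasDerivAt (fun τ : ℝ => (τ, x)) ((1 : ℝ), (0 : Ambient d)) z.1 :=
      (hasDerivAt_id z.1).prodMk (hasDerivAt_const z.1 x)
    have h2 := hf.hasFDerivAt.comp_hasDerivAt z.1 h1
    have h3 : HasDerivAt (fun τ => f (τ, x)) _ z.1 := h2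
    convert h3 using 1
    simp [real_inner_comm]
  have hmem : ∀ᶠ τ in 𝓝 z.1, (x ∈ Ω τ ↔ f (τ, x) < 0) := by
    filter_upwards [hW, hside] with τ h1 h2
    exact (h2 x h1).1
  rcases lt_or_gt_of_ne hvn with hneg | hpos
  · obtain ⟨h1, h2⟩ := eventually_sign_of_hasDerivAt_pos hder hf0 (neg_pos.2 hneg)
    refine ⟨1, ?_, ?_⟩
    · filter_upwards [h2, hmem.filter_mono nhdsWithin_le_nhds] with τ h3 h4
      rw [indicator_of_mem (h4.2 h3), Pi.one_apply]
    · filter_upwards [h1, hmem.filter_mono nhdsWithin_le_nhds] with τ h3 h4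
      rw [indicator_of_notMem (fun h => absurd (h4.1 h) (not_lt.2 h3.le)), Real.sign_of_neg hneg]
      norm_num
  · obtain ⟨h1, h2⟩ := eventually_sign_of_hasDerivAt_pos hder.neg
      (by rw [Pi.neg_apply, hf0, neg_zero]) (by rwa [neg_neg])
    refine ⟨0, ?_, ?_⟩
    · filter_upwards [h2, hmem.filter_mono nhdsWithin_le_nhds] with τ h3 h4
      rw [Pi.neg_apply, neg_lt_zero] at h3
      rw [indicator_of_notMem (fun h => absurd (h4.1 h) (not_lt.2 h3.le))]
    · filter_upwards [h1, hmem.filter_mono nhdsWithin_le_nhds] with τ h3 h4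
      rw [Pi.neg_apply, Left.neg_pos_iff] at h3
      rw [indicator_of_mem (h4.2 h3), Real.sign_of_pos hpos, Pi.one_apply, zero_add]

/-- The regular passages of the moving surface through a point. -/
def passages (𝓚 : Mesh d M) (Z : ℝ → M → Ambient d) (a b : ℝ) (x : Ambient d) :
    Set (𝓚.Cell × Ambient d) :=
  {q | (q.2 ∈ splitFirst d ⁻¹' (Ioo a b ×ˢ interior (𝓚.dom q.1)) ∧
    (cellMapDeriv 𝓚 Z q.1 q.2).det ≠ 0) ∧ cellMap 𝓚 Z q.1 (splitFirst d q.2) = x}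

omit [CompactSpace M] [T2Space M] hZ in
-- Since `Z τ` is injective and an interior point of a cell has a single coordinate, a point is
-- passed at most once at each time. The jumps of its indicator thus occur at distinct times.
theorem injOn_time_passages (x : Ambient d) :
    InjOn (fun q : 𝓚.Cell × Ambient d => (splitFirst d q.2).1) (passages 𝓚 Z a b x) := by
  rintro ⟨K, y⟩ ⟨⟨hy, hdet⟩, hyx⟩ ⟨K', y'⟩ ⟨⟨hy', hdet'⟩, hyx'⟩ heq
  simp only at heq hy hy' hyx hyx'
  have h1 : 𝓚.param K (splitFirst d y).2 = 𝓚.param K' (splitFirst d y').2 := by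
    refine (hI _ (Ioo_subset_Icc_self hy.1)).injective ?_
    have h2 : Z (splitFirst d y).1 (𝓚.param K (splitFirst d y).2) = x := hyx
    have h3 : Z (splitFirst d y').1 (𝓚.param K' (splitFirst d y').2) = x := hyx'
    rw [h2, heq, h3]
  have h2 := 𝓚.eq_of_param_eq hy.2 (interior_subset hy'.2) h1
  rw [Prod.mk.injEq] at h2
  exact Prod.ext h2.1 ((splitFirst d).injective (Prod.ext heq h2.2))

/-- A regular point lies in the region at the end of a time interval and not at its beginning, or
conversely, according to the signed number of passages of the surface. -/
theorem IsSmoothMotion.tsum_passages (hab : a < b) {x : Ambient d}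
    (hx : ∀ K, ∀ z ∈ Icc a b ×ˢ 𝓚.dom K,
      cellMap 𝓚 Z K z = x → z ∈ Ioo a b ×ˢ interior (𝓚.dom K) ∧
      (cellMapDeriv 𝓚 Z K ((splitFirst d).symm z)).det ≠ 0) :
    ∑' q : passages 𝓚 Z a b x,
      Real.sign (normalVelocity 𝓚 Ω Z q.1.1 (splitFirst d q.1.2)) =
      (Ω b).indicator (1 : Ambient d → ℝ) x - (Ω a).indicator 1 x := by
  have hfin : (passages 𝓚 Z a b x).Finite := by
    refine (finite_iUnion fun K => (hZ.finite_passages (hx K)).image (Prod.mk K)).subset ?_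
    rintro ⟨K, y⟩ ⟨⟨h1, -⟩, h2⟩
    exact mem_iUnion.2 ⟨K, y, ⟨⟨Ioo_subset_Icc_self h1.1, interior_subset h1.2⟩, h2⟩, rfl⟩
  have hsum : ∑' q : passages 𝓚 Z a b x,
      Real.sign (normalVelocity 𝓚 Ω Z q.1.1 (splitFirst d q.1.2)) =
      ∑ q ∈ hfin.toFinset, Real.sign (normalVelocity 𝓚 Ω Z q.1 (splitFirst d q.2)) := by
    have h := Finset.tsum_subtype' hfin.toFinset fun q : 𝓚.Cell × Ambient d =>
      Real.sign (normalVelocity 𝓚 Ω Z q.1 (splitFirst d q.2))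
    rwa [hfin.coe_toFinset] at h
  rw [hsum]
  symm
  -- As a function of time, the indicator at `x` is locally constant except at the passages, which
  -- regularity places at interior times.
  refine sub_eq_sum_jumps hfin.toFinset (fun q => (splitFirst d q.2).1)
    (fun q => Real.sign (normalVelocity 𝓚 Ω Z q.1 (splitFirst d q.2)))
    (fun τ => (Ω τ).indicator (1 : Ambient d → ℝ) x) hab ?_ ?_ ?_ ?_
  · rw [hfin.coe_toFinset]
    exact injOn_time_passages hI x
  · intro q hq
    exact (hfin.mem_toFinset.1 hq).1.1.1
  · intro τ hτ hne
    have hxf : x ∉ frontier (Ω τ) := by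
      intro hxf
      rw [← (hI τ hτ).range_eq] at hxf
      obtain ⟨ξ, hξ⟩ := hxf
      obtain ⟨K, u, hu, rfl⟩ := 𝓚.exists_param ξ
      obtain ⟨h1, h2⟩ := hx K (τ, u) ⟨hτ, hu⟩ hξ
      refine hne (K, (splitFirst d).symm (τ, u)) (hfin.mem_toFinset.2 ⟨⟨?_, h2⟩, ?_⟩) ?_
      · rw [mem_preimage, ContinuousLinearEquiv.apply_symm_apply]; exact h1
      · rw [ContinuousLinearEquiv.apply_symm_apply]; exact hξ
      · rw [ContinuousLinearEquiv.apply_symm_apply]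
    filter_upwards [hZ.eventually_mem_iff hI hτ hxf] with τ' h
    by_cases hxτ : x ∈ Ω τ
    · rw [indicator_of_mem hxτ, indicator_of_mem (h.2 hxτ)]
    · rw [indicator_of_notMem hxτ, indicator_of_notMem (fun h' => hxτ (h.1 h'))]
  · intro q hq
    have hq' := hfin.mem_toFinset.1 hq
    exact hZ.jump_indicator hI hq'.1.1 hq'.1.2 hq'.2

/-- The transport theorem: the enclosed volume varies by the flux through the moving surface. -/
theorem IsSmoothMotion.volume_sub (hab : a < b) :
    volume.real (Ω b) - volume.real (Ω a) =
      ∫ τ in Ioo a b, normalInner 𝓚 (Ω τ) (Z τ) (velocity Z τ) (fun _ => 1) := by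
  have hrhs : ∫ τ in Ioo a b, normalInner 𝓚 (Ω τ) (Z τ) (velocity Z τ) (fun _ => 1) =
      ∑ K, ∫ z in Ioo a b ×ˢ interior (𝓚.dom K), fluxDensity 𝓚 Ω Z K z := by
    have h1 : ∀ τ, normalInner 𝓚 (Ω τ) (Z τ) (velocity Z τ) (fun _ => 1) =
        ∑ K, ∫ u in 𝓚.dom K, fluxDensity 𝓚 Ω Z K (τ, u) := by
      intro τ
      simp [normalInner, l2Inner, surfIntegral, toField, fluxDensity, normalVelocity]
    simp only [h1]
    rw [integral_finsetSum _ fun K _ =>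
      𝓚.integrableOn_integral K (hZ.integrableOn_fluxDensity hI K)]
    exact Finset.sum_congr rfl fun K _ => 𝓚.integral_integral K (hZ.integrableOn_fluxDensity hI K)
  rw [hrhs]
  -- With the sign of the normal velocity as weight, the unsigned volume element `|v · n| J` of the
  -- area formula becomes the flux density.
  set σ : 𝓚.Cell → Ambient d → ℝ := fun K y =>
    Real.sign (normalVelocity 𝓚 Ω Z K (splitFirst d y)) with hσ
  set Q : 𝓚.Cell → Set (Ambient d) := fun K => splitFirst d ⁻¹' (Ioo a b ×ˢ interior (𝓚.dom K))
    with hQ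
  have hQo : ∀ K, IsOpen (Q K) := fun K =>
    (isOpen_Ioo.prod isOpen_interior).preimage (splitFirst d).continuous
  have hemb : MeasurableEmbedding (splitFirst d) :=
    (splitFirst d).toHomeomorph.measurableEmbedding
  have hval : ∀ K, ∀ y ∈ Q K, |(cellMapDeriv 𝓚 Z K y).det| * σ K y =
      fluxDensity 𝓚 Ω Z K (splitFirst d y) := by
    intro K y hy
    rw [hZ.abs_det_cellMapDeriv hI ⟨Ioo_subset_Icc_self hy.1, hy.2⟩, fluxDensity, mul_right_comm]
    congr 1
    simp only [hσ]
    set c : ℝ := normalVelocity 𝓚 Ω Z K (splitFirst d y)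
    rcases lt_trichotomy c 0 with h | h | h
    · rw [abs_of_neg h, Real.sign_of_neg h]; ring
    · rw [h]; simp
    · rw [abs_of_pos h, Real.sign_of_pos h]; ring
  have hint : ∀ K, IntegrableOn (fun y => |(cellMapDeriv 𝓚 Z K y).det| * σ K y) (Q K) := by
    intro K
    refine IntegrableOn.congr_fun ?_ (fun y hy => (hval K y hy).symm) (hQo K).measurableSet
    exact (measurePreserving_splitFirst.integrableOn_comp_preimage hemb).2
      (hZ.integrableOn_fluxDensity hI K)
  have harea := sum_integral_abs_det_mul_eq_integral_tsum volume
    (F := fun K y => cellMap 𝓚 Z K (splitFirst d y)) (F' := fun K => cellMapDeriv 𝓚 Z K) hQo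
    (fun K y hy => hZ.hasStrictFDerivAt_comp hy.2)
    (fun K => (hZ.continuousOn_cellMapDeriv K).mono fun y hy => hy.2) σ hint
  have hl : ∀ K, ∫ y in Q K, |(cellMapDeriv 𝓚 Z K y).det| * σ K y =
      ∫ z in Ioo a b ×ˢ interior (𝓚.dom K), fluxDensity 𝓚 Ω Z K z := by
    intro K
    rw [setIntegral_congr_fun (hQo K).measurableSet (hval K)]
    exact measurePreserving_splitFirst.setIntegral_preimage_emb hemb _ _
  simp only [hl] at harea
  rw [harea]
  -- For almost every `x` the weighted number of preimages is the difference of the two indicators,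
  -- whose integral is the difference of the volumes.
  have hae := hZ.ae_regular (a := a) (b := b)
  have hmeas : ∀ τ ∈ Icc a b, MeasurableSet (Ω τ) ∧ volume (Ω τ) ≠ ⊤ := fun τ hτ =>
    ⟨(hI τ hτ).lipschitz.isOpen.measurableSet, (hI τ hτ).lipschitz.isBounded.measure_lt_top.ne⟩
  have ha := hmeas a (left_mem_Icc.2 hab.le)
  have hb := hmeas b (right_mem_Icc.2 hab.le)
  have hcongr := integral_congr_ae (hae.mono fun x hx => hZ.tsum_passages hI hab hx)
  refine Eq.trans ?_ hcongr.symm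
  rw [integral_sub, integral_indicator_one hb.1, integral_indicator_one ha.1]
  · exact (integrable_indicator_iff hb.1).2 (integrableOn_const hb.2)
  · exact (integrable_indicator_iff ha.1).2 (integrableOn_const ha.2)

end Slab

end SurfFEM

/-! ### Polynomials in time and the derivative of the surface element -/

/-- Jacobi's formula for the derivative of a determinant. -/
theorem hasDerivAt_matrix_det {ι : Type*} [Fintype ι] [DecidableEq ι] {A : ℝ → Matrix ι ι ℝ}
    {A' : Matrix ι ι ℝ} {τ : ℝ} (hA : ∀ i j, HasDerivAt (fun σ => A σ i j) (A' i j) τ) :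
    HasDerivAt (fun σ => (A σ).det) (∑ i, ∑ k, (A τ).adjugate i k * A' k i) τ := by
  have h1 : HasDerivAt (fun σ => (A σ).det)
      (∑ π : Equiv.Perm ι, ((Equiv.Perm.sign π : ℤ) : ℝ) *
        ∑ i, (∏ j ∈ Finset.univ.erase i, A τ (π j) j) • A' (π i) i) τ := by
    simp only [Matrix.det_apply']
    refine HasDerivAt.fun_sum fun π _ => HasDerivAt.const_mul _ ?_
    exact HasDerivAt.fun_finsetProd fun i _ => hA (π i) i
  convert h1 using 1
  -- By Cramer's rule, row `i` of the adjugate applied to column `i` of `A'` is the determinant with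
  -- that column replaced, which matches the product rule in the Leibniz expansion.
  have h2 : ∀ i, ∑ k, (A τ).adjugate i k * A' k i = ((A τ).updateCol i fun k => A' k i).det := by
    intro i
    rw [← Matrix.cramer_apply, Matrix.cramer_eq_adjugate_mulVec]
    rfl
  simp only [h2, Matrix.det_apply', Finset.mul_sum]
  rw [Finset.sum_comm]
  refine Finset.sum_congr rfl fun π _ => Finset.sum_congr rfl fun i _ => ?_
  rw [← Finset.mul_prod_erase _ _ (Finset.mem_univ i), Matrix.updateCol_self, smul_eq_mul,
    mul_comm (A' (π i) i)]
  congr 2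
  refine Finset.prod_congr rfl fun j hj => ?_
  rw [Matrix.updateCol_ne (Finset.ne_of_mem_erase hj)]

/-- A polynomial in time. -/
def timePoly {F : Type*} [AddCommGroup F] [Module ℝ F] (k : ℕ) (c : ℕ → F) (τ : ℝ) : F :=
  ∑ j ∈ Finset.range (k + 1), τ ^ j • c j

/-- The coefficients of the derivative of a polynomial in time. -/
def derivCoeff {F : Type*} [AddCommGroup F] [Module ℝ F] (c : ℕ → F) (j : ℕ) : F :=
  ((j : ℝ) + 1) • c (j + 1)

theorem hasDerivAt_timePoly {F : Type*} [NormedAddCommGroup F] [NormedSpace ℝ F] {k : ℕ}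
    (hk : 1 ≤ k) (c : ℕ → F) (τ : ℝ) :
    HasDerivAt (timePoly k c) (timePoly (k - 1) (derivCoeff c) τ) τ := by
  have h1 : HasDerivAt (timePoly k c)
      (∑ j ∈ Finset.range (k + 1), ((j : ℝ) * τ ^ (j - 1)) • c j) τ := by
    unfold timePoly
    exact HasDerivAt.fun_sum fun j _ => (hasDerivAt_pow j τ).smul_const (c j)
  convert h1 using 1
  rw [Finset.sum_range_succ', timePoly, Nat.sub_add_cancel hk]
  simp only [derivCoeff, Nat.cast_zero, zero_mul, zero_smul, add_zero, smul_smul]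
  refine Finset.sum_congr rfl fun j _ => ?_
  rw [Nat.add_sub_cancel, mul_comm]
  push_cast
  rfl

namespace SurfFEM

variable {d : ℕ} {M : Type*} [TopologicalSpace M] {𝓚 : Mesh d M}

/-- A function on the manifold that is continuously differentiable on every closed cell. -/
def IsCellSmooth {W : Type*} [NormedAddCommGroup W] [NormedSpace ℝ W] (𝓚 : Mesh d M) (f : M → W) :
    Prop :=
  ∀ K, ContDiffOn ℝ 1 (fun u => f (𝓚.param K u)) (𝓚.dom K)

theorem Mesh.uniqueDiffOn (𝓚 : Mesh d M) (K : 𝓚.Cell) : UniqueDiffOn ℝ (𝓚.dom K) :=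
  uniqueDiffOn_convex (𝓚.convex_dom K) (𝓚.interior_dom_nonempty K)

section CellDeriv

variable {W : Type*} [NormedAddCommGroup W] [NormedSpace ℝ W]

theorem IsCellSmooth.continuousOn_cellDeriv {f : M → W} (hf : IsCellSmooth 𝓚 f) (K : 𝓚.Cell) :
    ContinuousOn (cellDeriv 𝓚 f K) (𝓚.dom K) :=
  (hf K).continuousOn_fderivWithin (𝓚.uniqueDiffOn K) le_rfl

theorem cellDeriv_timePoly {k : ℕ} {c : ℕ → M → W} (hc : ∀ j, IsCellSmooth 𝓚 (c j)) {K : 𝓚.Cell}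
    {u : Coord d} (hu : u ∈ 𝓚.dom K) (τ : ℝ) :
    cellDeriv 𝓚 (timePoly k c τ) K u = timePoly k (fun j => cellDeriv 𝓚 (c j) K u) τ := by
  have hd : ∀ j, HasFDerivWithinAt (fun w => c j (𝓚.param K w)) (cellDeriv 𝓚 (c j) K u)
      (𝓚.dom K) u := fun j => ((hc j K).differentiableOn one_ne_zero u hu).hasFDerivWithinAt
  have h1 : HasFDerivWithinAt (fun w => timePoly k c τ (𝓚.param K w))
      (timePoly k (fun j => cellDeriv 𝓚 (c j) K u) τ) (𝓚.dom K) u := by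
    simp only [timePoly, Finset.sum_apply, Pi.smul_apply]
    exact HasFDerivWithinAt.fun_sum fun j _ => (hd j).const_smul (τ ^ j)
  exact h1.fderivWithin (𝓚.uniqueDiffOn K u hu)

theorem continuousOn_cellDeriv_timePoly {k : ℕ} {c : ℕ → M → W} (hc : ∀ j, IsCellSmooth 𝓚 (c j))
    (K : 𝓚.Cell) :
    ContinuousOn (fun z : ℝ × Coord d => cellDeriv 𝓚 (timePoly k c z.1) K z.2)
      (univ ×ˢ 𝓚.dom K) := by
  refine ContinuousOn.congr
    (f := fun z : ℝ × Coord d => timePoly k (fun j => cellDeriv 𝓚 (c j) K z.2) z.1) ?_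
    fun z hz => cellDeriv_timePoly hc hz.2 z.1
  unfold timePoly
  exact continuousOn_finsetSum _ fun j _ => (continuous_fst.pow j).continuousOn.smul
    (((hc j).continuousOn_cellDeriv K).comp continuousOn_snd fun z hz => hz.2)

theorem timePoly_isCellSmooth {k : ℕ} {c : ℕ → M → W} (hc : ∀ j, IsCellSmooth 𝓚 (c j)) (τ : ℝ) :
    IsCellSmooth 𝓚 (timePoly k c τ) := by
  intro K
  simp only [timePoly, Finset.sum_apply, Pi.smul_apply]
  exact ContDiffOn.sum fun j _ => contDiffOn_const.smul (hc j K)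

end CellDeriv

theorem cellDeriv_component {A : M → Ambient d} (hA : IsCellSmooth 𝓚 A) {K : 𝓚.Cell}
    {u : Coord d} (hu : u ∈ 𝓚.dom K) (k : Fin (d + 1)) (w : Coord d) :
    cellDeriv 𝓚 (fun ξ => A ξ k) K u w = cellDeriv 𝓚 A K u w k := by
  have hd : HasFDerivWithinAt (fun w => A (𝓚.param K w)) (cellDeriv 𝓚 A K u) (𝓚.dom K) u :=
    ((hA K).differentiableOn one_ne_zero u hu).hasFDerivWithinAt
  have h1 := (EuclideanSpace.proj (𝕜 := ℝ) k : Ambient d →L[ℝ] ℝ).hasFDerivAt.comp_hasFDerivWithinAt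
    u hd
  rw [cellDeriv]
  have h2 : fderivWithin ℝ (fun w => A (𝓚.param K w) k) (𝓚.dom K) u = _ :=
    h1.fderivWithin (𝓚.uniqueDiffOn K u hu)
  rw [h2]
  rfl

theorem metricTensor_isSymm (X : M → Ambient d) (K : 𝓚.Cell) (u : Coord d) :
    (metricTensor 𝓚 X K u).IsSymm := by
  ext i j
  simp [metricTensor, real_inner_comm]

theorem metricTensor_inv_comm (X : M → Ambient d) (K : 𝓚.Cell) (u : Coord d) (i j : Fin d) :
    (metricTensor 𝓚 X K u)⁻¹ i j = (metricTensor 𝓚 X K u)⁻¹ j i := by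
  have h : ((metricTensor 𝓚 X K u)⁻¹).transpose = (metricTensor 𝓚 X K u)⁻¹ := by
    rw [Matrix.transpose_nonsing_inv, (metricTensor_isSymm X K u).eq]
  exact congrFun (congrFun h j) i

/-- The inner product of surface gradients in coordinates. -/
theorem inner_surfGrad {X : M → Ambient d} {K : 𝓚.Cell} {u : Coord d}
    (hJ : 0 < jacobian 𝓚 X K u) (f g : M → ℝ) :
    inner ℝ (surfGrad 𝓚 X f K u) (surfGrad 𝓚 X g K u) =
      ∑ i, ∑ j, (metricTensor 𝓚 X K u)⁻¹ i j * (cellDeriv 𝓚 f K u (EuclideanSpace.single i 1) *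
        cellDeriv 𝓚 g K u (EuclideanSpace.single j 1)) := by
  have hdet : IsUnit (metricTensor 𝓚 X K u).det := (Real.sqrt_pos.1 hJ).ne'.isUnit
  set G := metricTensor 𝓚 X K u with hG
  -- The coefficients of the gradient in the tangent basis are `G⁻¹ φ`, so the inner product is `φᵀ
  -- G⁻¹ G G⁻¹ ψ`, and one factor `G⁻¹` cancels against `G`.
  have hgrad : ∀ f : M → ℝ, surfGrad 𝓚 X f K u = ∑ j,
      (Matrix.mulVec G⁻¹ fun i => cellDeriv 𝓚 f K u (EuclideanSpace.single i 1)) j •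
        tangentVec 𝓚 X K u j := by
    intro f
    rw [surfGrad, Finset.sum_comm]
    refine Finset.sum_congr rfl fun j _ => ?_
    rw [← Finset.sum_smul]
    congr 1
    simp only [Matrix.mulVec, dotProduct]
    exact Finset.sum_congr rfl fun i _ => by rw [metricTensor_inv_comm]
  set φ : Fin d → ℝ := fun i => cellDeriv 𝓚 f K u (EuclideanSpace.single i 1) with hφ
  set ψ : Fin d → ℝ := fun i => cellDeriv 𝓚 g K u (EuclideanSpace.single i 1) with hψ
  have h1 : ∀ α β : Fin d → ℝ, inner ℝ (∑ j, α j • tangentVec 𝓚 X K u j)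
      (∑ j, β j • tangentVec 𝓚 X K u j) = α ⬝ᵥ Matrix.mulVec G β := by
    intro α β
    simp only [sum_inner, inner_sum, inner_smul_left, inner_smul_right, dotProduct, Matrix.mulVec,
      conj_trivial, Finset.mul_sum, hG, metricTensor, Matrix.of_apply]
    rw [Finset.sum_comm]
    exact Finset.sum_congr rfl fun i _ => Finset.sum_congr rfl fun j _ => by ring
  rw [hgrad f, hgrad g, h1, Matrix.mulVec_mulVec, Matrix.mul_nonsing_inv _ hdet, Matrix.one_mulVec]
  simp only [dotProduct, Matrix.mulVec, Finset.sum_mul]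
  rw [Finset.sum_comm]
  exact Finset.sum_congr rfl fun i _ => Finset.sum_congr rfl fun j _ => by
    rw [metricTensor_inv_comm]; ring

/-- The sum over the components of the inner products of surface gradients. -/
theorem sum_inner_surfGrad {X : M → Ambient d} {K : 𝓚.Cell} {u : Coord d} (hu : u ∈ 𝓚.dom K)
    (hJ : 0 < jacobian 𝓚 X K u) {A B : M → Ambient d} (hA : IsCellSmooth 𝓚 A)
    (hB : IsCellSmooth 𝓚 B) :
    ∑ k, inner ℝ (surfGrad 𝓚 X (fun ξ => A ξ k) K u) (surfGrad 𝓚 X (fun ξ => B ξ k) K u) =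
      ∑ i, ∑ j, (metricTensor 𝓚 X K u)⁻¹ i j * inner ℝ (tangentVec 𝓚 A K u i)
        (tangentVec 𝓚 B K u j) := by
  simp only [inner_surfGrad hJ, cellDeriv_component hA hu, cellDeriv_component hB hu]
  rw [Finset.sum_comm]
  refine Finset.sum_congr rfl fun i _ => ?_
  rw [Finset.sum_comm]
  refine Finset.sum_congr rfl fun j _ => ?_
  rw [← Finset.mul_sum]
  congr 1
  simp only [PiLp.inner_apply, RCLike.inner_apply, conj_trivial, tangentVec]
  exact Finset.sum_congr rfl fun k _ => mul_comm _ _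

section TimePoly

variable {k : ℕ} {c : ℕ → M → Ambient d} (hc : ∀ j, IsCellSmooth 𝓚 (c j))
include hc

theorem derivCoeff_isCellSmooth (j : ℕ) : IsCellSmooth 𝓚 (derivCoeff c j) := fun K =>
  contDiffOn_const.smul (hc (j + 1) K)

omit [TopologicalSpace M] hc in
theorem velocity_timePoly (hk : 1 ≤ k) (τ : ℝ) :
    velocity (timePoly k c) τ = timePoly (k - 1) (derivCoeff c) τ := by
  funext ξ
  have h1 := hasDerivAt_timePoly hk (fun j => c j ξ) τ
  have h2 : ∀ (k : ℕ) (e : ℕ → M → Ambient d) σ, timePoly k e σ ξ = timePoly k (fun j => e j ξ) σ := by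
    intro k e σ
    simp only [timePoly, Finset.sum_apply, Pi.smul_apply]
  rw [velocity, h2]
  simp only [h2]
  exact h1.deriv

/-- A polynomial in time is a finite sum of powers of `τ` times fixed functions of the coordinates,
so time and space derivatives commute by linearity, without any second derivative in space. -/
theorem hasDerivAt_tangentVec (hk : 1 ≤ k) {K : 𝓚.Cell} {u : Coord d} (hu : u ∈ 𝓚.dom K) (i : Fin d)
    (τ : ℝ) :
    HasDerivAt (fun σ => tangentVec 𝓚 (timePoly k c σ) K u i)
      (tangentVec 𝓚 (velocity (timePoly k c) τ) K u i) τ := by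
  have h1 := hasDerivAt_timePoly hk (fun j => cellDeriv 𝓚 (c j) K u) τ
  have h2 := h1.clm_apply (hasDerivAt_const τ (EuclideanSpace.single i (1 : ℝ)))
  simp only [tangentVec, velocity_timePoly hk, cellDeriv_timePoly hc hu,
    cellDeriv_timePoly (derivCoeff_isCellSmooth hc) hu]
  refine h2.congr_deriv ?_
  rw [map_zero, add_zero]
  congr 2
  funext j
  symm
  have hd : HasFDerivWithinAt (fun w => c (j + 1) (𝓚.param K w)) (cellDeriv 𝓚 (c (j + 1)) K u)
      (𝓚.dom K) u := ((hc (j + 1) K).differentiableOn one_ne_zero u hu).hasFDerivWithinAt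
  exact (hd.const_smul ((j : ℝ) + 1)).fderivWithin (𝓚.uniqueDiffOn K u hu)

/-- The derivative of the surface element. -/
theorem hasDerivAt_jacobian (hk : 1 ≤ k) {K : 𝓚.Cell} {u : Coord d} (hu : u ∈ 𝓚.dom K) {τ : ℝ}
    (hJ : 0 < jacobian 𝓚 (timePoly k c τ) K u) :
    HasDerivAt (fun σ => jacobian 𝓚 (timePoly k c σ) K u)
      ((∑ i, ∑ j, (metricTensor 𝓚 (timePoly k c τ) K u)⁻¹ i j *
        inner ℝ (tangentVec 𝓚 (timePoly k c τ) K u i)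
          (tangentVec 𝓚 (velocity (timePoly k c) τ) K u j)) *
        jacobian 𝓚 (timePoly k c τ) K u) τ := by
  set G := metricTensor 𝓚 (timePoly k c τ) K u with hG
  have hGpos : 0 < G.det := Real.sqrt_pos.1 hJ
  have hT := fun i => hasDerivAt_tangentVec hc hk hu i τ
  set T := tangentVec 𝓚 (timePoly k c τ) K u with hTdef
  set T' := tangentVec 𝓚 (velocity (timePoly k c) τ) K u with hT'def
  have h1 := hasDerivAt_matrix_det (A := fun σ => metricTensor 𝓚 (timePoly k c σ) K u)
    (A' := Matrix.of fun i j => inner ℝ (T i) (T' j) + inner ℝ (T' i) (T j)) (τ := τ)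
    (fun i j => (hT i).inner ℝ (hT j))
  rw [← hG] at h1
  have h2 := h1.sqrt hGpos.ne'
  refine h2.congr_deriv ?_
  have hJeq : jacobian 𝓚 (timePoly k c τ) K u = √G.det := rfl
  -- The adjugate is `G.det * G⁻¹`. The two terms of the product rule for `G` coincide by symmetry,
  -- and the resulting factor `2` cancels the one from the square root.
  have hadj : ∀ i j, G.adjugate i j = G.det * G⁻¹ i j := by
    intro i j
    rw [Matrix.inv_def, Ring.inverse_eq_inv', Matrix.smul_apply, smul_eq_mul, ← mul_assoc,
      mul_inv_cancel₀ hGpos.ne', one_mul]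
  have hsum1 : ∑ i, ∑ j, G⁻¹ i j * inner ℝ (T j) (T' i) = ∑ i, ∑ j, G⁻¹ i j * inner ℝ (T i) (T' j) := by
    rw [Finset.sum_comm]
    exact Finset.sum_congr rfl fun i _ => Finset.sum_congr rfl fun j _ => by
      rw [metricTensor_inv_comm]
  have hsum2 : ∑ i, ∑ j, G⁻¹ i j * inner ℝ (T' j) (T i) = ∑ i, ∑ j, G⁻¹ i j * inner ℝ (T i) (T' j) :=
    Finset.sum_congr rfl fun i _ => Finset.sum_congr rfl fun j _ => by rw [real_inner_comm]
  have hnum : ∑ i, ∑ j, G.adjugate i j * (Matrix.of fun i j =>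
      inner ℝ (T i) (T' j) + inner ℝ (T' i) (T j) : Matrix (Fin d) (Fin d) ℝ) j i =
      G.det * (2 * ∑ i, ∑ j, G⁻¹ i j * inner ℝ (T i) (T' j)) := by
    have : ∀ i j, G.adjugate i j * (Matrix.of fun i j =>
      inner ℝ (T i) (T' j) + inner ℝ (T' i) (T j) : Matrix (Fin d) (Fin d) ℝ) j i =
        G.det * (G⁻¹ i j * inner ℝ (T j) (T' i) + G⁻¹ i j * inner ℝ (T' j) (T i)) := by
      intro i j
      rw [hadj, Matrix.of_apply]; ring
    simp only [this, ← Finset.mul_sum, Finset.sum_add_distrib]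
    rw [hsum1, hsum2, two_mul]
  rw [hnum, hJeq]
  have hs : √G.det * √G.det = G.det := Real.mul_self_sqrt hGpos.le
  have hs0 : √G.det ≠ 0 := (Real.sqrt_pos.2 hGpos).ne'
  change _ / (2 * √G.det) = _
  rw [div_eq_iff (mul_ne_zero two_ne_zero hs0)]
  linear_combination (-2 * ∑ i, ∑ j, G⁻¹ i j * inner ℝ (T i) (T' j)) * hs

end TimePoly

end SurfFEM

/-! ### Integrability and the variation of the area -/

namespace SurfFEM

variable {d : ℕ} {M : Type*} [TopologicalSpace M] {𝓚 : Mesh d M}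

omit [TopologicalSpace M] in
theorem timePoly_apply {W : Type*} [AddCommGroup W] [Module ℝ W] (k : ℕ) (c : ℕ → M → W)
    (τ : ℝ) (ξ : M) : timePoly k c τ ξ = ∑ j ∈ Finset.range (k + 1), τ ^ j • c j ξ := by
  simp only [timePoly, Finset.sum_apply, Pi.smul_apply]

theorem continuousOn_timePoly_param {W : Type*} [NormedAddCommGroup W] [NormedSpace ℝ W] {k : ℕ}
    {c : ℕ → M → W} (hc : ∀ j, IsCellSmooth 𝓚 (c j)) (K : 𝓚.Cell) :
    ContinuousOn (fun z : ℝ × Coord d => timePoly k c z.1 (𝓚.param K z.2)) (univ ×ˢ 𝓚.dom K) := by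
  simp only [timePoly_apply]
  exact continuousOn_finsetSum _ fun j _ => (continuous_fst.pow j).continuousOn.smul
    ((hc j K).continuousOn.comp continuousOn_snd fun z hz => hz.2)

/-- The polynomial of one slab is considered at all real times. It is thus differentiable at the
ends of the slab as well, where the solution itself may have a kink. -/
theorem isSmoothMotion_timePoly {k : ℕ} {c : ℕ → M → Ambient d} (hc : ∀ j, IsCellSmooth 𝓚 (c j))
    (hcont : ∀ j, Continuous (c j)) : IsSmoothMotion 𝓚 (timePoly k c) where
  continuous := by
    simp only [timePoly_apply]
    exact continuous_finsetSum _ fun j _ =>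
      (continuous_fst.pow j).smul ((hcont j).comp continuous_snd)
  contDiffOn K := by
    unfold cellMap
    simp only [timePoly_apply]
    exact ContDiffOn.sum fun j _ => (contDiff_fst.pow j).contDiffOn.smul
      ((hc j K).comp contDiff_snd.contDiffOn fun z hz => hz.2)

section Continuity

variable {Y : Type*} [TopologicalSpace Y] {S : Set Y} {X : Y → M → Ambient d} {K : 𝓚.Cell}
  {v : Y → Coord d} (hT : ∀ i, ContinuousOn (fun y => tangentVec 𝓚 (X y) K (v y) i) S)
include hT

theorem continuousOn_metricTensor :
    ContinuousOn (fun y => metricTensor 𝓚 (X y) K (v y)) S := by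
  simp only [continuousOn_iff_continuous_domRestrict] at hT ⊢
  exact continuous_matrix fun i j => (hT i).inner (hT j)

theorem continuousOn_jacobian_of_tangentVec :
    ContinuousOn (fun y => jacobian 𝓚 (X y) K (v y)) S := by
  have h := continuousOn_metricTensor hT
  rw [continuousOn_iff_continuous_domRestrict] at h ⊢
  exact Real.continuous_sqrt.comp h.matrix_det

theorem continuousOn_metricTensor_inv (hJ : ∀ y ∈ S, 0 < jacobian 𝓚 (X y) K (v y)) (i j : Fin d) :
    ContinuousOn (fun y => (metricTensor 𝓚 (X y) K (v y))⁻¹ i j) S := by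
  have h := continuousOn_metricTensor hT
  rw [continuousOn_iff_continuous_domRestrict] at h
  have hdet : ContinuousOn (fun y => (metricTensor 𝓚 (X y) K (v y)).det) S := by
    rw [continuousOn_iff_continuous_domRestrict]
    exact h.matrix_det
  have hadj : ContinuousOn (fun y => (metricTensor 𝓚 (X y) K (v y)).adjugate i j) S := by
    rw [continuousOn_iff_continuous_domRestrict]
    exact h.matrix_adjugate.matrix_elem i j
  refine ((hdet.inv₀ fun y hy => (Real.sqrt_pos.1 (hJ y hy)).ne').mul hadj).congr fun y _ => ?_
  rw [Matrix.inv_def, Ring.inverse_eq_inv', Matrix.smul_apply, smul_eq_mul]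
  rfl

end Continuity

theorem IsCellSmooth.continuousOn_tangentVec {A : M → Ambient d} (hA : IsCellSmooth 𝓚 A)
    (K : 𝓚.Cell) (i : Fin d) : ContinuousOn (fun u => tangentVec 𝓚 A K u i) (𝓚.dom K) :=
  (hA.continuousOn_cellDeriv K).clm_apply continuousOn_const

theorem IsCellSmooth.component {A : M → Ambient d} (hA : IsCellSmooth 𝓚 A) (k : Fin (d + 1)) :
    IsCellSmooth 𝓚 fun ξ => A ξ k := fun K =>
  (contDiffOn_euclidean.1 (hA K)) k

theorem IsCellSmooth.continuousOn_surfGrad {X : M → Ambient d} (hX : IsCellSmooth 𝓚 X) {K : 𝓚.Cell}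
    (hJ : ∀ u ∈ 𝓚.dom K, 0 < jacobian 𝓚 X K u) {f : M → ℝ} (hf : IsCellSmooth 𝓚 f) :
    ContinuousOn (surfGrad 𝓚 X f K) (𝓚.dom K) := by
  unfold surfGrad
  exact continuousOn_finsetSum _ fun i _ => continuousOn_finsetSum _ fun j _ =>
    ((continuousOn_metricTensor_inv (X := fun _ => X) (hX.continuousOn_tangentVec K) hJ i j).mul
      ((hf.continuousOn_cellDeriv K).clm_apply continuousOn_const)).smul
      (hX.continuousOn_tangentVec K j)

/-- The density of the inner product of the surface gradients of two vector fields. -/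
noncomputable def gradDensity (𝓚 : Mesh d M) (X A B : M → Ambient d) (K : 𝓚.Cell) (u : Coord d) :
    ℝ :=
  (∑ i, ∑ j, (metricTensor 𝓚 X K u)⁻¹ i j *
    inner ℝ (tangentVec 𝓚 A K u i) (tangentVec 𝓚 B K u j)) * jacobian 𝓚 X K u

theorem gradInnerVec_eq_sum_integral {X A B : M → Ambient d} (hX : IsCellSmooth 𝓚 X)
    (hJ : ∀ K, ∀ u ∈ 𝓚.dom K, 0 < jacobian 𝓚 X K u) (hA : IsCellSmooth 𝓚 A)
    (hB : IsCellSmooth 𝓚 B) :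
    gradInnerVec 𝓚 X A B = ∑ K, ∫ u in 𝓚.dom K, gradDensity 𝓚 X A B K u := by
  simp only [gradInnerVec, gradInner, l2Inner, surfIntegral]
  rw [Finset.sum_comm]
  refine Finset.sum_congr rfl fun K _ => ?_
  rw [← integral_finsetSum]
  · refine setIntegral_congr_fun (𝓚.isCompact_dom K).isClosed.measurableSet fun u hu => ?_
    simp only [gradDensity]
    rw [← Finset.sum_mul, sum_inner_surfGrad hu (hJ K u hu) hA hB]
  · intro k _
    refine ContinuousOn.integrableOn_compact (𝓚.isCompact_dom K) ?_
    exact ((hX.continuousOn_surfGrad (hJ K) (hA.component k)).inner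
      (hX.continuousOn_surfGrad (hJ K) (hB.component k))).mul
      (continuousOn_jacobian_of_tangentVec (X := fun _ => X) (hX.continuousOn_tangentVec K))

theorem Mesh.integrableOn_of_continuousOn (𝓚 : Mesh d M) (K : 𝓚.Cell) {a b : ℝ}
    {H : ℝ × Coord d → ℝ} (hH : ContinuousOn H (Icc a b ×ˢ 𝓚.dom K)) :
    IntegrableOn H (Ioo a b ×ˢ interior (𝓚.dom K)) :=
  (hH.integrableOn_compact (isCompact_Icc.prod (𝓚.isCompact_dom K))).mono_set
    (prod_mono Ioo_subset_Icc_self interior_subset)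

section Slab

variable {a b : ℝ} {k : ℕ} {c : ℕ → M → Ambient d} (hc : ∀ j, IsCellSmooth 𝓚 (c j))
include hc

theorem continuousOn_tangentVec_timePoly (K : 𝓚.Cell) (i : Fin d) :
    ContinuousOn (fun z : ℝ × Coord d => tangentVec 𝓚 (timePoly k c z.1) K z.2 i)
      (Icc a b ×ˢ 𝓚.dom K) :=
  ((continuousOn_cellDeriv_timePoly hc K).clm_apply continuousOn_const).mono
    (prod_mono (subset_univ _) subset_rfl)

variable (hJ : ∀ τ ∈ Icc a b, ∀ K, ∀ u ∈ 𝓚.dom K, 0 < jacobian 𝓚 (timePoly k c τ) K u)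
include hJ

theorem continuousOn_gradDensity_timePoly {k₁ k₂ : ℕ} {e₁ e₂ : ℕ → M → Ambient d}
    (he₁ : ∀ j, IsCellSmooth 𝓚 (e₁ j)) (he₂ : ∀ j, IsCellSmooth 𝓚 (e₂ j)) (K : 𝓚.Cell) :
    ContinuousOn (fun z : ℝ × Coord d => gradDensity 𝓚 (timePoly k c z.1) (timePoly k₁ e₁ z.1)
      (timePoly k₂ e₂ z.1) K z.2) (Icc a b ×ˢ 𝓚.dom K) := by
  have hT := continuousOn_tangentVec_timePoly (a := a) (b := b) (k := k) hc K
  unfold gradDensity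
  refine ContinuousOn.mul ?_ (continuousOn_jacobian_of_tangentVec hT)
  exact continuousOn_finsetSum _ fun i _ => continuousOn_finsetSum _ fun j _ =>
    (continuousOn_metricTensor_inv hT (fun z hz => hJ z.1 hz.1 K z.2 hz.2) i j).mul
      ((continuousOn_tangentVec_timePoly he₁ K i).inner (continuousOn_tangentVec_timePoly he₂ K j))

theorem integrableOn_gradInnerVec_timePoly {k₁ k₂ : ℕ} {e₁ e₂ : ℕ → M → Ambient d}
    (he₁ : ∀ j, IsCellSmooth 𝓚 (e₁ j)) (he₂ : ∀ j, IsCellSmooth 𝓚 (e₂ j)) :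
    IntegrableOn (fun τ => gradInnerVec 𝓚 (timePoly k c τ) (timePoly k₁ e₁ τ) (timePoly k₂ e₂ τ))
      (Ioo a b) := by
  refine IntegrableOn.congr_fun (f := fun τ => ∑ K, ∫ u in 𝓚.dom K,
    gradDensity 𝓚 (timePoly k c τ) (timePoly k₁ e₁ τ) (timePoly k₂ e₂ τ) K u) ?_
    (fun τ hτ => (gradInnerVec_eq_sum_integral (timePoly_isCellSmooth hc τ)
      (hJ τ (Ioo_subset_Icc_self hτ)) (timePoly_isCellSmooth he₁ τ)
      (timePoly_isCellSmooth he₂ τ)).symm) measurableSet_Ioo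
  exact integrable_finsetSum _ fun K _ => 𝓚.integrableOn_integral K
    (𝓚.integrableOn_of_continuousOn K (continuousOn_gradDensity_timePoly hc hJ he₁ he₂ K))

theorem jacobian_sub (hk : 1 ≤ k) (hab : a ≤ b) {K : 𝓚.Cell} {u : Coord d} (hu : u ∈ 𝓚.dom K) :
    jacobian 𝓚 (timePoly k c b) K u - jacobian 𝓚 (timePoly k c a) K u =
      ∫ τ in Ioo a b, gradDensity 𝓚 (timePoly k c τ) (timePoly k c τ)
        (timePoly (k - 1) (derivCoeff c) τ) K u := by
  have hD := continuousOn_gradDensity_timePoly (k₁ := k) (k₂ := k - 1) hc hJ hc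
    (derivCoeff_isCellSmooth hc) K
  have hline : ContinuousOn (fun τ : ℝ => (τ, u)) (Icc a b) := by fun_prop
  have hcont := hD.comp hline fun τ hτ => ⟨hτ, hu⟩
  have hder : ∀ τ ∈ Ioo a b, HasDerivAt (fun σ => jacobian 𝓚 (timePoly k c σ) K u)
      (gradDensity 𝓚 (timePoly k c τ) (timePoly k c τ) (timePoly (k - 1) (derivCoeff c) τ) K u)
      τ := by
    intro τ hτ
    rw [← velocity_timePoly hk]
    exact hasDerivAt_jacobian hc hk hu (hJ τ (Ioo_subset_Icc_self hτ) K u hu)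
  have hJc : ContinuousOn (fun σ => jacobian 𝓚 (timePoly k c σ) K u) (Icc a b) := fun τ hτ =>
    (hasDerivAt_jacobian hc hk hu (hJ τ hτ K u hu)).continuousAt.continuousWithinAt
  have h := intervalIntegral.integral_eq_sub_of_hasDerivAt_of_le hab hJc hder
    (hcont.intervalIntegrable_of_Icc hab)
  rw [intervalIntegral.integral_of_le hab, integral_Ioc_eq_integral_Ioo] at h
  exact h.symm

/-- The first variation of the surface area. -/
theorem area_sub (hk : 1 ≤ k) (hab : a ≤ b) :
    area 𝓚 (timePoly k c b) - area 𝓚 (timePoly k c a) =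
      ∫ τ in Ioo a b,
        gradInnerVec 𝓚 (timePoly k c τ) (timePoly k c τ) (velocity (timePoly k c) τ) := by
  simp only [velocity_timePoly hk]
  have hc' := derivCoeff_isCellSmooth hc
  have hD := continuousOn_gradDensity_timePoly (k₁ := k) (k₂ := k - 1) hc hJ hc hc'
  have hDi := fun K => 𝓚.integrableOn_of_continuousOn K (hD K)
  have hrhs : ∫ τ in Ioo a b, gradInnerVec 𝓚 (timePoly k c τ) (timePoly k c τ)
      (timePoly (k - 1) (derivCoeff c) τ) = ∑ K, ∫ τ in Ioo a b, ∫ u in 𝓚.dom K,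
        gradDensity 𝓚 (timePoly k c τ) (timePoly k c τ) (timePoly (k - 1) (derivCoeff c) τ) K u := by
    rw [← integral_finsetSum _ fun K _ => 𝓚.integrableOn_integral K (hDi K)]
    exact setIntegral_congr_fun measurableSet_Ioo fun τ hτ =>
      gradInnerVec_eq_sum_integral (timePoly_isCellSmooth hc τ) (hJ τ (Ioo_subset_Icc_self hτ))
        (timePoly_isCellSmooth hc τ) (timePoly_isCellSmooth hc' τ)
  rw [hrhs]
  simp only [area, surfIntegral, one_mul]
  rw [← Finset.sum_sub_distrib]
  refine Finset.sum_congr rfl fun K _ => ?_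
  have hJi : ∀ τ, IntegrableOn (jacobian 𝓚 (timePoly k c τ) K) (𝓚.dom K) := fun τ =>
    ContinuousOn.integrableOn_compact (𝓚.isCompact_dom K)
      (continuousOn_jacobian_of_tangentVec (X := fun _ => timePoly k c τ)
        ((timePoly_isCellSmooth hc τ).continuousOn_tangentVec K))
  -- After Fubini the claim reduces to the fundamental theorem of calculus for the surface element
  -- at each coordinate point.
  rw [← integral_sub (hJi b) (hJi a), integral_integral_swap]
  · refine setIntegral_congr_fun (𝓚.isCompact_dom K).isClosed.measurableSet fun u hu => ?_
    exact jacobian_sub hc hJ hk hab hu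
  · have h := hDi K
    rw [IntegrableOn, ← 𝓚.restrict_prod K a b] at h
    exact h

end Slab

/-- The normal is continuous only on open cells but has norm `1` there, so the integrand is
dominated by a continuous function on the compact closed cell. Integrability is what allows the
integrals of sums in the scheme to be split. -/
theorem integrableOn_scaledNormalInner_timePoly [T2Space M] [CompactSpace M] {a b : ℝ}
    {k : ℕ} {c : ℕ → M → Ambient d} (hc : ∀ j, IsCellSmooth 𝓚 (c j)) (hcont : ∀ j, Continuous (c j))
    {Ω : ℝ → Set (Ambient d)} (hI : ∀ τ ∈ Icc a b, Encloses 𝓚 (timePoly k c τ) (Ω τ))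
    {k₁ k₂ : ℕ} {q : ℕ → M → ℝ} {e : ℕ → M → Ambient d}
    (hq : ∀ j, IsCellSmooth 𝓚 (q j)) (he : ∀ j, IsCellSmooth 𝓚 (e j)) :
    IntegrableOn (fun τ => scaledNormalInner 𝓚 (Ω τ) (timePoly k c τ) (timePoly k₁ q τ)
      (timePoly k₂ e τ)) (Ioo a b) := by
  have hZ := isSmoothMotion_timePoly (k := k) hc hcont
  unfold scaledNormalInner l2Inner surfIntegral toField
  refine integrable_finsetSum _ fun K _ => 𝓚.integrableOn_integral K (H := fun z =>
    inner ℝ (timePoly k₁ q z.1 (𝓚.param K z.2) • normalField 𝓚 (Ω z.1) (timePoly k c z.1) K z.2)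
      (timePoly k₂ e z.1 (𝓚.param K z.2)) * jacobian 𝓚 (timePoly k c z.1) K z.2) ?_
  have hsub : Icc a b ×ˢ 𝓚.dom K ⊆ (univ : Set ℝ) ×ˢ 𝓚.dom K :=
    prod_mono (subset_univ _) subset_rfl
  have hsub' : Ioo a b ×ˢ interior (𝓚.dom K) ⊆ Icc a b ×ˢ 𝓚.dom K :=
    prod_mono Ioo_subset_Icc_self interior_subset
  have hq' := (continuousOn_timePoly_param (k := k₁) hq K).mono hsub
  have he' := (continuousOn_timePoly_param (k := k₂) he K).mono hsub
  have hJ' := continuousOn_jacobian_of_tangentVec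
    (continuousOn_tangentVec_timePoly (a := a) (b := b) (k := k) hc K)
  obtain ⟨C, hC⟩ := (isCompact_Icc.prod (𝓚.isCompact_dom K)).exists_bound_of_continuousOn
    ((hq'.norm.mul he'.norm).mul hJ')
  refine 𝓚.integrableOn_of_bounded K (C := C) ?_ fun z hz => ?_
  · refine ContinuousOn.mul (ContinuousOn.inner (ContinuousOn.smul (hq'.mono hsub') ?_)
      (he'.mono hsub')) (hJ'.mono hsub')
    exact (hZ.continuousOn_normalField hI K).mono (prod_mono Ioo_subset_Icc_self subset_rfl)
  · refine le_trans ?_ (hC z (hsub' hz))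
    simp only [Pi.mul_apply]
    rw [abs_mul, norm_mul, norm_mul, norm_norm, norm_norm, Real.norm_eq_abs (jacobian _ _ _ _)]
    refine mul_le_mul_of_nonneg_right ((abs_real_inner_le_norm _ _).trans_eq ?_) (abs_nonneg _)
    rw [norm_smul, hZ.norm_normalField hI (Ioo_subset_Icc_self hz.1) hz.2, mul_one]

theorem gradInnerVec_comm (X A B : M → Ambient d) :
    gradInnerVec 𝓚 X A B = gradInnerVec 𝓚 X B A := by
  simp only [gradInnerVec, gradInner, l2Inner, real_inner_comm]

/-- This symmetry couples the equations in pairs: the multiplier term tested with `R` is the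
auxiliary equation tested with `p`, and the curvature term tested with `Ẋ` is the velocity equation
tested with `κ`. -/
theorem scaledNormalInner_eq_normalInner (Ω : Set (Ambient d)) (X B : M → Ambient d) (q : M → ℝ) :
    scaledNormalInner 𝓚 Ω X q B = normalInner 𝓚 Ω X B q := by
  simp only [scaledNormalInner, normalInner, l2Inner, toField, inner_smul_left, conj_trivial,
    real_inner_comm, RCLike.inner_apply]

theorem gradInner_self (X : M → Ambient d) (f : M → ℝ) :
    gradInner 𝓚 X f f = gradNormSq 𝓚 X f := by
  simp only [gradInner, gradNormSq, l2Inner, real_inner_self_eq_norm_sq]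

theorem gradInner_one_right (X : M → Ambient d) (f : M → ℝ) :
    gradInner 𝓚 X f (fun _ => 1) = 0 := by
  simp [gradInner, l2Inner, surfIntegral, surfGrad, cellDeriv]

theorem gradNormSq_nonneg (X : M → Ambient d) (f : M → ℝ) : 0 ≤ gradNormSq 𝓚 X f :=
  Finset.sum_nonneg fun _ _ => integral_nonneg fun _ => mul_nonneg (sq_nonneg _) (Real.sqrt_nonneg _)

theorem IsFESpace.isCellSmooth {V : Submodule ℝ (M → ℝ)} (hV : IsFESpace 𝓚 V) {v : M → ℝ}
    (hv : v ∈ V) : IsCellSmooth 𝓚 v := fun K => (hV.smooth v hv K).of_le (by norm_num)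

theorem IsFESpace.isCellSmooth_vec {V : Submodule ℝ (M → ℝ)} (hV : IsFESpace 𝓚 V)
    {F : M → Ambient d} (hF : F ∈ vecSpace d V) : IsCellSmooth 𝓚 F := fun K =>
  contDiffOn_euclidean.2 fun i => hV.isCellSmooth (hF i) K

theorem IsFESpace.continuous_vec {V : Submodule ℝ (M → ℝ)} (hV : IsFESpace 𝓚 V)
    {F : M → Ambient d} (hF : F ∈ vecSpace d V) : Continuous F :=
  (PiLp.continuous_toLp 2 _).comp (continuous_pi fun i => hV.continuous _ (hF i))

end SurfFEM

/-! ### Conservation of volume and dissipation of area -/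

theorem theorem4p4 {d : ℕ} (hd : 1 ≤ d)
    {M : Type*} [TopologicalSpace M] [T2Space M] [CompactSpace M]
    [ChartedSpace (EuclideanSpace ℝ (Fin d)) M]
    (𝓚 : Mesh d M) (V : Submodule ℝ (M → ℝ)) (hV : IsFESpace 𝓚 V)
    (s : ℕ) (hs : 1 ≤ s)
    (N : ℕ) (t : ℕ → ℝ) (ht0 : t 0 = 0) (ht : ∀ n < N, t n < t (n + 1))
    (X₀ : M → Ambient d) (Ω : ℝ → Set (Ambient d))
    (X : ℝ → M → Ambient d) (p : ℝ → M → ℝ) (R : ℝ → M → Ambient d) (κ : ℝ → M → ℝ)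
    (hX : ∀ τ ∈ Set.Icc (t 0) (t N), Encloses 𝓚 (X τ) (Ω τ))
    (hsol : IsSDSolution 𝓚 V s N t X₀ Ω X p R κ) :
    ∀ n < N,
      volume.real (Ω (t (n + 1))) = volume.real (Ω (t n)) ∧
      area 𝓚 (X (t (n + 1))) - area 𝓚 (X (t n)) =
        -∫ τ in Set.Ioo (t n) (t (n + 1)), gradNormSq 𝓚 (X τ) (κ τ) ∧
      -∫ τ in Set.Ioo (t n) (t (n + 1)), gradNormSq 𝓚 (X τ) (κ τ) ≤ 0 := by
  intro n hn
  have hmono : ∀ m ≤ N, ∀ l ≤ m, t l ≤ t m := by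
    intro m
    induction m with
    | zero => intro _ l hl; rw [Nat.le_zero.1 hl]
    | succ m ih =>
      intro hm l hl
      rcases Nat.le_succ_iff.1 hl with h | h
      · exact (ih (by omega) l h).trans (ht m (by omega)).le
      · rw [h]
  have hab := ht n hn
  have hsub : Icc (t n) (t (n + 1)) ⊆ Icc (t 0) (t N) :=
    Icc_subset_Icc (hmono n hn.le 0 (Nat.zero_le _)) (hmono N le_rfl (n + 1) hn)
  obtain ⟨c, hcV, hXc⟩ := hsol.poly_X n hn
  obtain ⟨cp, hpV, hpc⟩ := hsol.poly_p n hn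
  obtain ⟨cR, hRV, hRc⟩ := hsol.poly_R n hn
  obtain ⟨cκ, hκV, hκc⟩ := hsol.poly_κ n hn
  have hv := hsol.eq_velocity n hn
  -- The test functions are `Q = R`, `q = p`, `Λ = Ẋ` and `y = κ`.
  have hm := hsol.eq_multiplier n hn R (hsol.poly_R n hn)
  have haux := hsol.eq_auxiliary n hn p (hsol.poly_p n hn)
  have hcurv := hsol.eq_curvature n hn (velocity X)
  have hκ := hv κ (hsol.poly_κ n hn)
  set a := t n
  set b := t (n + 1)
  replace hXc : ∀ τ ∈ Icc a b, X τ = timePoly s c τ := hXc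
  replace hpc : ∀ τ ∈ Ioo a b, p τ = timePoly (s - 1) cp τ := hpc
  replace hRc : ∀ τ ∈ Ioo a b, R τ = timePoly (s - 1) cR τ := hRc
  replace hκc : ∀ τ ∈ Ioo a b, κ τ = timePoly (s - 1) cκ τ := hκc
  have hc := fun j => hV.isCellSmooth_vec (hcV j)
  have hp := fun j => hV.isCellSmooth (hpV j)
  have hR := fun j => hV.isCellSmooth_vec (hRV j)
  have hκ' := fun j => hV.isCellSmooth (hκV j)
  have hcc := fun j => hV.continuous_vec (hcV j)
  have hc' := derivCoeff_isCellSmooth hc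
  have hI : ∀ τ ∈ Icc a b, Encloses 𝓚 (timePoly s c τ) (Ω τ) := fun τ hτ =>
    hXc τ hτ ▸ hX τ (hsub hτ)
  have hJ : ∀ τ ∈ Icc a b, ∀ K, ∀ u ∈ 𝓚.dom K, 0 < jacobian 𝓚 (timePoly s c τ) K u :=
    fun τ hτ => (hI τ hτ).jacobian_pos
  have hZ := isSmoothMotion_timePoly (k := s) hc hcc
  -- This is restricted to the open slab, since at its ends `deriv` would also see the neighbouring
  -- slab.
  have hvelZ : ∀ τ ∈ Ioo a b, velocity X τ = velocity (timePoly s c) τ := by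
    intro τ hτ
    funext ξ
    refine Filter.EventuallyEq.deriv_eq ?_
    filter_upwards [Icc_mem_nhds hτ.1 hτ.2] with σ hσ
    rw [hXc σ hσ]
  have hvel : ∀ τ ∈ Ioo a b, velocity X τ = timePoly (s - 1) (derivCoeff c) τ := fun τ hτ => by
    rw [hvelZ τ hτ, velocity_timePoly hs]
  have hXo : ∀ τ ∈ Ioo a b, X τ = timePoly s c τ := fun τ hτ => hXc τ (Ioo_subset_Icc_self hτ)
  -- Differentiation lowers the degree in time from `s` to `s - 1`, which makes the velocity
  -- admissible as a test function.
  replace hcurv := hcurv ⟨derivCoeff c, fun j => (vecSpace d V).smul_mem _ (hcV (j + 1)), hvel⟩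
  have hone := hv (fun _ _ => 1) ⟨fun j => if j = 0 then fun _ => 1 else 0,
    fun j => by
      dsimp only
      split_ifs
      exacts [hV.one_mem, V.zero_mem], fun τ _ => by simp⟩
  refine ⟨?_, ?_, ?_⟩
  · rw [← sub_eq_zero, hZ.volume_sub hI hab]
    simp only [gradInner_one_right, integral_zero] at hone
    rw [← hone]
    exact setIntegral_congr_fun measurableSet_Ioo fun τ hτ => by
      simp only [hXo τ hτ, hvelZ τ hτ]
  · have i1 : IntegrableOn (fun τ => gradInnerVec 𝓚 (X τ) (R τ) (velocity X τ)) (Ioo a b) :=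
      (integrableOn_gradInnerVec_timePoly (k₁ := s - 1) (k₂ := s - 1) hc hJ hR hc').congr_fun
        (fun τ hτ => by simp only [hXo τ hτ, hRc τ hτ, hvel τ hτ]) measurableSet_Ioo
    have i2 : IntegrableOn (fun τ => scaledNormalInner 𝓚 (Ω τ) (X τ) (p τ) (R τ)) (Ioo a b) :=
      (integrableOn_scaledNormalInner_timePoly (k₁ := s - 1) (k₂ := s - 1) hc hcc hI hp hR).congr_fun
        (fun τ hτ => by simp only [hXo τ hτ, hRc τ hτ, hpc τ hτ]) measurableSet_Ioo
    have i3 : IntegrableOn (fun τ => scaledNormalInner 𝓚 (Ω τ) (X τ) (κ τ) (velocity X τ))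
        (Ioo a b) :=
      (integrableOn_scaledNormalInner_timePoly (k₁ := s - 1) (k₂ := s - 1) hc hcc hI hκ' hc').congr_fun
        (fun τ hτ => by simp only [hXo τ hτ, hκc τ hτ, hvel τ hτ]) measurableSet_Ioo
    simp only [gradInnerVec_comm (𝓚 := 𝓚) _ (velocity X _) (R _)] at hm
    rw [integral_add i1 i2] at hm
    rw [integral_add i1 i3] at hcurv
    simp only [scaledNormalInner_eq_normalInner] at hm hcurv
    simp only [gradInner_self] at hκ
    rw [hXc b (right_mem_Icc.2 hab.le), hXc a (left_mem_Icc.2 hab.le), area_sub hc hJ hs hab.le]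
    have harea : ∫ τ in Ioo a b, gradInnerVec 𝓚 (timePoly s c τ) (timePoly s c τ)
        (velocity (timePoly s c) τ) =
        ∫ τ in Ioo a b, gradInnerVec 𝓚 (X τ) (X τ) (velocity X τ) :=
      setIntegral_congr_fun measurableSet_Ioo fun τ hτ => by simp only [hXo τ hτ, hvelZ τ hτ]
    rw [harea]
    -- By `hm` and `haux` the term with the gradients of `R` and the velocity vanishes, by `hκ` the
    -- curvature term is the dissipation, and `hcurv` combines them.
    linarith
  · exact neg_nonpos.2 (integral_nonneg fun τ => gradNormSq_nonneg _ _)
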